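/- All graphs are finite and simple, and $n(G)$ and $m(G)$ denote the numbers of vertices and edges of $G$. A graph is claw-free if it has no induced $K_{1,3}$. Consider the following nondeterministic algorithm PMinCF. It maintains a graph $G$ (initially the input), a path $P:u_1\ldots u_k$ in $G$ (initially $k=0$), a set $M$ of edges (initially empty), and an integer $\mathrm{lm}(u)$ for each vertex $u$ (initially $-1$). As long as $n(G)\geq 2$, it does the following. (0) If $k=0$, it chooses some edge $uv$ of $G$ and sets $k=2$, $u_1=u$, $u_2=v$. (1) If $u_k$ has a neighbor $v$ in $G$ not on $P$, it chooses such a $v$, appends it to $P$ (end-extension), and repeats (1). Otherwise, if $\mathrm{lm}(u_k)=-1$, it sets $\mathrm{lm}(u_k)$ to the largest $\ell\in\{1,\ldots,k-1\}$ such that $u_k$ is adjacent to $u_{k-1},\ldots,u_{k-\ell}$; then, if $\mathrm{lm}(u_k)\geq 2$ and $u_{k-1}$ has a neighbor $v$ in $G$ not on $P$, it chooses such a $v$, decreases $\mathrm{lm}(u_k)$ by $1$, increases $\mathrm{lm}(u_{k-1})$ by $1$ if that value is not $-1$, replaces $P$ by $u_1\ldots u_{k-2}u_ku_{k-1}v$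 (swap-extension), and repeats (1). (2) If neither extension was made, it adds the edge $u_{k-1}u_k$ to $M$, removes $u_{k-1}$ and $u_k$ from $G$, and replaces $P$ by $u_1\ldots u_{k-2}$. When $n(G)<2$, it returns $M$. Theorem 1. (a) For every connected claw-free graph $G$ of even order, PMinCF works correctly: whatever choices are made, every execution terminates, no execution gets stuck, and the returned set $M$ is a perfect matching of $G$. (b) PMinCF can be implemented to run in $O(m(G))$ time: there are a program for a random access machine with unit costs and a constant $C$ such that, for every connected claw-free graph $G$ of even order, given by arbitrarily ordered neighborhood lists, the program carries out an execution of PMinCF on $G$ and halts within $C\cdot m(G)$ steps. (c) It can be decided in linear time whether a given claw-free graph has a unique perfect matching: there are a program for a random access machine with unit costs and a constant $C$ such that, for every claw-free graph $G$ given by neighborhood lists, the program halts within $C\cdot(n(G)+m(G)+1)$ steps and decides whether $G$ has exactly one perfect matching. -/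

import Mathlib

/-! # Claw-free graphs and perfect matchings given by edge sets -/

/-- `G` has no induced subgraph isomorphic to the claw `K_{1,3}`. -/
def ClawFree {V : Type*} (G : SimpleGraph V) : Prop :=
  ¬ (completeBipartiteGraph (Fin 1) (Fin 3)).IsIndContained G

/-- The set of edges `M` is (the edge set of) a perfect matching of `G`. -/
def IsPerfectMatchingSet {V : Type*} (G : SimpleGraph V) (M : Finset (Sym2 V)) : Prop :=
  ∃ P : G.Subgraph, P.IsPerfectMatching ∧ P.edgeSet = (M : Set (Sym2 V))

/-- `G` has exactly one perfect matching. -/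
def HasUniquePerfectMatching {V : Type*} (G : SimpleGraph V) : Prop :=
  ∃! P : G.Subgraph, P.IsPerfectMatching

/-! # The algorithm `PMinCF`

`PMinCF` is a nondeterministic transition system: whenever the algorithm picks "some" edge or
"some" neighbor, there is one transition for every possible pick. -/

namespace PMinCF

/-- Control points: the test of the outer `while`-loop, the start of the body of the `repeat`-loop,
the test for a swap-extension, the lines after the `repeat`-loop, and termination. -/
inductive Point
  | outer
  | body
  | swapTest
  | cut
  | halted

structure State (V : Type*) where
  point : Point
  /-- the vertex set of the current graph, which is the subgraph of the input induced by it -/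
  rem : Finset V
  /-- the path `u_1 … u_k`, listed from its last vertex to its first: `[u_k, …, u_1]` -/
  path : List V
  /-- the value `lm_nb(u)`; it is `-1` as long as it has not been determined -/
  lm : V → ℤ
  /-- the matching constructed so far -/
  M : Finset (Sym2 V)

variable {V : Type*}

/-- The state in which `PMinCF` starts. -/
def start (V : Type*) [Fintype V] : State V where
  point := .outer
  rem := Finset.univ
  path := []
  lm := fun _ => -1
  M := ∅

/-- `v` is a neighbor of `w` in the current graph. -/
def Nbr (G : SimpleGraph V) (s : State V) (w v : V) : Prop :=
  v ∈ s.rem ∧ G.Adj w v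

/-- There is a neighbor of `w` in the current graph that does not lie on the path. -/
def HasNewNbr (G : SimpleGraph V) (s : State V) (w : V) : Prop :=
  ∃ v, Nbr G s w v ∧ v ∉ s.path

/-- For `back = [u_{k-1}, …, u_1]`, the set of all `ℓ ∈ [k-1]` such that `u_{k-i}` is a neighbor of
`w` for every `i ∈ [ℓ]`. -/
def lmSet (G : SimpleGraph V) (s : State V) (w : V) (back : List V) : Set ℕ :=
  {l | 1 ≤ l ∧ l ≤ back.length ∧ ∀ x ∈ back.take l, Nbr G s w x}

/-- The values of `lm_nb` after `u_k = x` and `u_{k-1} = y` have been swapped. -/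
def swapLm [DecidableEq V] (lm : V → ℤ) (x y : V) : V → ℤ :=
  let lm₁ := Function.update lm x (lm x - 1)
  if lm₁ y ≠ -1 then Function.update lm₁ y (lm₁ y + 1) else lm₁

/-- `Step G s t`: on the input graph `G`, the algorithm can move from `s` to `t`. -/
inductive Step [DecidableEq V] (G : SimpleGraph V) : State V → State V → Prop
  /-- the `while`-loop ends: the current graph has less than two vertices -/
  | stop_while (s : State V) : s.point = .outer → s.rem.card < 2 →
      Step G s { s with point := .halted }
  /-- the path is empty and is reinitialized with some edge `uv` of the current graph -/
  | restart (s : State V) (u v : V) : s.point = .outer → 2 ≤ s.rem.card → s.path = [] →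
      u ∈ s.rem → Nbr G s u v →
      Step G s { s with point := .body, path := [v, u] }
  /-- the path is not empty and is kept -/
  | keep (s : State V) : s.point = .outer → 2 ≤ s.rem.card → s.path ≠ [] →
      Step G s { s with point := .body }
  /-- an end-extension, after which the `repeat`-loop is executed again -/
  | end_extension (s : State V) (w v : V) (p : List V) : s.point = .body → s.path = w :: p →
      Nbr G s w v → v ∉ s.path →
      Step G s { s with path := v :: w :: p }
  /-- there is no end-extension, and `lm_nb(u_k)` is known -/
  | lm_known (s : State V) (w : V) (p : List V) : s.point = .body → s.path = w :: p →
      ¬ HasNewNbr G s w → s.lm w ≠ -1 →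
      Step G s { s with point := .swapTest }
  /-- there is no end-extension, and `lm_nb(u_k)` is determined for the first time -/
  | lm_compute (s : State V) (w : V) (p : List V) (l : ℕ) : s.point = .body → s.path = w :: p →
      ¬ HasNewNbr G s w → s.lm w = -1 → IsGreatest (lmSet G s w p) l →
      Step G s { s with point := .swapTest, lm := Function.update s.lm w (l : ℤ) }
  /-- a swap-extension, after which the `repeat`-loop is executed again -/
  | swap_extension (s : State V) (x y v : V) (p : List V) : s.point = .swapTest →
      s.path = x :: y :: p → 2 ≤ s.lm x → Nbr G s y v → v ∉ s.path →
      Step G s { s with point := .body, path := v :: y :: x :: p, lm := swapLm s.lm x y }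
  /-- neither extension is possible: the `repeat`-loop ends -/
  | no_extension (s : State V) (x y : V) (p : List V) : s.point = .swapTest →
      s.path = x :: y :: p → ¬ (2 ≤ s.lm x ∧ HasNewNbr G s y) →
      Step G s { s with point := .cut }
  /-- the last edge of the path is added to the matching, and its ends are removed -/
  | match_last (s : State V) (x y : V) (p : List V) : s.point = .cut → s.path = x :: y :: p →
      Step G s { s with point := .outer, rem := s.rem \ {x, y}, path := p,
                        M := insert s(y, x) s.M }

/-- `PMinCF` works correctly on `G`, whatever choices are made: no execution is infinite, no
execution gets stuck before the algorithm halts, and when it halts, `M` is a perfect matching. -/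
def WorksCorrectly [Fintype V] [DecidableEq V] (G : SimpleGraph V) : Prop :=
  (¬ ∃ f : ℕ → State V, f 0 = start V ∧ ∀ i, Step G (f i) (f (i + 1))) ∧
  ∀ s, Relation.ReflTransGen (Step G) (start V) s →
    (s.point ≠ .halted → ∃ t, Step G s t) ∧
    (s.point = .halted → IsPerfectMatchingSet G s.M)

end PMinCF

/-! # A random access machine with unit costs

A program uses finitely many registers and finitely many arrays, all holding natural numbers. The
only arithmetic operations are increment and decrement, so that after `t` steps no number
exceeds the largest number in the input or in the program by more than `t`; hence all numbers
occurring in a linear-time computation fit into machine words of logarithmic length. -/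

namespace RAM

/-- Comparisons of two registers. -/
inductive Test
  | eq (x y : ℕ)
  | lt (x y : ℕ)

inductive Cmd
  | skip
  /-- register `x` gets the constant `c` -/
  | const (x c : ℕ)
  /-- register `x` gets the value of register `y` -/
  | copy (x y : ℕ)
  | inc (x : ℕ)
  | dec (x : ℕ)
  /-- register `x` gets the entry of array `a` whose index is the value of register `i` -/
  | load (x a i : ℕ)
  /-- the entry of array `a` whose index is the value of register `i` gets the value of `x` -/
  | save (a i x : ℕ)
  | seq (c d : Cmd)
  | cond (b : Test) (c d : Cmd)
  | while (b : Test) (c : Cmd)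

structure Store where
  reg : ℕ → ℕ
  arr : ℕ → ℕ → ℕ

namespace Store

def setReg (σ : Store) (x v : ℕ) : Store :=
  { σ with reg := Function.update σ.reg x v }

def setArr (σ : Store) (a i v : ℕ) : Store :=
  { σ with arr := Function.update σ.arr a (Function.update (σ.arr a) i v) }

end Store

def Test.eval (σ : Store) : Test → Bool
  | .eq x y => decide (σ.reg x = σ.reg y)
  | .lt x y => decide (σ.reg x < σ.reg y)

/-- The commands that are still to be executed, the next one first, and the current store. -/
structure Config where
  code : List Cmd
  store : Store

/-- One step of the machine. A configuration without code is final. -/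
def step : Config → Config
  | ⟨[], σ⟩ => ⟨[], σ⟩
  | ⟨.skip :: K, σ⟩ => ⟨K, σ⟩
  | ⟨.const x c :: K, σ⟩ => ⟨K, σ.setReg x c⟩
  | ⟨.copy x y :: K, σ⟩ => ⟨K, σ.setReg x (σ.reg y)⟩
  | ⟨.inc x :: K, σ⟩ => ⟨K, σ.setReg x (σ.reg x + 1)⟩
  | ⟨.dec x :: K, σ⟩ => ⟨K, σ.setReg x (σ.reg x - 1)⟩
  | ⟨.load x a i :: K, σ⟩ => ⟨K, σ.setReg x (σ.arr a (σ.reg i))⟩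
  | ⟨.save a i x :: K, σ⟩ => ⟨K, σ.setArr a (σ.reg i) (σ.reg x)⟩
  | ⟨.seq c d :: K, σ⟩ => ⟨c :: d :: K, σ⟩
  | ⟨.cond b c d :: K, σ⟩ => ⟨(if b.eval σ then c else d) :: K, σ⟩
  | ⟨.while b c :: K, σ⟩ => ⟨if b.eval σ then c :: .while b c :: K else K, σ⟩

/-- The configuration that program `p`, started on the store `σ`, reaches after `t` steps. -/
def after (p : Cmd) (σ : Store) (t : ℕ) : Config :=
  step^[t] ⟨[p], σ⟩

/-- `adj u` lists the neighbors of `u` in `G`, without repetition, in an arbitrary order. -/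
def IsNeighborhoodLists {n : ℕ} (G : SimpleGraph (Fin n)) (adj : Fin n → List (Fin n)) : Prop :=
  ∀ u, (adj u).Nodup ∧ ∀ v, v ∈ adj u ↔ G.Adj u v

/-- The store holding a graph given by neighborhood lists. Register `0` holds the number `n` of
vertices, array `1` holds the concatenation of the lists of the vertices `0, …, n - 1`, and the
list of vertex `u` starts at the position given by entry `u` of array `0` and ends before the
position given by entry `u + 1`. Everything else is `0`. -/
def input {n : ℕ} (adj : Fin n → List (Fin n)) : Store where
  reg := fun x => if x = 0 then n else 0
  arr := fun a i =>
    if a = 0 then (((List.ofFn adj).take i).map List.length).sum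
    else if a = 1 then ((List.ofFn adj).flatten.map Fin.val).getD i 0
    else 0

end RAM

/-! # Implementations -/

namespace PMinCF

open RAM

/-- The store `σ` holds the variables of the state `s` of `PMinCF`: register `1` holds `k`, and array
`2` holds `u_1, …, u_k`; array `3` holds `lm_nb`, shifted by one; register `2` holds the number of
edges in `M`, and arrays `4` and `5` hold the ends of these edges; array `6` is zero
exactly at the vertices of the current graph. -/
structure Represents {n : ℕ} (s : State (Fin n)) (σ : Store) : Prop where
  path_length : σ.reg 1 = s.path.length
  path_eq : ∀ i, (h : i < s.path.reverse.length) → σ.arr 2 i = (s.path.reverse[i] : Fin n)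
  lm_eq : ∀ v : Fin n, (σ.arr 3 v : ℤ) = s.lm v + 1
  card_M : σ.reg 2 = s.M.card
  mem_M : ∀ e, e ∈ s.M ↔
    ∃ i < σ.reg 2, ∃ a b : Fin n, σ.arr 4 i = a ∧ σ.arr 5 i = b ∧ e = s(a, b)
  mem_rem : ∀ v : Fin n, v ∈ s.rem ↔ σ.arr 6 v = 0

/-- On the graph `G` given by the neighborhood lists `adj`, program `p` halts within `T` steps and
carries out an execution `s 0, s 1, …, s N` of `PMinCF` from its start until it halts: the variables
of `s i` are in the store at time `τ i`, and those of `s N` are in the final store. -/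
def ImplementedWithin {n : ℕ} (p : Cmd) (G : SimpleGraph (Fin n)) (adj : Fin n → List (Fin n))
    (T : ℕ) : Prop :=
  ∃ (N : ℕ) (s : ℕ → State (Fin n)) (τ : ℕ → ℕ),
    s 0 = start (Fin n) ∧
    (∀ i < N, Step G (s i) (s (i + 1)) ∧ τ i ≤ τ (i + 1)) ∧
    (s N).point = .halted ∧
    (∀ i ≤ N, Represents (s i) (after p (input adj) (τ i)).store) ∧
    (after p (input adj) (τ N)).code = [] ∧
    τ N ≤ T

end PMinCF

namespace RAM

/-- On the graph given by the neighborhood lists `adj`, program `p` halts within `T` steps, and the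
final value of register `1` is `1` if `Q` holds and `0` if `Q` fails. -/
def DecidesWithin {n : ℕ} (p : Cmd) (adj : Fin n → List (Fin n)) (Q : Prop) (T : ℕ) : Prop :=
  (after p (input adj) T).code = [] ∧
  (Q → (after p (input adj) T).store.reg 1 = 1) ∧
  (¬ Q → (after p (input adj) T).store.reg 1 = 0)

end RAM

/-! # Claws and connectivity -/

/-! Correctness rests on `connectedOn_sdiff`: when no extension is possible, deleting y = u_{k-1}
and x = u_k keeps the current graph connected. Every component of the rest sees x or y, and x has no
neighbor off the path. So a component that misses the remaining path contains a neighbor of y off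
the path that is not adjacent to x. As no swap-extension is possible, lm(x) is at most 1, so x is
not adjacent to u_{k-2}; since y is not the center of a claw, that neighbor is adjacent to u_{k-2},
which lies on the remaining path. If k = 2, any two such neighbors, taken in different components,
would be adjacent for the same reason. Hence there is only one component. Connectivity and even
order keep the algorithm from getting stuck, exactness of lm survives swaps by the stated
corrections by one, and a potential built from n(G) and k bounds the number of steps.

The running time is an amortized count. A vertex leaves the path only by being deleted, so "visited"
is permanent and one forward-moving pointer per vertex finds all new neighbors. Each lm is computed
from scratch once, by marking the neighborhood of the vertex and walking back along the path while
marks are found, which costs at most twice its degree. Together with n ≤ m + 1 for connected graphs,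
this is O(m).

For uniqueness of the perfect matching, two reductions are used: delete a leaf with its neighbor, or
delete two adjacent vertices of degree two with a common neighbor ("twins"). Every perfect matching
contains the deleted edge, so both reductions preserve unique matchability in both directions.
Conversely, a nonempty claw-free graph with a unique perfect matching admits one of them
(`UniquelyMatchable.exists_isLeafOn_or_areTwinsOn`): look at the end of a longest alternating path;
a further neighbor would extend the path or, by claw-freeness, close an alternating cycle, and an
alternating cycle yields a second perfect matching. So exhaustive reduction ends with the empty
graph exactly if the perfect matching is unique. A stack of candidates and a window of three
positions on each neighborhood list make this linear.

Both programs are a single loop around a loop-free body that dispatches on a control register, so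
that `exists_after_eq_nil` turns a decreasing potential into a bound on machine steps. -/

theorem ClawFree.adj_of_adj {V : Type*} {G : SimpleGraph V} (h : ClawFree G) {c x y z : V}
    (hx : G.Adj c x) (hy : G.Adj c y) (hz : G.Adj c z) (hxy : x ≠ y) (hxz : x ≠ z) (hyz : y ≠ z) :
    G.Adj x y ∨ G.Adj x z ∨ G.Adj y z := by
  by_contra! hn
  obtain ⟨h1, h2, h3⟩ := hn
  let f : Fin 1 ⊕ Fin 3 → V := Sum.elim (fun _ => c) ![x, y, z]
  have hf : Function.Injective f := by
    rintro (a | a) (b | b) hab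
    · simp [Subsingleton.elim a b]
    · fin_cases b <;> simp [f] at hab
      exacts [(hx.ne hab).elim, (hy.ne hab).elim, (hz.ne hab).elim]
    · fin_cases a <;> simp [f] at hab
      exacts [(hx.ne hab.symm).elim, (hy.ne hab.symm).elim, (hz.ne hab.symm).elim]
    · fin_cases a <;> fin_cases b <;> simp_all [f]
  have hadj : ∀ a b, G.Adj (f a) (f b) ↔ (completeBipartiteGraph (Fin 1) (Fin 3)).Adj a b := by
    rintro (a | a) (b | b)
    · simp [f]
    · fin_cases b <;> simp [f, hx, hy, hz]
    · fin_cases a <;> simp [f, hx.symm, hy.symm, hz.symm]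
    · fin_cases a <;> fin_cases b <;> simp [f, h1, h2, h3, G.adj_comm y x, G.adj_comm z x,
        G.adj_comm z y]
  exact h ⟨⟨⟨f, hf⟩, hadj _ _⟩⟩

/-- The subgraph of `G` induced by `S` is connected (or empty): no proper nonempty subset of `S` is
closed under taking neighbors in `S`. -/
def ConnectedOn {V : Type*} (G : SimpleGraph V) (S : Finset V) : Prop :=
  ∀ A : Set V, A ⊆ S → A.Nonempty → (∀ a ∈ A, ∀ b ∈ S, G.Adj a b → b ∈ A) → (S : Set V) ⊆ A

theorem SimpleGraph.Connected.connectedOn_univ {V : Type*} [Fintype V] {G : SimpleGraph V}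
    (h : G.Connected) : ConnectedOn G Finset.univ := by
  rintro A - ⟨a, ha⟩ hA b -
  obtain ⟨w⟩ := h.preconnected a b
  induction w with
  | nil => exact ha
  | cons hadj _ ih => exact ih (hA _ ha _ (Finset.mem_univ _) hadj)

theorem ConnectedOn.exists_adj {V : Type*} {G : SimpleGraph V} {S : Finset V}
    (h : ConnectedOn G S) (hS : 2 ≤ S.card) {u : V} (hu : u ∈ S) : ∃ v ∈ S, G.Adj u v := by
  by_contra! hn
  have := h {u} (by simpa using hu) ⟨u, rfl⟩ (by
    rintro a rfl b hb hab
    exact (hn b hb hab).elim)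
  have h1 : S ⊆ {u} := fun v hv => by simpa using this hv
  have := Finset.card_le_card h1
  simp at this
  omega

/-- A path is connected. For `connectedOn_sdiff`: two disjoint closed sets cannot both meet the
remaining path. -/
theorem List.IsChain.mem_of_closed {V : Type*} {G : SimpleGraph V} {p : List V}
    (hp : p.IsChain G.Adj) {A : Set V} (hA : ∀ a ∈ A, ∀ b ∈ p, G.Adj a b → b ∈ A) {a : V}
    (ha : a ∈ A) (hap : a ∈ p) : ∀ b ∈ p, b ∈ A := by
  induction p generalizing a with
  | nil => simp
  | cons c p ih =>
    have hA' : ∀ a ∈ A, ∀ b ∈ p, G.Adj a b → b ∈ A := fun a ha b hb =>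
      hA a ha b (List.mem_cons_of_mem _ hb)
    rcases p with _ | ⟨d, p⟩
    · intro b hb
      simp only [List.mem_singleton] at hb hap
      rwa [hb, ← hap]
    · rw [List.isChain_cons_cons] at hp
      rcases List.mem_cons.1 hap with rfl | hap
      · have hd : d ∈ A := hA _ ha d (by simp) hp.1
        intro b hb
        rcases List.mem_cons.1 hb with rfl | hb
        · exact ha
        · exact ih hp.2 hA' hd (by simp) b hb
      · have := ih hp.2 hA' ha hap
        intro b hb
        rcases List.mem_cons.1 hb with rfl | hb
        · exact hA d (this d (by simp)) b (by simp) hp.1.symm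
        · exact this b hb

/-! ### Invariants, correctness and termination of `PMinCF` -/

namespace PMinCF

variable {V : Type*}

/-- The number of entries of the longest initial segment of a list that consists of neighbors of
`w`. -/
noncomputable def adjRun (G : SimpleGraph V) (w : V) : List V → ℕ
  | [] => 0
  | x :: p => open Classical in if G.Adj w x then adjRun G w p + 1 else 0

theorem adjRun_cons_of_adj {G : SimpleGraph V} {w x : V} (h : G.Adj w x) (p : List V) :
    adjRun G w (x :: p) = adjRun G w p + 1 := by
  simp [adjRun, h]

theorem adjRun_cons_of_not_adj {G : SimpleGraph V} {w x : V} (h : ¬ G.Adj w x) (p : List V) :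
    adjRun G w (x :: p) = 0 := by
  simp [adjRun, h]

theorem adjRun_append {G : SimpleGraph V} {w : V} {p : List V} (h : ∀ x ∈ p, G.Adj w x)
    (q : List V) : adjRun G w (p ++ q) = p.length + adjRun G w q := by
  induction p with
  | nil => simp
  | cons x p ih =>
    rw [List.cons_append, adjRun_cons_of_adj (h x (by simp)),
      ih fun y hy => h y (List.mem_cons_of_mem _ hy), List.length_cons]
    omega

theorem adjRun_le_length (G : SimpleGraph V) (w : V) (p : List V) :
    adjRun G w p ≤ p.length := by
  induction p with
  | nil => simp [adjRun]
  | cons x p ih =>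
    simp only [adjRun, List.length_cons]
    split_ifs <;> omega

theorem le_adjRun_iff {G : SimpleGraph V} {w : V} {p : List V} {l : ℕ} (hl : l ≤ p.length) :
    l ≤ adjRun G w p ↔ ∀ x ∈ p.take l, G.Adj w x := by
  induction p generalizing l with
  | nil => simp_all
  | cons x p ih =>
    rcases l with _ | l
    · simp
    · simp only [List.length_cons, Nat.add_le_add_iff_right] at hl
      by_cases hx : G.Adj w x
      · simp [adjRun_cons_of_adj hx, ih hl, hx]
      · simp [adjRun_cons_of_not_adj hx, hx]

/-- Links the value chosen by the algorithm to `adjRun`. Membership in the current graph is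
automatic for path vertices; positivity is stated separately because `lmSet` is empty when the run
is 0. -/
theorem isGreatest_lmSet_iff {G : SimpleGraph V} {s : State V} {w : V} {p : List V}
    (hp : ∀ x ∈ p, x ∈ s.rem) {l : ℕ} :
    IsGreatest (lmSet G s w p) l ↔ l = adjRun G w p ∧ 1 ≤ l := by
  have key : ∀ k, k ∈ lmSet G s w p ↔ 1 ≤ k ∧ k ≤ adjRun G w p := by
    intro k
    simp only [lmSet, Nbr, Set.mem_ofPred_eq]
    constructor
    · rintro ⟨h1, h2, h3⟩
      exact ⟨h1, (le_adjRun_iff h2).2 fun x hx => (h3 x hx).2⟩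
    · rintro ⟨h1, h2⟩
      have h3 := h2.trans (adjRun_le_length G w p)
      exact ⟨h1, h3, fun x hx => ⟨hp x (List.mem_of_mem_take hx), (le_adjRun_iff h3).1 h2 x hx⟩⟩
  constructor
  · rintro ⟨h1, h2⟩
    have h3 := (key l).1 h1
    exact ⟨le_antisymm h3.2 (h2 ((key _).2 ⟨h3.1.trans h3.2, le_rfl⟩)), h3.1⟩
  · rintro ⟨h1, h2⟩
    exact ⟨(key l).2 ⟨h2, h1.le⟩, fun k hk => h1 ▸ ((key k).1 hk).2⟩

/-- For every vertex `w` of the path, `lm w` is undetermined, or it is the number of the vertices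
immediately before `w` that are adjacent to `w`, and this number is positive. -/
def LmExact (G : SimpleGraph V) (lm : V → ℤ) : List V → Prop
  | [] => True
  | w :: p => (lm w = -1 ∨ lm w = adjRun G w p ∧ 1 ≤ lm w) ∧ LmExact G lm p

theorem LmExact.congr {G : SimpleGraph V} {lm lm' : V → ℤ} {p : List V} (h : LmExact G lm p)
    (heq : ∀ v ∈ p, lm' v = lm v) : LmExact G lm' p := by
  induction p with
  | nil => trivial
  | cons w p ih =>
    refine ⟨?_, ih h.2 fun v hv => heq v (List.mem_cons_of_mem _ hv)⟩
    rw [heq w (by simp)]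
    exact h.1

/-- The invariants of `PMinCF`. -/
structure Inv (G : SimpleGraph V) (s : State V) : Prop where
  path_sub : ∀ v ∈ s.path, v ∈ s.rem
  nodup : s.path.Nodup
  chain : s.path.IsChain G.Adj
  lmExact : LmExact G s.lm s.path
  lm_off : ∀ v ∈ s.rem, v ∉ s.path → s.lm v = -1
  conn : ConnectedOn G s.rem
  even : Even s.rem.card
  adj_of_mem : ∀ a b, s(a, b) ∈ s.M → G.Adj a b ∧ a ∉ s.rem ∧ b ∉ s.rem
  existsUnique : ∀ a ∉ s.rem, ∃! b, s(a, b) ∈ s.M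
  two_le : s.point ≠ .outer → s.point ≠ .halted → 2 ≤ s.rem.card
  body : s.point = .body → s.path ≠ []
  no_end : s.point = .swapTest ∨ s.point = .cut → ∃ x y p, s.path = x :: y :: p ∧
    ¬ HasNewNbr G s x ∧ s.lm x ≠ -1
  no_swap : s.point = .cut → ∀ x y p, s.path = x :: y :: p → ¬ (2 ≤ s.lm x ∧ HasNewNbr G s y)
  halted : s.point = .halted → s.rem.card < 2

/-- The key to the correctness of `PMinCF`: deleting the last two vertices of the path preserves
connectivity if no extension is possible. -/
theorem connectedOn_sdiff [DecidableEq V] {G : SimpleGraph V} (hG : ClawFree G) {S : Finset V}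
    (hS : ConnectedOn G S) {x y : V} {p : List V} (hp : ∀ v ∈ x :: y :: p, v ∈ S)
    (hnd : (x :: y :: p).Nodup) (hch : (x :: y :: p).IsChain G.Adj)
    (hx : ∀ v ∈ S, G.Adj x v → v ∈ x :: y :: p)
    (hy : adjRun G x (y :: p) ≤ 1 ∨ ∀ v ∈ S, G.Adj y v → v ∈ x :: y :: p) :
    ConnectedOn G (S \ {x, y}) := by
  have hxS : x ∈ S := hp x (by simp)
  rw [List.isChain_cons_cons] at hch
  obtain ⟨hxy, hch⟩ := hch
  -- every closed set meets the remaining path or contains a private neighbor of `y`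
  have key : ∀ A : Set V, A ⊆ ↑(S \ {x, y}) → A.Nonempty →
      (∀ a ∈ A, ∀ b ∈ S \ {x, y}, G.Adj a b → b ∈ A) →
      (∃ a ∈ A, a ∈ p) ∨ (p = [] ∧ ∃ a ∈ A, G.Adj y a ∧ ¬ G.Adj x a) := by
    intro A hA hne hcl
    have hA' : ∀ a ∈ A, a ∈ S ∧ a ≠ x ∧ a ≠ y := fun a ha => by simpa using hA ha
    -- Otherwise `A` would be closed in all of `S`, hence contain `x` by connectivity.
    have : ∃ a ∈ A, G.Adj x a ∨ G.Adj y a := by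
      by_contra! hn
      have := hS A (fun a ha => (hA' a ha).1) hne (by
        intro a ha b hb hab
        refine hcl a ha b ?_ hab
        simp only [Finset.mem_sdiff, hb, Finset.mem_insert, Finset.mem_singleton, true_and]
        rintro (rfl | rfl)
        · exact (hn a ha).1 hab.symm
        · exact (hn a ha).2 hab.symm)
      exact (hA' x (this hxS)).2.1 rfl
    obtain ⟨a, ha, hadj⟩ := this
    obtain ⟨haS, hax, hay⟩ := hA' a ha
    by_cases hap : a ∈ p
    · exact Or.inl ⟨a, ha, hap⟩
    have hxa : ¬ G.Adj x a := fun h => by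
      have := hx a haS h
      simp_all
    have hya : G.Adj y a := by tauto
    rcases hy with hy | hy
    · rcases p with _ | ⟨z, p⟩
      · exact Or.inr ⟨rfl, a, ha, hya, hxa⟩
      -- `y` already contributes 1 to the run of `x`, so a run of at most 1 stops before `z`.
      · have hxz : ¬ G.Adj x z := fun h => by
          rw [adjRun_cons_of_adj hxy, adjRun_cons_of_adj h] at hy
          omega
        rw [List.isChain_cons_cons] at hch
        -- The vertex `y` has the neighbors `x`, `z`, `a`, and `x` is adjacent to neither of the
        -- others.
        have hza : G.Adj z a := by
          have hzx : x ≠ z := by rintro rfl; simp at hnd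
          have := hG.adj_of_adj hxy.symm hch.1 hya hzx hax.symm (by rintro rfl; simp at hap)
          tauto
        refine Or.inl ⟨z, hcl a ha z ?_ hza.symm, by simp⟩
        simp only [List.nodup_cons, List.mem_cons, not_or] at hnd
        simp [hp z (by simp), Ne.symm hnd.1.2.1, Ne.symm hnd.2.1.1]
    · have := hy a haS hya
      simp_all
  have hchp : p.IsChain G.Adj := hch.tail
  have hpS : ∀ v ∈ p, v ∈ S \ {x, y} := by
    intro v hv
    have h1 : v ≠ x := by rintro rfl; simp [hv] at hnd
    have h2 : v ≠ y := by rintro rfl; simp [hv] at hnd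
    simp [hp v (by simp [hv]), h1, h2]
  intro A hA hne hcl
  by_contra hnot
  rw [Set.not_subset] at hnot
  obtain ⟨b, hbS, hbA⟩ := hnot
  -- The complement of a closed set is closed too, so `key` applies to both sides of a supposed
  -- separation.
  have hclB : ∀ a ∈ (↑(S \ {x, y}) \ A : Set V), ∀ b ∈ S \ {x, y}, G.Adj a b →
      b ∈ (↑(S \ {x, y}) \ A : Set V) := by
    rintro a ⟨haS, haA⟩ b hb hab
    exact ⟨hb, fun hbA => haA (hcl b hbA a haS hab.symm)⟩
  have h1 := key A hA hne hcl
  have h2 := key (↑(S \ {x, y}) \ A) Set.sdiff_subset ⟨b, hbS, hbA⟩ hclB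
  rcases h1 with ⟨a, ha, hap⟩ | ⟨rfl, a, ha, hya, hxa⟩
  · rcases h2 with ⟨c, hc, hcp⟩ | ⟨rfl, -⟩
    · exact hc.2 (hchp.mem_of_closed (fun a ha b hb => hcl a ha b (hpS b hb)) ha hap c hcp)
    · simp at hap
  · rcases h2 with ⟨c, hc, hcp⟩ | ⟨-, c, hc, hyc, hxc⟩
    · simp at hcp
    · have hac : a ≠ c := by rintro rfl; exact hc.2 ha
      have hax : a ≠ x ∧ a ≠ y := by simpa using (Finset.mem_sdiff.1 (hA ha)).2
      have hcx : c ≠ x ∧ c ≠ y := by simpa using (Finset.mem_sdiff.1 hc.1).2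
      -- With an empty remaining path, `y` has the neighbors `x`, `a`, `c`; only the edge between
      -- `a` and `c` can prevent a claw, and it joins the two sides.
      rcases hG.adj_of_adj hxy.symm hya hyc hax.1.symm hcx.1.symm hac with h | h | h
      · exact hxa h
      · exact hxc h
      · exact hc.2 (hcl a ha c hc.1 h)

theorem inv_start [Fintype V] {G : SimpleGraph V} (hG : G.Connected)
    (he : Even (Fintype.card V)) : Inv G (start V) where
  path_sub := by simp [start]
  nodup := by simp [start]
  chain := by simp [start]
  lmExact := trivial
  lm_off := by simp [start]
  conn := hG.connectedOn_univ
  even := by simpa [start] using he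
  adj_of_mem := by simp [start]
  existsUnique := by simp [start]
  two_le := by simp [start]
  body := by simp [start]
  no_end := by simp [start]
  no_swap := by simp [start]
  halted := by simp [start]

theorem Inv.lm_eq_of_cons {G : SimpleGraph V} {s : State V} (h : Inv G s) {w : V} {p : List V}
    (hp : s.path = w :: p) (hw : s.lm w ≠ -1) : s.lm w = adjRun G w p ∧ 1 ≤ s.lm w := by
  have := h.lmExact
  rw [hp] at this
  exact this.1.resolve_left hw

theorem Inv.exists_cons_cons {G : SimpleGraph V} {s : State V} (h : Inv G s) {w : V} {p : List V}
    (hp : s.path = w :: p) (hw : s.lm w ≠ -1) : ∃ y q, p = y :: q := by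
  have := h.lm_eq_of_cons hp hw
  rcases p with _ | ⟨y, q⟩
  · simp [adjRun] at this
    omega
  · exact ⟨y, q, rfl⟩

/-- If the path cannot be extended, then `lm` can be determined. -/
theorem Inv.one_le_adjRun {G : SimpleGraph V} {s : State V} (h : Inv G s) (hs : s.point = .body)
    {w : V} {p : List V} (hp : s.path = w :: p) (hn : ¬ HasNewNbr G s w) : 1 ≤ adjRun G w p := by
  have hch := h.chain
  rw [hp] at hch
  rcases p with _ | ⟨y, p⟩
  · obtain ⟨v, hv, hwv⟩ := h.conn.exists_adj (h.two_le (by simp [hs]) (by simp [hs]))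
      (h.path_sub w (by simp [hp]))
    refine (hn ⟨v, ⟨hv, hwv⟩, ?_⟩).elim
    have := hwv.ne'
    simp_all
  · rw [adjRun_cons_of_adj (List.isChain_cons_cons.1 hch).1]
    omega

theorem Inv.isPerfectMatchingSet {G : SimpleGraph V} {s : State V} (h : Inv G s)
    (hs : s.point = .halted) : IsPerfectMatchingSet G s.M := by
  -- An even number below two is zero.
  have hr : s.rem = ∅ := by
    have h1 := h.halted hs
    obtain ⟨k, hk⟩ := h.even
    exact Finset.card_eq_zero.1 (by omega)
  refine ⟨⟨Set.univ, fun a b => s(a, b) ∈ s.M, fun hab => (h.adj_of_mem _ _ hab).1,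
    fun _ => Set.mem_univ _, ⟨fun a b hab => by rwa [Sym2.eq_swap]⟩⟩, ⟨?_, ?_⟩, ?_⟩
  · intro v _
    exact h.existsUnique v (by simp [hr])
  · exact fun v => Set.mem_univ v
  · ext e
    induction e with
    | _ a b => simp

/-- An upper bound for the number of steps before `PMinCF` halts. -/
def potential (s : State V) : ℕ :=
  10 * (2 * s.rem.card - s.path.length) +
    match s.point with
    | .outer => 4
    | .body => 3
    | .swapTest => 2
    | .cut => 1
    | .halted => 0

variable [DecidableEq V]

theorem swapLm_left {lm : V → ℤ} {x y : V} (h : x ≠ y) : swapLm lm x y x = lm x - 1 := by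
  simp only [swapLm]
  split_ifs <;> simp [h]

theorem swapLm_right {lm : V → ℤ} {x y : V} (h : x ≠ y) :
    swapLm lm x y y = if lm y ≠ -1 then lm y + 1 else lm y := by
  simp only [swapLm, Function.update_of_ne h.symm]
  split_ifs <;> simp [h.symm]

theorem swapLm_of_ne {lm : V → ℤ} {x y v : V} (hx : v ≠ x) (hy : v ≠ y) :
    swapLm lm x y v = lm v := by
  simp only [swapLm]
  split_ifs <;> simp [hx, hy]

/-- Only two transitions need an argument. In a swap, lm(x) ≥ 2 says that x is adjacent to the
vertex before y, if there is one, so the swapped sequence is again a path and the two corrected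
values of lm are exact. When an edge is matched, the failed extension tests are the hypotheses of
`connectedOn_sdiff`. -/
theorem Inv.step {G : SimpleGraph V} (hG : ClawFree G) {s t : State V} (h : Inv G s)
    (hst : Step G s t) : Inv G t := by
  cases hst with
  | stop_while hs hc =>
    exact { h with
      two_le := by simp
      body := by simp
      no_end := by simp
      no_swap := by simp
      halted := fun _ => hc }
  | restart u v hs hc hp hu hv =>
    exact { h with
      path_sub := by simp [hu, hv.1]
      nodup := by simpa using hv.2.ne'
      chain := by simpa using hv.2.symm
      lmExact := ⟨Or.inl (h.lm_off v hv.1 (by simp [hp])),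
        Or.inl (h.lm_off u hu (by simp [hp])), trivial⟩
      lm_off := fun w hw _ => h.lm_off w hw (by simp [hp])
      two_le := fun _ _ => hc
      body := by simp
      no_end := by simp
      no_swap := by simp
      halted := by simp }
  | keep hs hc hp =>
    exact { h with
      two_le := fun _ _ => hc
      body := fun _ => hp
      no_end := by simp
      no_swap := by simp
      halted := by simp }
  | end_extension w v p hs hp hv hvp =>
    have h1 := h.path_sub
    have h2 := h.nodup
    have h3 := h.chain
    have h4 := h.lmExact
    rw [hp] at h1 h2 h3 h4 hvp
    exact { h with
      path_sub := by
        intro x hx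
        rcases List.mem_cons.1 hx with rfl | hx
        exacts [hv.1, h1 x hx]
      nodup := List.nodup_cons.2 ⟨hvp, h2⟩
      chain := List.isChain_cons_cons.2 ⟨hv.2.symm, h3⟩
      lmExact := ⟨Or.inl (h.lm_off v hv.1 (by rwa [hp])), h4⟩
      lm_off := fun x hx hxp => h.lm_off x hx fun hxs => by
        rw [hp] at hxs
        exact hxp (List.mem_cons_of_mem _ hxs)
      body := by simp
      no_end := by simp [hs]
      no_swap := by simp [hs] }
  | lm_known w p hs hp hn hl =>
    obtain ⟨y, q, rfl⟩ := h.exists_cons_cons hp hl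
    exact { h with
      two_le := fun _ _ => h.two_le (by simp [hs]) (by simp [hs])
      body := by simp
      no_end := fun _ => ⟨w, y, q, hp, hn, hl⟩
      no_swap := by simp
      halted := by simp }
  | lm_compute w p l hs hp hn hl hg =>
    have hps : ∀ x ∈ p, x ∈ s.rem := fun x hx => h.path_sub x (by simp [hp, hx])
    obtain ⟨rfl, hl1⟩ := (isGreatest_lmSet_iff hps).1 hg
    have hwp : w ∉ p := by
      have := h.nodup
      rw [hp] at this
      exact (List.nodup_cons.1 this).1
    exact { h with
      lmExact := by
        rw [hp]
        refine ⟨Or.inr (by simpa using hl1), ?_⟩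
        have := h.lmExact
        rw [hp] at this
        exact this.2.congr fun v hv => by
          dsimp only
          rw [Function.update_of_ne]
          rintro rfl
          exact hwp hv
      lm_off := fun v hv hvp => by
        have : v ≠ w := by
          rintro rfl
          simp [hp] at hvp
        simpa [this] using h.lm_off v hv hvp
      two_le := fun _ _ => h.two_le (by simp [hs]) (by simp [hs])
      body := by simp
      no_end := fun _ => by
        rcases p with _ | ⟨y, q⟩
        · simp [adjRun] at hl1
        · exact ⟨w, y, q, hp, hn, by simp⟩
      no_swap := by simp
      halted := by simp }
  | swap_extension x y v p hs hp hx hv hvp =>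
    have h1 := h.path_sub
    have h2 := h.nodup
    have h3 := h.chain
    have h4 := h.lmExact
    have h5 := h.lm_eq_of_cons hp (by omega)
    rw [hp] at h1 h2 h3 h4 hvp
    rw [List.isChain_cons_cons] at h3
    rw [adjRun_cons_of_adj h3.1] at h5
    have hxy : x ≠ y := h3.1.ne
    have hp' : ∀ z ∈ p, z ≠ x ∧ z ≠ y := by
      intro z hz
      constructor <;> rintro rfl <;> simp [hz] at h2
    have hv' : v ≠ x ∧ v ≠ y := by
      constructor <;> rintro rfl <;> simp at hvp
    have hoff : ∀ u, u ∉ v :: y :: x :: p → u ∈ s.rem → s.lm u = -1 ∧ u ≠ x ∧ u ≠ y := by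
      intro u hu hur
      simp only [List.mem_cons, not_or] at hu
      exact ⟨h.lm_off u hur (by simp [hp, hu]), hu.2.2.1, hu.2.1⟩
    exact { h with
      path_sub := by
        intro z hz
        have : z = v ∨ z ∈ x :: y :: p := by simp at hz ⊢; tauto
        rcases this with rfl | hz
        exacts [hv.1, h1 z hz]
      nodup := by
        simp only [List.nodup_cons, List.mem_cons, not_or] at h2 hvp ⊢
        tauto
      chain := by
        refine List.isChain_cons_cons.2 ⟨hv.2.symm, List.isChain_cons_cons.2 ⟨h3.1.symm, ?_⟩⟩
        rcases p with _ | ⟨z, p⟩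
        · simp
        -- A run of length at least 2 from `x` passes `y` and reaches `z`.
        · refine List.isChain_cons_cons.2 ⟨?_, (List.isChain_cons_cons.1 h3.2).2⟩
          by_contra hn
          rw [adjRun_cons_of_not_adj hn] at h5
          omega
      lmExact := by
        refine ⟨Or.inl ?_, ?_, ?_, ?_⟩
        · dsimp only
          rw [swapLm_of_ne hv'.1 hv'.2]
          exact h.lm_off v hv.1 (by rwa [hp])
        · dsimp only
          -- The run of `y` gains `x` in front of the old run through `p`; in the next case the run
          -- of `x` loses `y` and stays positive.
          rw [swapLm_right hxy, adjRun_cons_of_adj h3.1.symm]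
          rcases h4.2.1 with h6 | h6
          · simp [h6]
          · rw [if_pos (by omega)]
            right
            push_cast
            omega
        · dsimp only
          rw [swapLm_left hxy]
          push_cast at h5
          omega
        · exact h4.2.2.congr fun z hz => swapLm_of_ne (hp' z hz).1 (hp' z hz).2
      lm_off := by
        intro u hu hup
        have := hoff u hup hu
        dsimp only
        rw [swapLm_of_ne this.2.1 this.2.2, this.1]
      two_le := fun _ _ => h.two_le (by simp [hs]) (by simp [hs])
      body := by simp
      no_end := by simp
      no_swap := by simp
      halted := by simp }
  | no_extension x y p hs hp hn =>
    exact { h with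
      two_le := fun _ _ => h.two_le (by simp [hs]) (by simp [hs])
      body := by simp
      no_end := fun _ => h.no_end (Or.inl hs)
      no_swap := by
        rintro - x' y' p' hp'
        obtain ⟨rfl, rfl, rfl⟩ : x = x' ∧ y = y' ∧ p = p' := by
          have := hp.symm.trans hp'
          simpa using this
        exact hn
      halted := by simp }
  | match_last x y p hs hp =>
    have h1 := h.path_sub
    have h2 := h.nodup
    have h3 := h.chain
    have h4 := h.lmExact
    obtain ⟨x', y', p', hp', hnx, hlx⟩ := h.no_end (Or.inr hs)
    obtain ⟨rfl, rfl, rfl⟩ : x = x' ∧ y = y' ∧ p = p' := by simpa using hp.symm.trans hp'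
    have hns := h.no_swap hs x y p hp
    have h5 := h.lm_eq_of_cons hp hlx
    rw [hp] at h1 h2 h3 h4
    have hxS := h1 x (by simp)
    have hyS := h1 y (by simp)
    have hxy : G.Adj x y := (List.isChain_cons_cons.1 h3).1
    have hnew : ∀ w, ¬ HasNewNbr G s w → ∀ v ∈ s.rem, G.Adj w v → v ∈ x :: y :: p := by
      intro w hw v hv hadj
      by_contra hvp
      exact hw ⟨v, ⟨hv, hadj⟩, by rwa [hp]⟩
    have hnM : ∀ a b, s(a, b) ∈ s.M → a ≠ x ∧ a ≠ y ∧ b ≠ x ∧ b ≠ y := by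
      intro a b hab
      have := (h.adj_of_mem a b hab).2
      refine ⟨?_, ?_, ?_, ?_⟩ <;> rintro rfl <;> tauto
    exact {
      path_sub := by
        intro v hv
        have h6 : v ≠ x := by rintro rfl; simp [hv] at h2
        have h7 : v ≠ y := by rintro rfl; simp [hv] at h2
        simp [h1 v (by simp [hv]), h6, h7]
      nodup := (List.nodup_cons.1 (List.nodup_cons.1 h2).2).2
      chain := h3.tail.tail
      lmExact := h4.2.2
      lm_off := by
        intro v hv hvp
        simp only [Finset.mem_sdiff, Finset.mem_insert, Finset.mem_singleton, not_or] at hv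
        exact h.lm_off v hv.1 (by simp [hp, hv.2, hvp])
      conn := by
        refine connectedOn_sdiff hG h.conn h1 h2 h3 (hnew x hnx) ?_
        -- If `y` has a new neighbor, the failed swap test gives lm(x) < 2, and lm(x) is the exact
        -- run.
        by_cases hy : HasNewNbr G s y
        · left
          by_contra h6
          exact hns ⟨by omega, hy⟩
        · exact Or.inr (hnew y hy)
      even := by
        rw [Finset.card_sdiff_of_subset (by simp [Finset.insert_subset_iff, hxS, hyS]),
          Finset.card_pair hxy.ne]
        exact h.even.tsub (by simp)
      adj_of_mem := by
        intro a b hab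
        rcases Finset.mem_insert.1 hab with hab | hab
        · rcases Sym2.eq_iff.1 hab with ⟨rfl, rfl⟩ | ⟨rfl, rfl⟩
          · simpa using hxy.symm
          · simpa using hxy
        · have := h.adj_of_mem a b hab
          simp [this]
      existsUnique := by
        intro a ha
        by_cases hax : a = x
        · subst hax
          refine ⟨y, by simp [Sym2.eq_swap], fun b hb => ?_⟩
          rcases Finset.mem_insert.1 hb with hb | hb
          · rcases Sym2.eq_iff.1 hb with ⟨h6, rfl⟩ | ⟨-, rfl⟩
            exacts [h6, rfl]
          · exact ((hnM a b hb).1 rfl).elim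
        · by_cases hay : a = y
          · subst hay
            refine ⟨x, by simp, fun b hb => ?_⟩
            rcases Finset.mem_insert.1 hb with hb | hb
            · rcases Sym2.eq_iff.1 hb with ⟨-, rfl⟩ | ⟨h6, rfl⟩
              exacts [rfl, h6]
            · exact ((hnM a b hb).2.1 rfl).elim
          · have ha' : a ∉ s.rem := by simpa [hax, hay] using ha
            obtain ⟨b, hb, hu⟩ := h.existsUnique a ha'
            refine ⟨b, Finset.mem_insert_of_mem hb, fun c hc => ?_⟩
            rcases Finset.mem_insert.1 hc with hc | hc
            · rcases Sym2.eq_iff.1 hc with ⟨rfl, -⟩ | ⟨rfl, -⟩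
              exacts [(hay rfl).elim, (hax rfl).elim]
            · exact hu c hc
      two_le := by simp
      body := by simp
      no_end := by simp
      no_swap := by simp
      halted := by simp }

theorem Inv.of_reflTransGen {G : SimpleGraph V} (hG : ClawFree G) {s t : State V} (h : Inv G s)
    (hst : Relation.ReflTransGen (Step G) s t) : Inv G t := by
  induction hst with
  | refl => exact h
  | tail _ hst ih => exact ih.step hG hst

theorem Inv.exists_step {G : SimpleGraph V} {s : State V} (h : Inv G s)
    (hs : s.point ≠ .halted) : ∃ t, Step G s t := by
  cases hpt : s.point with
  | outer =>
    by_cases hc : 2 ≤ s.rem.card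
    · by_cases hp : s.path = []
      · obtain ⟨u, hu⟩ : s.rem.Nonempty := Finset.card_pos.1 (by omega)
        obtain ⟨v, hv, huv⟩ := h.conn.exists_adj hc hu
        exact ⟨_, .restart _ u v hpt hc hp hu ⟨hv, huv⟩⟩
      · exact ⟨_, .keep _ hpt hc hp⟩
    · exact ⟨_, .stop_while _ hpt (by omega)⟩
  | body =>
    obtain ⟨w, p, hp⟩ := List.exists_cons_of_ne_nil (h.body hpt)
    by_cases hn : HasNewNbr G s w
    · obtain ⟨v, hv, hvp⟩ := hn
      exact ⟨_, .end_extension _ w v p hpt hp hv hvp⟩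
    · by_cases hl : s.lm w = -1
      · have hps : ∀ x ∈ p, x ∈ s.rem := fun x hx => h.path_sub x (by simp [hp, hx])
        exact ⟨_, .lm_compute _ w p (adjRun G w p) hpt hp hn hl
          ((isGreatest_lmSet_iff hps).2 ⟨rfl, h.one_le_adjRun hpt hp hn⟩)⟩
      · exact ⟨_, .lm_known _ w p hpt hp hn hl⟩
  | swapTest =>
    obtain ⟨x, y, p, hp, -⟩ := h.no_end (Or.inl hpt)
    by_cases hn : 2 ≤ s.lm x ∧ HasNewNbr G s y
    · obtain ⟨hx, v, hv, hvp⟩ := hn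
      exact ⟨_, .swap_extension _ x y v p hpt hp hx hv hvp⟩
    · exact ⟨_, .no_extension _ x y p hpt hp hn⟩
  | cut =>
    obtain ⟨x, y, p, hp, -⟩ := h.no_end (Or.inr hpt)
    exact ⟨_, .match_last _ x y p hpt hp⟩
  | halted => exact (hs hpt).elim

theorem Inv.length_le {G : SimpleGraph V} {s : State V} (h : Inv G s) :
    s.path.length ≤ s.rem.card := by
  rw [← List.toFinset_card_of_nodup h.nodup]
  exact Finset.card_le_card fun v hv => h.path_sub v (List.mem_toFinset.1 hv)

/-- An extension lengthens the path by one and gains 10; matching an edge shrinks both the vertex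
set and the path by two and gains 20. The ranks of the control points differ by at most 4, and all
other steps lower the rank. The bound k ≤ n(G) keeps the truncated subtraction exact. -/
theorem potential_lt {G : SimpleGraph V} {s t : State V} (hs : Inv G s) (ht : Inv G t)
    (hst : Step G s t) : potential t < potential s := by
  have h1 := hs.length_le
  have h2 := ht.length_le
  cases hst with
  | match_last x y p hs' hp =>
    have hx := hs.path_sub x (by simp [hp])
    have hy := hs.path_sub y (by simp [hp])
    have hxy : x ≠ y := by
      have := hs.nodup
      rw [hp] at this
      rintro rfl
      simp at this
    have h3 : (s.rem \ {x, y}).card + 2 = s.rem.card := by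
      rw [← Finset.card_pair hxy]
      exact Finset.card_sdiff_add_card_eq_card (by simp [Finset.insert_subset_iff, hx, hy])
    simp_all [potential]
    omega
  | _ => simp_all [potential] <;> omega

theorem worksCorrectly [Fintype V] {G : SimpleGraph V} (hG : G.Connected) (hc : ClawFree G)
    (he : Even (Fintype.card V)) : WorksCorrectly G := by
  have h0 := inv_start hG he
  constructor
  · rintro ⟨f, hf0, hf⟩
    have hinv : ∀ i, Inv G (f i) := by
      intro i
      induction i with
      | zero => rwa [hf0]
      | succ i ih => exact ih.step hc (hf i)
    have hdec : ∀ i, potential (f i) + i ≤ potential (f 0) := by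
      intro i
      induction i with
      | zero => simp
      | succ i ih =>
        have := potential_lt (hinv i) (hinv (i + 1)) (hf i)
        omega
    have := hdec (potential (f 0) + 1)
    omega
  · intro s hs
    have := h0.of_reflTransGen hc hs
    exact ⟨this.exists_step, this.isPerfectMatchingSet⟩

end PMinCF

/-! # Programs consisting of a single loop with a loop-free body -/

namespace RAM

namespace Cmd

def LoopFree : Cmd → Prop
  | seq c d => c.LoopFree ∧ d.LoopFree
  | cond _ c d => c.LoopFree ∧ d.LoopFree
  | .while _ _ => False
  | _ => True

/-- The store after the execution of a loop-free command. -/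
def exec : Cmd → Store → Store
  | skip, σ => σ
  | const x c, σ => σ.setReg x c
  | copy x y, σ => σ.setReg x (σ.reg y)
  | inc x, σ => σ.setReg x (σ.reg x + 1)
  | dec x, σ => σ.setReg x (σ.reg x - 1)
  | load x a i, σ => σ.setReg x (σ.arr a (σ.reg i))
  | save a i x, σ => σ.setArr a (σ.reg i) (σ.reg x)
  | seq c d, σ => d.exec (c.exec σ)
  | cond b c d, σ => if b.eval σ then c.exec σ else d.exec σ
  | .while _ _, σ => σ

/-- An upper bound for the number of steps that a loop-free command takes. -/
def cost : Cmd → ℕ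
  | seq c d => c.cost + d.cost + 1
  | cond _ c d => max c.cost d.cost + 1
  | _ => 1

/-- The time is chosen before the continuation `K`; this is what lets the two halves of a `seq` be
composed. -/
theorem LoopFree.exists_iterate_step {c : Cmd} (h : c.LoopFree) (σ : Store) :
    ∃ t ≤ c.cost, ∀ K, step^[t] ⟨c :: K, σ⟩ = ⟨K, c.exec σ⟩ := by
  induction c generalizing σ with
  | seq c d ihc ihd =>
    obtain ⟨t, ht, hc⟩ := ihc h.1 σ
    obtain ⟨u, hu, hd⟩ := ihd h.2 (c.exec σ)
    refine ⟨u + t + 1, by simp only [cost]; omega, fun K => ?_⟩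
    rw [Function.iterate_succ_apply, Function.iterate_add_apply]
    exact (congrArg _ (hc (d :: K))).trans (hd K)
  | cond b c d ihc ihd =>
    obtain ⟨t, ht, hc⟩ := ihc h.1 σ
    obtain ⟨u, hu, hd⟩ := ihd h.2 σ
    by_cases hb : b.eval σ
    · refine ⟨t + 1, by simp only [cost]; omega, fun K => ?_⟩
      rw [Function.iterate_succ_apply]
      simpa [step, exec, hb] using hc K
    · refine ⟨u + 1, by simp only [cost]; omega, fun K => ?_⟩
      rw [Function.iterate_succ_apply]
      simpa [step, exec, hb] using hd K
  | _ => first | exact h.elim | exact ⟨1, by simp [cost], fun K => rfl⟩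

end Cmd

theorem after_add {p : Cmd} {σ : Store} {t : ℕ} {c : Config} (h : after p σ t = c) (u : ℕ) :
    after p σ (t + u) = step^[u] c := by
  rw [after, Nat.add_comm, Function.iterate_add_apply]
  exact congrArg _ h

theorem iterate_step_nil (σ : Store) (t : ℕ) : step^[t] ⟨[], σ⟩ = ⟨[], σ⟩ :=
  Function.iterate_fixed rfl t

/-- A loop with a loop-free body halts if every iteration decreases a potential. The invariant `I`
refers to the potential, to the time, and to the store. -/
theorem exists_after_eq_nil {a b : ℕ} {body : Cmd} (hb : body.LoopFree) {σ₀ : Store}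
    {I : ℕ → ℕ → Store → Prop} {φ₀ : ℕ} (h₀ : I φ₀ 0 σ₀)
    (hI : ∀ φ t σ, I φ t σ → σ.reg a = σ.reg b → ∀ t', t ≤ t' →
      after (.while (.eq a b) body) σ₀ t' = ⟨[.while (.eq a b) body], body.exec σ⟩ →
      ∃ φ' < φ, I φ' t' (body.exec σ)) :
    ∃ φ t σ, t ≤ (body.cost + 1) * φ₀ ∧ I φ t σ ∧ σ.reg a ≠ σ.reg b ∧
      after (.while (.eq a b) body) σ₀ (t + 1) = ⟨[], σ⟩ := by
  suffices H : ∀ φ t σ, I φ t σ → t + (body.cost + 1) * φ ≤ (body.cost + 1) * φ₀ →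
      after (.while (.eq a b) body) σ₀ t = ⟨[.while (.eq a b) body], σ⟩ →
      ∃ φ t σ, t ≤ (body.cost + 1) * φ₀ ∧ I φ t σ ∧ σ.reg a ≠ σ.reg b ∧
        after (.while (.eq a b) body) σ₀ (t + 1) = ⟨[], σ⟩ from
    H φ₀ 0 σ₀ h₀ (by simp) rfl
  intro φ
  induction φ using Nat.strong_induction_on with
  | _ φ ih =>
    intro t σ hi ht hat
    by_cases hab : σ.reg a = σ.reg b
    · obtain ⟨u, hu, hstep⟩ := hb.exists_iterate_step σ
      have h1 : after (.while (.eq a b) body) σ₀ (t + (u + 1)) =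
          ⟨[.while (.eq a b) body], body.exec σ⟩ := by
        -- One machine step evaluates the loop test; the remaining `u` steps execute the body.
        rw [after_add hat, Function.iterate_succ_apply, ← hstep]
        simp [step, Test.eval, hab]
      obtain ⟨φ', hφ, hi'⟩ := hI φ t σ hi hab _ (by omega) h1
      refine ih φ' hφ _ _ hi' ?_ h1
      have : (body.cost + 1) * (φ' + 1) ≤ (body.cost + 1) * φ := Nat.mul_le_mul_left _ hφ
      rw [Nat.mul_add] at this
      omega
    · refine ⟨φ, t, σ, by omega, hi, hab, ?_⟩
      rw [after_add hat]
      simp [step, Test.eval, hab]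

/-! ### Dispatching on a control register, and bookkeeping for stores -/

namespace Cmd

/-- Execute the commands of the list one after the other. -/
def block : List Cmd → Cmd
  | [] => skip
  | c :: cs => seq c (block cs)

/-- Execute the command of the list whose index is the value of register `6`, using register `30` as
a counter. -/
def dispatch : List Cmd → Cmd
  | [] => skip
  | c :: cs => cond (.eq 6 30) c (seq (inc 30) (dispatch cs))

def dispatcher (cs : List Cmd) : Cmd :=
  seq (const 30 0) (dispatch cs)

end Cmd

namespace Store

theorem setReg_reg (σ : Store) (x v y : ℕ) :
    (σ.setReg x v).reg y = if y = x then v else σ.reg y := by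
  simp [setReg, Function.update_apply]

theorem setReg_arr (σ : Store) (x v : ℕ) : (σ.setReg x v).arr = σ.arr := rfl

theorem setArr_reg (σ : Store) (a i v : ℕ) : (σ.setArr a i v).reg = σ.reg := rfl

theorem setArr_arr (σ : Store) (a i v b : ℕ) :
    (σ.setArr a i v).arr b = if b = a then Function.update (σ.arr a) i v else σ.arr b := by
  by_cases h : b = a
  · subst h; simp [setArr]
  · simp [setArr, h]

theorem setArr_arr_of_ne (σ : Store) (a v b : ℕ) {i j : ℕ} (h : j ≠ i) :
    (σ.setArr a i v).arr b j = σ.arr b j := by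
  rw [setArr_arr]
  split_ifs with hb
  · rw [Function.update_of_ne h, hb]
  · rfl

end Store

theorem eval_eq_iff (σ : Store) (x y : ℕ) : (Test.eq x y).eval σ = true ↔ σ.reg x = σ.reg y := by
  simp [Test.eval]

theorem eval_lt_iff (σ : Store) (x y : ℕ) : (Test.lt x y).eval σ = true ↔ σ.reg x < σ.reg y := by
  simp [Test.eval]

namespace Cmd

theorem exec_block_nil (σ : Store) : (block []).exec σ = σ := rfl

theorem exec_block_cons (c : Cmd) (cs : List Cmd) (σ : Store) :
    (block (c :: cs)).exec σ = (block cs).exec (c.exec σ) := rfl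

theorem loopFree_dispatcher {cs : List Cmd} (h : ∀ c ∈ cs, c.LoopFree) :
    (dispatcher cs).LoopFree := by
  refine ⟨trivial, ?_⟩
  induction cs with
  | nil => trivial
  | cons c cs ih => exact ⟨h c (by simp), trivial, ih fun d hd => h d (List.mem_cons_of_mem _ hd)⟩

/-- Register `6` acts as a program counter. The scan leaves its counter `k` in register `30`, hence
the modified store on the right. -/
theorem exec_dispatcher {cs : List Cmd} {k : ℕ} {c : Cmd} (h : cs[k]? = some c) {σ : Store}
    (hσ : σ.reg 6 = k) : (dispatcher cs).exec σ = c.exec (σ.setReg 30 k) := by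
  -- The induction needs an arbitrary initial value `i` of the counter.
  suffices H : ∀ (cs : List Cmd) (i j : ℕ), cs[j]? = some c → σ.reg 6 = i + j →
      (dispatch cs).exec (σ.setReg 30 i) = c.exec (σ.setReg 30 (i + j)) by
    simpa [dispatcher, exec] using H cs 0 k h (by simpa using hσ)
  intro cs
  induction cs with
  | nil => simp
  | cons d cs ih =>
    rintro i (_ | j) hj h6
    · simp only [List.getElem?_cons_zero, Option.some.injEq] at hj
      subst hj
      have : (Test.eq 6 30).eval (σ.setReg 30 i) = true := by
        simp [eval_eq_iff, Store.setReg_reg, h6]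
      simp [dispatch, exec, this]
    · have : ¬ (Test.eq 6 30).eval (σ.setReg 30 i) = true := by
        simp [eval_eq_iff, Store.setReg_reg, h6]
      have h2 : (σ.setReg 30 i).setReg 30 (i + 1) = σ.setReg 30 (i + 1) := by
        simp [Store.setReg]
      simp only [dispatch, exec, this]
      rw [show (σ.setReg 30 i).reg 30 = i by simp [Store.setReg_reg], h2]
      have := ih (i + 1) j (by simpa using hj) (by omega)
      rw [show i + 1 + j = i + (j + 1) by omega] at this
      simpa using this

end Cmd

/-! # The input -/

theorem getElem?_flatten_sum_take_add {α : Type*} (L : List (List α)) {i : ℕ} (hi : i < L.length)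
    {j : ℕ} (hj : j < L[i].length) :
    L.flatten[((L.take i).map List.length).sum + j]? = some L[i][j] := by
  induction L generalizing i with
  | nil => simp at hi
  | cons l L ih =>
    rcases i with _ | i
    · simp only [List.getElem_cons_zero] at hj
      simp [List.getElem?_append_left hj]
    · simp only [List.getElem_cons_succ] at hj ⊢
      rw [← ih (by simpa using hi) hj]
      simp [Nat.add_assoc, List.getElem?_append_right]

/-- The positions `a₀ u, …, a₀ (u + 1) - 1` of `a₁` hold the neighbors of `u` in `G`. -/
structure Layout {n : ℕ} (G : SimpleGraph (Fin n)) (a₀ a₁ : ℕ → ℕ) : Prop where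
  adj_iff : ∀ u v : Fin n, G.Adj u v ↔ ∃ j, a₀ u ≤ j ∧ j < a₀ (u + 1) ∧ a₁ j = v
  exists_adj : ∀ (u : Fin n) (j : ℕ), a₀ u ≤ j → j < a₀ (u + 1) → ∃ v : Fin n, G.Adj u v ∧ a₁ j = v
  inj : ∀ (u : Fin n) (j k : ℕ), a₀ u ≤ j → j < a₀ (u + 1) → a₀ u ≤ k → k < a₀ (u + 1) →
    a₁ j = a₁ k → j = k
  ncard_neighborSet : ∀ u : Fin n, a₀ (u + 1) = a₀ u + (G.neighborSet u).ncard

theorem IsNeighborhoodLists.layout {n : ℕ} {G : SimpleGraph (Fin n)}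
    {adj : Fin n → List (Fin n)} (h : IsNeighborhoodLists G adj) :
    Layout G ((input adj).arr 0) ((input adj).arr 1) := by
  have h0 : ∀ u : Fin n, (input adj).arr 0 (u + 1) = (input adj).arr 0 u + (adj u).length := by
    intro u
    simp only [input, if_true, List.map_take]
    rw [List.sum_take_succ _ _ (by simp)]
    simp
  have h1 : ∀ (u : Fin n) (j : ℕ) (hj : j < (adj u).length),
      (input adj).arr 1 ((input adj).arr 0 u + j) = (adj u)[j] := by
    intro u j hj
    have := getElem?_flatten_sum_take_add (List.ofFn adj) (i := u) (by simp) (j := j) (by simpa)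
    simp only [input, if_true, one_ne_zero, if_false]
    rw [List.getD_eq_getElem?_getD, List.getElem?_map, this]
    simp
  have h2 : ∀ (u : Fin n) (j : ℕ), (input adj).arr 0 u ≤ j → j < (input adj).arr 0 (u + 1) →
      ∃ v : Fin n, G.Adj u v ∧ (input adj).arr 1 j = v := by
    intro u j hj hj'
    obtain ⟨k, rfl⟩ := Nat.exists_eq_add_of_le hj
    have hk : k < (adj u).length := by
      have := h0 u
      omega
    exact ⟨_, ((h u).2 _).1 (List.getElem_mem hk), h1 u k hk⟩
  refine ⟨fun u v => ⟨fun huv => ?_, ?_⟩, h2, fun u j k hj hj' hk hk' hjk => ?_, fun u => ?_⟩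
  · obtain ⟨k, hk, rfl⟩ := List.getElem_of_mem (((h u).2 v).2 huv)
    exact ⟨_, Nat.le_add_right _ k, by rw [h0]; omega, h1 u k hk⟩
  · rintro ⟨j, hj, hj', hjv⟩
    obtain ⟨w, huw, hw⟩ := h2 u j hj hj'
    rwa [Fin.ext (hjv.symm.trans hw)]
  · obtain ⟨j, rfl⟩ := Nat.exists_eq_add_of_le hj
    obtain ⟨k, rfl⟩ := Nat.exists_eq_add_of_le hk
    have hlen := h0 u
    rw [h1 u j (by omega), h1 u k (by omega)] at hjk
    rw [(h u).1.getElem_inj_iff.1 (Fin.ext hjk)]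
  · rw [h0]
    have : G.neighborSet u = ((adj u).toFinset : Set (Fin n)) := by
      ext v
      simp [(h u).2]
    rw [this, Set.ncard_coe_finset, List.toFinset_card_of_nodup (h u).1]

theorem Layout.le {n : ℕ} {G : SimpleGraph (Fin n)} {a₀ a₁ : ℕ → ℕ} (h : Layout G a₀ a₁)
    (u : Fin n) : a₀ u ≤ a₀ (u + 1) := by
  rw [h.ncard_neighborSet]
  omega

/-- The handshake lemma, which turns potentials measured by list lengths into bounds in terms of
edges. -/
theorem Layout.sum {n : ℕ} {G : SimpleGraph (Fin n)} {a₀ a₁ : ℕ → ℕ} (h : Layout G a₀ a₁) :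
    ∑ u : Fin n, (a₀ (u + 1) - a₀ u) = 2 * G.edgeSet.ncard := by
  classical
  rw [Set.ncard_eq_toFinset_card', Set.toFinset_card, ← SimpleGraph.edgeFinset_card,
    ← G.sum_degrees_eq_twice_card_edges]
  refine Finset.sum_congr rfl fun u _ => ?_
  rw [h.ncard_neighborSet, Set.ncard_eq_toFinset_card', Set.toFinset_card,
    SimpleGraph.card_neighborSet_eq_degree]
  omega

/-- Bounds the walk back along the path in the computation of lm by the degree of the vertex. -/
theorem Layout.length_le {n : ℕ} {G : SimpleGraph (Fin n)} {a₀ a₁ : ℕ → ℕ} (h : Layout G a₀ a₁)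
    {u : Fin n} {l : List (Fin n)} (hl : l.Nodup) (hadj : ∀ v ∈ l, G.Adj u v) :
    a₀ u + l.length ≤ a₀ (u + 1) := by
  classical
  rw [h.ncard_neighborSet, ← List.toFinset_card_of_nodup hl, ← Set.ncard_coe_finset]
  refine Nat.add_le_add_left (Set.ncard_le_ncard (fun v hv => hadj v ?_) (Set.toFinite _)) _
  simpa using hv

end RAM

/-! # Unique perfect matchings of claw-free graphs -/

section UniquePerfectMatching

variable {V : Type*}

/-- The involution `f` maps every vertex in `S` to its partner in a perfect matching of the
subgraph of `G` induced by `S`, and fixes all other vertices. -/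
def MatchesOn (G : SimpleGraph V) (S : Finset V) (f : V → V) : Prop :=
  (∀ v ∈ S, f v ∈ S ∧ G.Adj v (f v) ∧ f (f v) = v) ∧ ∀ v ∉ S, f v = v

def UniquelyMatchable (G : SimpleGraph V) (S : Finset V) : Prop :=
  ∃! f, MatchesOn G S f

/-- In the subgraph induced by `S`, the only neighbor of `x` is `y`. -/
def IsLeafOn (G : SimpleGraph V) (S : Finset V) (x y : V) : Prop :=
  x ∈ S ∧ y ∈ S ∧ G.Adj x y ∧ ∀ z ∈ S, G.Adj x z → z = y

/-- In the subgraph induced by `S`, the adjacent vertices `x` and `y` both have degree two, and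
they have a common neighbor. -/
def AreTwinsOn (G : SimpleGraph V) (S : Finset V) (x y : V) : Prop :=
  x ∈ S ∧ y ∈ S ∧ G.Adj x y ∧ ∃ z ∈ S, G.Adj x z ∧ G.Adj y z ∧
    (∀ w ∈ S, G.Adj x w → w = y ∨ w = z) ∧ ∀ w ∈ S, G.Adj y w → w = x ∨ w = z

theorem AreTwinsOn.symm {G : SimpleGraph V} {S : Finset V} {x y : V} (h : AreTwinsOn G S x y) :
    AreTwinsOn G S y x := by
  obtain ⟨hx, hy, hxy, z, hz, hxz, hyz, h1, h2⟩ := h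
  exact ⟨hy, hx, hxy.symm, z, hz, hyz, hxz, h2, h1⟩

/-- Perfect matchings correspond to their partner maps. Fixing the vertices outside `S` in
`MatchesOn` makes uniqueness of the map meaningful on a subset. -/
theorem hasUniquePerfectMatching_iff [Fintype V] {G : SimpleGraph V} :
    HasUniquePerfectMatching G ↔ UniquelyMatchable G Finset.univ := by
  have hA : ∀ f, MatchesOn G Finset.univ f → ∃ P : G.Subgraph, P.IsPerfectMatching ∧
      ∀ v w, P.Adj v w ↔ f v = w := by
    intro f hf
    refine ⟨⟨Set.univ, fun v w => f v = w, ?_, fun _ => Set.mem_univ _, ⟨?_⟩⟩, ⟨?_, ?_⟩,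
      fun v w => Iff.rfl⟩
    · rintro v _ rfl
      exact (hf.1 v (Finset.mem_univ v)).2.1
    · rintro v _ rfl
      exact (hf.1 v (Finset.mem_univ v)).2.2
    · exact fun v _ => ⟨f v, rfl, fun w hw => (show f v = w from hw).symm⟩
    · exact fun v => Set.mem_univ v
  have hB : ∀ P : G.Subgraph, P.IsPerfectMatching → ∃ f, MatchesOn G Finset.univ f ∧
      ∀ v w, P.Adj v w ↔ f v = w := by
    intro P hP
    choose f hf hu using fun v => hP.1 (hP.2 v)
    have hadj : ∀ v w, P.Adj v w ↔ f v = w :=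
      fun v w => ⟨fun h => (hu v w h).symm, fun h => h ▸ hf v⟩
    refine ⟨f, ⟨fun v _ => ⟨Finset.mem_univ _, (hf v).adj_sub, ?_⟩, fun v hv =>
      (hv (Finset.mem_univ v)).elim⟩, hadj⟩
    exact (hadj _ _).1 (hf v).symm
  constructor
  · rintro ⟨P, hP, hPu⟩
    obtain ⟨f, hf, hfP⟩ := hB P hP
    refine ⟨f, hf, fun g hg => ?_⟩
    obtain ⟨Q, hQ, hgQ⟩ := hA g hg
    obtain rfl := hPu Q hQ
    funext v
    exact (hgQ v _).1 ((hfP v _).2 rfl)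
  · rintro ⟨f, hf, hfu⟩
    obtain ⟨P, hP, hfP⟩ := hA f hf
    refine ⟨P, hP, fun Q hQ => ?_⟩
    obtain ⟨g, hg, hgQ⟩ := hB Q hQ
    obtain rfl := hfu g hg
    refine SimpleGraph.Subgraph.ext ?_ ?_
    · rw [SimpleGraph.Subgraph.isSpanning_iff.1 hP.2, SimpleGraph.Subgraph.isSpanning_iff.1 hQ.2]
    · ext v w
      rw [hfP, hgQ]

theorem uniquelyMatchable_empty (G : SimpleGraph V) : UniquelyMatchable G ∅ :=
  ⟨id, ⟨by simp, by simp⟩, fun f hf => funext fun v => hf.2 v (by simp)⟩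

/-- Removing and adding the forced edge are mutually inverse operations on matchings. -/
theorem uniquelyMatchable_sdiff [DecidableEq V] {G : SimpleGraph V} {S : Finset V} {x y : V}
    (hx : x ∈ S) (hy : y ∈ S) (hxy : G.Adj x y) (h : ∀ f, MatchesOn G S f → f x = y) :
    UniquelyMatchable G S ↔ UniquelyMatchable G (S \ {x, y}) := by
  have hne := hxy.ne
  have hmem : ∀ v, v ∈ S \ {x, y} ↔ v ∈ S ∧ v ≠ x ∧ v ≠ y := by simp
  have hfix : ∀ g, MatchesOn G (S \ {x, y}) g → g x = x ∧ g y = y :=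
    fun g hg => ⟨hg.2 x (by simp), hg.2 y (by simp)⟩
  have hdown : ∀ f, MatchesOn G S f →
      MatchesOn G (S \ {x, y}) (Function.update (Function.update f x x) y y) := by
    intro f hf
    have h1 : f x = y := h f hf
    have h2 : f y = x := by rw [← h1]; exact (hf.1 x hx).2.2
    constructor
    · intro v hv
      obtain ⟨hvS, hvx, hvy⟩ := (hmem v).1 hv
      obtain ⟨h3, h4, h5⟩ := hf.1 v hvS
      have h6 : f v ≠ x := fun h6 => hvy (by rw [← h5, h6, h1])
      have h7 : f v ≠ y := fun h7 => hvx (by rw [← h5, h7, h2])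
      simp [hvx, hvy, h3, h4, h5, h6, h7]
    · intro v hv
      by_cases hvy : v = y
      · subst hvy; simp
      by_cases hvx : v = x
      · subst hvx; simp [hne]
      simp only [ne_eq, hvy, not_false_eq_true, Function.update_of_ne, hvx]
      exact hf.2 v fun hvS => hv ((hmem v).2 ⟨hvS, hvx, hvy⟩)
  have hup : ∀ g, MatchesOn G (S \ {x, y}) g →
      MatchesOn G S (Function.update (Function.update g x y) y x) := by
    intro g hg
    constructor
    · intro v hv
      by_cases hvy : v = y
      · subst hvy; simp [hne, hx, hxy.symm]
      by_cases hvx : v = x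
      · subst hvx; simp [hne, hy, hxy]
      obtain ⟨h3, h4, h5⟩ := hg.1 v ((hmem v).2 ⟨hv, hvx, hvy⟩)
      obtain ⟨h6, h7, h8⟩ := (hmem _).1 h3
      simp [hvx, hvy, h6, h4, h5, h7, h8]
    · intro v hv
      have hvy : v ≠ y := by rintro rfl; exact hv hy
      have hvx : v ≠ x := by rintro rfl; exact hv hx
      simp only [ne_eq, hvy, not_false_eq_true, Function.update_of_ne, hvx]
      exact hg.2 v fun h' => hv ((hmem v).1 h').1
  constructor
  · rintro ⟨f, hf, hu⟩
    refine ⟨_, hdown f hf, fun g hg => ?_⟩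
    rw [← hu _ (hup g hg)]
    funext v
    by_cases hvy : v = y
    · subst hvy; simp [(hfix g hg).2]
    by_cases hvx : v = x
    · subst hvx; simp [hne, (hfix g hg).1]
    simp [hvx, hvy]
  · rintro ⟨g, hg, hu⟩
    refine ⟨_, hup g hg, fun f hf => ?_⟩
    have h1 : f x = y := h f hf
    have h2 : f y = x := by rw [← h1]; exact (hf.1 x hx).2.2
    rw [← hu _ (hdown f hf)]
    funext v
    by_cases hvy : v = y
    · subst hvy; simp [h2]
    by_cases hvx : v = x
    · subst hvx; simp [hne, h1]
    simp [hvx, hvy]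

theorem IsLeafOn.uniquelyMatchable_iff [DecidableEq V] {G : SimpleGraph V} {S : Finset V} {x y : V}
    (h : IsLeafOn G S x y) :
    UniquelyMatchable G S ↔ UniquelyMatchable G (S \ {x, y}) :=
  uniquelyMatchable_sdiff h.1 h.2.1 h.2.2.1 fun _ hf =>
    h.2.2.2 _ (hf.1 x h.1).1 (hf.1 x h.1).2.1

/-- If twins were not matched to each other, both would have to be matched to their common neighbor.
-/
theorem AreTwinsOn.uniquelyMatchable_iff [DecidableEq V] {G : SimpleGraph V} {S : Finset V}
    {x y : V} (h : AreTwinsOn G S x y) :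
    UniquelyMatchable G S ↔ UniquelyMatchable G (S \ {x, y}) := by
  obtain ⟨hx, hy, hxy, z, hz, hxz, hyz, h1, h2⟩ := h
  refine uniquelyMatchable_sdiff hx hy hxy fun f hf => ?_
  obtain ⟨h3, h4, h5⟩ := hf.1 x hx
  obtain ⟨h6, h7, h8⟩ := hf.1 y hy
  rcases h1 _ h3 h4 with h9 | h9
  · exact h9
  · rcases h2 _ h6 h7 with h10 | h10
    · rw [h10, h9] at h8
      exact (hyz.ne h8.symm).elim
    · rw [h9] at h5
      rw [h10, h5] at h8
      exact (hxy.ne h8).elim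

/-- In a uniquely matchable graph, there is no alternating cycle. The permutation `σ` moves the
vertices on the cycle that are the second ends of their matching edges, and conjugating the
matching with `σ` exchanges the edges of the cycle. -/
theorem UniquelyMatchable.perm_eq_one {G : SimpleGraph V} {S : Finset V}
    (h : UniquelyMatchable G S) {f : V → V} (hf : MatchesOn G S f) {σ : Equiv.Perm V}
    (hσ : ∀ c, σ c ≠ c → c ∈ S ∧ σ c ∈ S ∧ G.Adj (f (σ c)) c ∧ σ (f c) = f c) : σ = 1 := by
  have hinv : ∀ c, σ.symm c ≠ c → σ.symm c ∈ S ∧ c ∈ S ∧ G.Adj (f c) (σ.symm c) := by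
    intro c hc
    have := hσ (σ.symm c) (by simpa using hc.symm)
    simp only [Equiv.apply_symm_apply] at this
    exact ⟨this.1, this.2.1, this.2.2.1⟩
  have hmem : ∀ v, v ∈ S → σ v ∈ S := fun v hv => by
    by_cases h : σ v = v
    · rwa [h]
    · exact (hσ v h).2.1
  have hmem' : ∀ v, v ∈ S → σ.symm v ∈ S := fun v hv => by
    by_cases h : σ.symm v = v
    · rwa [h]
    · exact (hinv v h).1
  -- Conjugation by `σ` gives another matching. A vertex moved by `σ` gets the new partner `f (σ v)`
  -- along a cycle edge; the partner of a fixed vertex changes only if that partner is itself moved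
  -- by `σ⁻¹`.
  have hg : MatchesOn G S fun v => σ.symm (f (σ v)) := by
    constructor
    · intro v hv
      have h1 := hf.1 _ (hmem v hv)
      refine ⟨hmem' _ h1.1, ?_, by simp [h1.2.2]⟩
      change G.Adj v (σ.symm (f (σ v)))
      by_cases hm : σ v = v
      · rw [hm] at h1 ⊢
        by_cases hm' : σ.symm (f v) = f v
        · rw [hm']; exact h1.2.1
        · have := (hinv _ hm').2.2
          rwa [h1.2.2] at this
      · have hm' : σ (σ v) ≠ σ v := fun h' => hm (σ.injective h')
        rw [(Equiv.symm_apply_eq σ).2 (hσ _ hm').2.2.2.symm]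
        exact (hσ _ hm).2.2.1.symm
    · intro v hv
      have h1 : σ v = v := by
        by_contra h'
        exact hv (hσ v h').1
      have h2 : σ.symm v = v := (Equiv.symm_apply_eq σ).2 h1.symm
      simp [h1, hf.2 v hv, h2]
  have hgf := h.unique hg hf
  by_contra hne
  obtain ⟨c, hc⟩ : ∃ c, σ c ≠ c := by
    by_contra! h'
    exact hne (Equiv.ext h')
  obtain ⟨h1, -, -, h2⟩ := hσ c hc
  -- Since `σ` fixes `f c`, the new partner of `f c` is `σ⁻¹ c`, while the old one is `c`.
  have := congrFun hgf (f c)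
  simp only [h2, (hf.1 c h1).2.2] at this
  exact hc ((Equiv.symm_apply_eq σ).1 this).symm

theorem List.IsChain.formPerm_apply [DecidableEq V] {R : V → V → Prop} {l : List V}
    (h : l.IsChain R) (hnd : l.Nodup) (hne : l ≠ []) (hlast : R (l.getLast hne) (l.head hne))
    {c : V} (hc : c ∈ l) : R c (l.formPerm c) := by
  obtain ⟨i, hi, rfl⟩ := List.getElem_of_mem hc
  rw [List.formPerm_apply_getElem l hnd i hi]
  by_cases hi' : i + 1 < l.length
  · simp only [Nat.mod_eq_of_lt hi']
    exact List.isChain_iff_getElem.1 h i hi'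
  · have h1 : i = l.length - 1 := by omega
    have h2 : (i + 1) % l.length = 0 := by
      rw [show i + 1 = l.length by omega, Nat.mod_self]
    simp only [h2]
    subst h1
    rwa [← List.getLast_eq_getElem hne, ← List.head_eq_getElem hne]

/-- The matching edges `{x, f x}`, for the entries `x` of the list `l`, appear on an
alternating path, which leads from the last entry of the list to the `f`-image of the first entry. -/
def IsAltPath (G : SimpleGraph V) (S : Finset V) (f : V → V) (l : List V) : Prop :=
  l.IsChain (fun a b => G.Adj (f b) a) ∧ l.Nodup ∧ (∀ x ∈ l, x ∈ S) ∧ ∀ x ∈ l, f x ∉ l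

/-- Such an edge would close the part of the alternating path from `b` to `f a` to an alternating
cycle. The cyclic permutation of the list from `a` to `b` contradicts
`UniquelyMatchable.perm_eq_one`, as it moves at least two vertices. -/
theorem UniquelyMatchable.not_adj_of_isAltPath {G : SimpleGraph V} {S : Finset V}
    (h : UniquelyMatchable G S) {f : V → V} (hf : MatchesOn G S f) {a b : V} {q r : List V}
    (hl : IsAltPath G S f (a :: q ++ b :: r)) : ¬ G.Adj (f a) b := by
  classical
  intro hab
  obtain ⟨h1, h2, h3, h4⟩ := hl
  set l := a :: q ++ [b] with hl
  have hpre : l ++ r = a :: q ++ b :: r := by simp [hl]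
  rw [← hpre] at h1 h2 h3 h4
  have hne : l ≠ [] := by simp [hl]
  have hch : l.IsChain (fun a b => G.Adj (f b) a) := (List.isChain_append.1 h1).1
  have hnd : l.Nodup := (List.nodup_append.1 h2).1
  have hmem : ∀ x ∈ l, x ∈ l ++ r := fun x hx => List.mem_append_left _ hx
  have := h.perm_eq_one hf (σ := l.formPerm) (by
    intro c hc
    have hcl : c ∈ l := List.mem_of_formPerm_apply_ne hc
    have hcl' : l.formPerm c ∈ l := List.formPerm_apply_mem_of_mem hcl
    refine ⟨h3 _ (hmem _ hcl), h3 _ (hmem _ hcl'), ?_, ?_⟩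
    · exact hch.formPerm_apply hnd hne (by simpa [hl] using hab) hcl
    · exact List.formPerm_apply_of_notMem fun h' => h4 c (hmem c hcl) (hmem _ h'))
  rw [List.formPerm_eq_one_iff l hnd] at this
  simp [hl] at this

/-- The end of a longest alternating path has no neighbors except for its partner and the end of
the preceding matching edge. -/
theorem UniquelyMatchable.eq_or_of_adj {G : SimpleGraph V} (hG : ClawFree G) {S : Finset V}
    (h : UniquelyMatchable G S) {f : V → V} (hf : MatchesOn G S f) {a : V} {r : List V}
    (hl : IsAltPath G S f (a :: r))
    (hmax : ∀ l, IsAltPath G S f l → l.length ≤ (a :: r).length) {z : V} (hz : z ∈ S)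
    (haz : G.Adj (f a) z) : z = a ∨ ∃ b r', r = b :: r' ∧ z = f b := by
  have hfS := hf.1
  by_cases h1 : z ∈ a :: r
  · rcases List.mem_cons.1 h1 with rfl | h1
    · exact Or.inl rfl
    · obtain ⟨q, r', rfl⟩ := List.append_of_mem h1
      exact (h.not_adj_of_isAltPath hf hl haz).elim
  right
  have ⟨hch, hnd, hS, hdis⟩ := hl
  have hffz := (hfS z hz).2.2
  by_cases h2 : f z ∈ a :: r
  · rcases List.mem_cons.1 h2 with h2 | h2
    · rw [← h2, hffz] at haz
      exact (haz.ne rfl).elim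
    · obtain ⟨q, r', hr⟩ := List.append_of_mem h2
      generalize hb : f z = b at *
      obtain rfl : f b = z := hffz
      -- If `b` does not directly follow `a` in the list, let `e` be the entry just before `b`; a
      -- contradiction follows.
      rcases List.eq_nil_or_concat' q with rfl | ⟨q, e, rfl⟩
      · exact ⟨b, r', hr, rfl⟩
      exfalso
      subst hr
      have hbS : b ∈ S := hS b (by simp)
      have hab : ¬ G.Adj (f a) b :=
        h.not_adj_of_isAltPath hf (q := q ++ [e]) (r := r') (by simpa using hl)
      have hae : ¬ G.Adj (f a) e :=
        h.not_adj_of_isAltPath hf (q := q) (r := b :: r') (by simpa using hl)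
      have hch' : (a :: q ++ [e]).IsChain (fun a b => G.Adj (f b) a) ∧ G.Adj (f b) e := by
        have h3 : a :: (q ++ [e] ++ b :: r') = (a :: q ++ [e]) ++ b :: r' := by simp
        rw [h3, List.isChain_append] at hch
        exact ⟨hch.1, hch.2.2 e (by rw [List.getLast?_concat]; rfl) b (by simp)⟩
      -- The neighbors `b`, `e`, `f a` of `f b` do not form a claw, and `f a` is adjacent to neither
      -- `b` nor `e`, since such an edge would close an alternating cycle.
      have hbe : G.Adj b e := by
        have h4 : b ≠ e := by rintro rfl; simp [List.nodup_append] at hnd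
        have h5 := hdis a (by simp)
        have h6 : b ≠ f a := by rintro rfl; simp at h5
        have h7 : e ≠ f a := by rintro rfl; simp at h5
        have := hG.adj_of_adj (hfS b hbS).2.1.symm hch'.2 haz.symm h4 h6 h7
        rw [G.adj_comm b, G.adj_comm e] at this
        tauto
      -- Reverse the matching edge at `b` and put it at the head, which is possible as `f a` is
      -- adjacent to `f b`. The new path ends in `b`, and the edge from `b` to `e` closes an
      -- alternating cycle.
      refine h.not_adj_of_isAltPath hf (a := f b) (q := a :: q) (b := e) (r := [])
        ⟨List.isChain_cons_cons.2 ⟨haz, hch'.1⟩, ?_, ?_, ?_⟩ (by rwa [hb])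
      · simp only [List.cons_append, List.nodup_cons, List.mem_cons, List.mem_append,
          List.nodup_append] at hnd h1 ⊢
        simp only [List.not_mem_nil, or_false]
        tauto
      · intro x hx
        rcases List.mem_cons.1 hx with rfl | hx
        · exact hz
        · exact hS x (by simp at hx ⊢; tauto)
      · intro x hx
        rcases List.mem_cons.1 hx with rfl | hxq
        · rw [hb]
          intro h5
          rcases List.mem_cons.1 h5 with h5 | h5
          · exact (hfS b hbS).2.1.ne h5
          · have : b ∉ a :: (q ++ [e]) := by
              intro h6
              have h7 : a :: (q ++ [e] ++ b :: r') = (a :: (q ++ [e])) ++ b :: r' := by simp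
              rw [h7, List.nodup_append] at hnd
              exact hnd.2.2 b h6 b (by simp) rfl
            exact this (by simpa using h5)
        · have hx' : x ∈ a :: (q ++ [e] ++ b :: r') := by simp at hxq ⊢; tauto
          have h5 := hdis x hx'
          intro h6
          rcases List.mem_cons.1 h6 with h6 | h6
          · have h7 : x = b := by rw [← (hfS x (hS x hx')).2.2, h6, hb]
            subst h7
            have h7 : a :: (q ++ [e] ++ x :: r') = (a :: (q ++ [e])) ++ x :: r' := by simp
            rw [h7, List.nodup_append] at hnd
            exact hnd.2.2 x (by simpa using hxq) x (by simp) rfl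
          · exact h5 (by simp at h6 ⊢; tauto)
  · exfalso
    -- Neither end of the matching edge at `z` is an entry of the list, so the path could be
    -- extended by that edge.
    have := hmax (z :: a :: r) ⟨List.isChain_cons_cons.2 ⟨haz, hch⟩, List.nodup_cons.2 ⟨h1, hnd⟩,
      fun x hx => ?_, fun x hx => ?_⟩
    · simp at this
    · rcases List.mem_cons.1 hx with rfl | hx
      exacts [hz, hS x hx]
    · rcases List.mem_cons.1 hx with rfl | hx
      · intro h3
        rcases List.mem_cons.1 h3 with h3 | h3
        · exact (hfS x hz).2.1.ne h3.symm
        · exact h2 h3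
      · intro h3
        rcases List.mem_cons.1 h3 with h3 | h3
        · rw [← h3, (hfS x (hS x hx)).2.2] at h2
          exact h2 hx
        · exact hdis x hx h3

/-- Let `f a` be the end of a longest alternating path. By `UniquelyMatchable.eq_or_of_adj` its only
possible neighbors are `a` and the end `f b` of the preceding matching edge. If it is not adjacent
to `f b`, it is a leaf. Otherwise exchanging `a` and `f a` gives another longest path, so `a` has
the same restriction, and the two are twins. -/
theorem UniquelyMatchable.exists_isLeafOn_or_areTwinsOn [Fintype V] {G : SimpleGraph V}
    (hG : ClawFree G) {S : Finset V} (h : UniquelyMatchable G S) (hS : S.Nonempty) :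
    ∃ x y, IsLeafOn G S x y ∨ AreTwinsOn G S x y := by
  obtain ⟨f, hf, -⟩ := id h
  have hfS := hf.1
  obtain ⟨v, hv⟩ := hS
  obtain ⟨l, hne, hl, hmax⟩ : ∃ l, l ≠ [] ∧ IsAltPath G S f l ∧
      ∀ l', IsAltPath G S f l' → l'.length ≤ l.length := by
    -- Without a longest alternating path there would be arbitrarily long ones, but their entries
    -- are distinct.
    by_contra! hn
    have : ∀ k, ∃ l, IsAltPath G S f l ∧ k < l.length := by
      intro k
      induction k with
      | zero =>
        refine ⟨[v], ⟨by simp, by simp, by simpa using hv, ?_⟩, by simp⟩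
        simpa using (hfS v hv).2.1.ne'
      | succ k ih =>
        obtain ⟨l, hl, hk⟩ := ih
        obtain ⟨l', hl', hk'⟩ := hn l (by rintro rfl; simp at hk) hl
        exact ⟨l', hl', by omega⟩
    obtain ⟨l, hl, hk⟩ := this (Fintype.card V)
    have := hl.2.1.length_le_card
    omega
  obtain ⟨a, r, rfl⟩ := List.exists_cons_of_ne_nil hne
  have haS := hl.2.2.1 a (by simp)
  have ha := hfS a haS
  have hend := fun z => h.eq_or_of_adj hG hf hl hmax (z := z)
  rcases r with _ | ⟨b, r⟩
  · exact ⟨f a, a, Or.inl ⟨ha.1, haS, ha.2.1.symm, fun z hz haz => by simpa using hend z hz haz⟩⟩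
  have hend' : ∀ z ∈ S, G.Adj (f a) z → z = a ∨ z = f b := by
    intro z hz haz
    rcases hend z hz haz with h1 | ⟨b', r', h1, h2⟩
    · exact Or.inl h1
    · simp only [List.cons.injEq] at h1
      exact Or.inr (h1.1 ▸ h2)
  by_cases hab : G.Adj (f a) (f b)
  · obtain ⟨hch, hnd, hlS, hdis⟩ := hl
    have hbS := hlS b (by simp)
    -- The last matching edge is traversed in the other direction, so that the path now ends in `a`.
    have hl' : IsAltPath G S f (f a :: b :: r) := by
      refine ⟨List.isChain_cons_cons.2 ⟨hab.symm, (List.isChain_cons_cons.1 hch).2⟩, ?_, ?_, ?_⟩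
      · refine List.nodup_cons.2 ⟨fun h' => hdis a (by simp) (List.mem_cons_of_mem _ h'),
          (List.nodup_cons.1 hnd).2⟩
      · intro x hx
        rcases List.mem_cons.1 hx with rfl | hx
        exacts [ha.1, hlS x (List.mem_cons_of_mem _ hx)]
      · intro x hx h'
        rcases List.mem_cons.1 hx with rfl | hxr
        · rw [ha.2.2] at h'
          rcases List.mem_cons.1 h' with h' | h'
          · exact ha.2.1.ne h'
          · exact (List.nodup_cons.1 hnd).1 h'
        · have hx' := List.mem_cons_of_mem a hxr
          rcases List.mem_cons.1 h' with h' | h'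
          · have h1 : x = a := by rw [← (hfS x (hlS x hx')).2.2, h', ha.2.2]
            subst h1
            exact (List.nodup_cons.1 hnd).1 hxr
          · exact hdis x hx' (List.mem_cons_of_mem _ h')
    refine ⟨f a, a, Or.inr ⟨ha.1, haS, ha.2.1.symm, f b, (hfS b hbS).1, hab,
      (List.isChain_cons_cons.1 hch).1.symm, hend', fun w hw haw => ?_⟩⟩
    rcases h.eq_or_of_adj hG hf hl' (by simpa using hmax) hw (by rwa [ha.2.2]) with
      h1 | ⟨b', r', h1, h2⟩
    · exact Or.inl h1
    · simp only [List.cons.injEq] at h1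
      exact Or.inr (h1.1 ▸ h2)
  · refine ⟨f a, a, Or.inl ⟨ha.1, haS, ha.2.1.symm, fun z hz haz => ?_⟩⟩
    rcases hend' z hz haz with h1 | rfl
    exacts [h1, (hab haz).elim]

end UniquePerfectMatching

/-! # Recognition of the claw-free graphs with a unique perfect matching -/

namespace RAM

theorem sum_add_eq_sum_add {α : Type*} [Fintype α] {f g : α → ℕ} {x : α}
    (h : ∀ v, v ≠ x → f v = g v) : ∑ v, f v + g x = ∑ v, g v + f x := by
  classical
  have : ∑ v ∈ Finset.univ.erase x, f v = ∑ v ∈ Finset.univ.erase x, g v :=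
    Finset.sum_congr rfl fun v hv => h v (Finset.ne_of_mem_erase hv)
  rw [← Finset.add_sum_erase _ f (Finset.mem_univ x),
    ← Finset.add_sum_erase _ g (Finset.mem_univ x), this]
  omega

/-- For the vertex `v`, the positions `p₁ < p₂ < p₃` are a window on the list of its neighbors: all
neighbors at other positions before `p₃` are dead. -/
structure Window (a₀ a₁ dead : ℕ → ℕ) (v p₁ p₂ p₃ : ℕ) : Prop where
  le₁ : a₀ v ≤ p₁
  lt₁₂ : p₁ < p₂
  lt₂₃ : p₂ < p₃
  bound₁ : p₁ ≤ a₀ (v + 1)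
  bound₂ : p₂ ≤ a₀ (v + 1) + 1
  bound₃ : p₃ ≤ a₀ (v + 1) + 2
  tight₁ : p₁ < a₀ (v + 1) → p₂ ≤ a₀ (v + 1) ∧ p₃ ≤ a₀ (v + 1) + 1
  tight₂ : p₂ < a₀ (v + 1) → p₃ ≤ a₀ (v + 1)
  dead_of_lt : ∀ j, a₀ v ≤ j → j < a₀ (v + 1) → j < p₃ → j ≠ p₁ → j ≠ p₂ → dead (a₁ j) ≠ 0

/-! ### The recognition program and its invariants -/

namespace Recognition

open RAM.Cmd

/-- Move the window of the vertex in register `r` by one position if one of its entries is dead.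
Otherwise continue with `c₀`, `c₁`, `c₂`, or `c₃` if the number of alive neighbors is `0`,
`1`, `2`, or larger; registers `24` and `25` hold the first two alive neighbors. -/
def probe (r : ℕ) (c₀ c₁ c₂ c₃ : Cmd) : Cmd :=
  block [.copy 20 r, .inc 20, .load 20 0 20, .load 21 2 r, .load 22 3 r, .load 23 4 r,
    .cond (.lt 21 20)
      (block [.load 24 1 21, .load 26 6 24, .cond (.eq 26 5)
        (.cond (.lt 22 20)
          (block [.load 25 1 22, .load 26 6 25, .cond (.eq 26 5)
            (.cond (.lt 23 20)
              (block [.load 27 1 23, .load 26 6 27, .cond (.eq 26 5) c₃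
                (block [.inc 23, .save 4 r 23])])
              c₂)
            (block [.save 3 r 23, .inc 23, .save 4 r 23])])
          c₁)
        (block [.save 2 r 22, .save 3 r 23, .inc 23, .save 4 r 23])])
      c₀]

theorem loopFree_probe {r : ℕ} {c₀ c₁ c₂ c₃ : Cmd} (h₀ : c₀.LoopFree) (h₁ : c₁.LoopFree)
    (h₂ : c₂.LoopFree) (h₃ : c₃.LoopFree) : (probe r c₀ c₁ c₂ c₃).LoopFree := by
  simp [probe, block, LoopFree, h₀, h₁, h₂, h₃]

/-- The command `c` has executed the window-moving part of `probe` for the vertex `x`. -/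
structure Shifted {n : ℕ} (a₀ a₁ : ℕ → ℕ) (x : Fin n) (σ τ : Store) : Prop where
  arr_eq : ∀ k, k ≠ 2 → k ≠ 3 → k ≠ 4 → τ.arr k = σ.arr k
  arr_of_ne : ∀ k i, i ≠ (x : ℕ) → τ.arr k i = σ.arr k i
  window : Window a₀ a₁ (σ.arr 6) x (τ.arr 2 x) (τ.arr 3 x) (τ.arr 4 x)
  succ : τ.arr 4 x = σ.arr 4 x + 1
  lt : σ.arr 4 x < a₀ (x + 1) + 2

/-- Positions at or beyond the end of the list stand for missing candidates. All other entries
before `p₃` are dead, so once the candidates inside the list are alive, their number is the exact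
count if it is below three, and three of them show that it is at least three. The bounds `tight₁`
and `tight₂` of the window keep `p₃` within two positions of the end, which limits the number of
shifts. -/
theorem exec_probe {n : ℕ} {G : SimpleGraph (Fin n)} {a₀ a₁ : ℕ → ℕ} (hL : Layout G a₀ a₁)
    {r : ℕ} (hr : r < 20) {σ : Store} (h0 : σ.arr 0 = a₀) (h1 : σ.arr 1 = a₁) (h5 : σ.reg 5 = 0)
    {x : Fin n} (hx : σ.reg r = x)
    (hW : Window a₀ a₁ (σ.arr 6) x (σ.arr 2 x) (σ.arr 3 x) (σ.arr 4 x)) (c₀ c₁ c₂ c₃ : Cmd) :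
    ∃ τ : Store, (∀ k < 20, τ.reg k = σ.reg k) ∧
      (((probe r c₀ c₁ c₂ c₃).exec σ = τ ∧ Shifted a₀ a₁ x σ τ) ∨
      (τ.arr = σ.arr ∧
        (((probe r c₀ c₁ c₂ c₃).exec σ = c₀.exec τ ∧ ∀ y, G.Adj x y → σ.arr 6 y ≠ 0) ∨
        ((probe r c₀ c₁ c₂ c₃).exec σ = c₁.exec τ ∧ ∃ y : Fin n, τ.reg 24 = y ∧ G.Adj x y ∧
          σ.arr 6 y = 0 ∧ ∀ z, G.Adj x z → σ.arr 6 z = 0 → z = y) ∨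
        ((probe r c₀ c₁ c₂ c₃).exec σ = c₂.exec τ ∧ ∃ y z : Fin n, y ≠ z ∧ τ.reg 24 = y ∧
          τ.reg 25 = z ∧ G.Adj x y ∧ G.Adj x z ∧ σ.arr 6 y = 0 ∧ σ.arr 6 z = 0 ∧
          ∀ w, G.Adj x w → σ.arr 6 w = 0 → w = y ∨ w = z) ∨
        ((probe r c₀ c₁ c₂ c₃).exec σ = c₃.exec τ ∧ ∃ y z w : Fin n, y ≠ z ∧ y ≠ w ∧ z ≠ w ∧
          G.Adj x y ∧ G.Adj x z ∧ G.Adj x w ∧ σ.arr 6 y = 0 ∧ σ.arr 6 z = 0 ∧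
          σ.arr 6 w = 0)))) := by
  have hr20 : r ≠ 20 := by omega
  have hr21 : r ≠ 21 := by omega
  have hr22 : r ≠ 22 := by omega
  have hr23 : r ≠ 23 := by omega
  have hr24 : r ≠ 24 := by omega
  have hr25 : r ≠ 25 := by omega
  have hr26 : r ≠ 26 := by omega
  have hr27 : r ≠ 27 := by omega
  obtain ⟨p1, hp1⟩ : ∃ p, σ.arr 2 x = p := ⟨_, rfl⟩
  obtain ⟨p2, hp2⟩ : ∃ p, σ.arr 3 x = p := ⟨_, rfl⟩
  obtain ⟨p3, hp3⟩ : ∃ p, σ.arr 4 x = p := ⟨_, rfl⟩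
  obtain ⟨e, he⟩ : ∃ e, a₀ (x + 1) = e := ⟨_, rfl⟩
  rw [hp1, hp2, hp3] at hW
  have ⟨w1, w2, w3, w4, w5, w6, w7, w8, w9⟩ := hW
  rw [he] at w4 w5 w6 w7 w8 w9
  have hmem : ∀ y, G.Adj x y → ∃ j, a₀ x ≤ j ∧ j < e ∧ a₁ j = y := fun y hy =>
    he ▸ (hL.adj_iff x y).1 hy
  have hget : ∀ j, a₀ x ≤ j → j < e → ∃ y : Fin n, G.Adj x y ∧ a₁ j = y := fun j hj hj' =>
    hL.exists_adj x j hj (he ▸ hj')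
  have hinj : ∀ j k, a₀ x ≤ j → j < e → a₀ x ≤ k → k < e → a₁ j = a₁ k → j = k :=
    fun j k h1 h2 h3 h4 => hL.inj x j k h1 (he ▸ h2) h3 (he ▸ h4)
  obtain ⟨σ₁, hσ₁⟩ : ∃ τ : Store, τ = (((((σ.setReg 20 x).setReg 20 (x + 1)).setReg 20 e).setReg
    21 p1).setReg 22 p2).setReg 23 p3 := ⟨_, rfl⟩
  have hreg₁ : ∀ k < 20, σ₁.reg k = σ.reg k := by
    intro k hk
    simp [hσ₁, Store.setReg_reg, show k ≠ 20 by omega, show k ≠ 21 by omega,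
      show k ≠ 22 by omega, show k ≠ 23 by omega]
  by_cases c1 : p1 < e
  swap
  · refine ⟨σ₁, hreg₁, Or.inr ⟨by rw [hσ₁]; rfl, Or.inl ⟨?_, ?_⟩⟩⟩
    · simp only [probe, exec_block_nil, exec_block_cons, exec, eval_eq_iff, eval_lt_iff,
        Store.setReg_reg, Store.setReg_arr]
      simp [h0, hx, hr20, hr21, hr22, hp1, hp2, hp3, he, c1, hσ₁]
    · intro y hy
      obtain ⟨j, hj, hj', hjy⟩ := hmem y hy
      rw [← hjy]
      exact w9 j hj hj' (by omega) (by omega) (by omega)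
  obtain ⟨v1, hv1, hav1⟩ := hget p1 w1 c1
  obtain ⟨σ₂, hσ₂⟩ : ∃ τ : Store, τ = (σ₁.setReg 24 v1).setReg 26 (σ.arr 6 v1) := ⟨_, rfl⟩
  have hreg₂ : ∀ k < 20, σ₂.reg k = σ.reg k := by
    intro k hk
    rw [← hreg₁ k hk]
    simp [hσ₂, Store.setReg_reg, show k ≠ 24 by omega, show k ≠ 26 by omega]
  by_cases d1 : σ.arr 6 v1 = 0
  swap
  · refine ⟨((σ₂.setArr 2 x p2).setArr 3 x p3 |>.setReg 23 (p3 + 1)).setArr 4 x (p3 + 1), ?_,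
      Or.inl ⟨?_, ?_⟩⟩
    · intro k hk
      rw [← hreg₂ k hk]
      simp [Store.setReg_reg, Store.setArr_reg, show k ≠ 23 by omega]
    · simp only [probe, exec_block_nil, exec_block_cons, exec, eval_eq_iff, eval_lt_iff,
        Store.setReg_reg, Store.setReg_arr, Store.setArr_reg]
      simp [h0, h1, h5, hx, hr20, hr21, hr22, hr23, hr24, hr26, hp1, hp2, hp3, he, c1, hσ₂, hσ₁,
        hav1, d1]
    · refine ⟨?_, ?_, ?_, ?_, ?_⟩
      · intro k h2 h3 h4
        simp [Store.setReg_arr, Store.setArr_arr, h2, h3, h4, hσ₂, hσ₁]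
      · intro k i hi
        simp only [Store.setReg_arr, Store.setArr_arr_of_ne _ _ _ _ hi, hσ₂, hσ₁]
      · simp only [Store.setReg_arr, Store.setArr_arr]
        simp only [Function.update_self, if_true, Nat.reduceEqDiff, if_false]
        -- The only position newly required to be dead is the discarded `p1`; likewise for `p2` and
        -- `p3` in the other two shifts.
        refine ⟨by omega, by omega, by omega, by omega, by omega, by omega, by omega, by omega,
          fun j hj hj' hj1 hj2 hj3 => ?_⟩
        by_cases hjp : j = p1
        · rwa [hjp, hav1]
        · exact w9 j hj (he ▸ hj') (by omega) hjp hj2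
      · simp [Store.setReg_arr, Store.setArr_arr, hp3]
      · omega
  by_cases c2 : p2 < e
  swap
  · refine ⟨σ₂, hreg₂, Or.inr ⟨by rw [hσ₂, hσ₁]; rfl, Or.inr (Or.inl ⟨?_, v1, ?_, hv1, d1, ?_⟩)⟩⟩
    · simp only [probe, exec_block_nil, exec_block_cons, exec, eval_eq_iff, eval_lt_iff,
        Store.setReg_reg, Store.setReg_arr]
      simp [h0, h1, h5, hx, hr20, hr21, hr22, hp1, hp2, hp3, he, c1, hσ₁, hσ₂, hav1, d1, c2]
    · simp [hσ₂, Store.setReg_reg]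
    · intro z hz hz'
      obtain ⟨j, hj, hj', hjz⟩ := hmem z hz
      by_cases hjp : j = p1
      · exact Fin.ext (by rw [← hjz, hjp, hav1])
      · rw [← hjz] at hz'
        exact (w9 j hj hj' (by omega) hjp (by omega) hz').elim
  obtain ⟨v2, hv2, hav2⟩ := hget p2 (by omega) c2
  have hv12 : v1 ≠ v2 := by
    rintro rfl
    have := hinj p1 p2 w1 c1 (by omega) c2 (hav1.trans hav2.symm)
    omega
  obtain ⟨σ₃, hσ₃⟩ : ∃ τ : Store, τ = (σ₂.setReg 25 v2).setReg 26 (σ.arr 6 v2) := ⟨_, rfl⟩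
  have hreg₃ : ∀ k < 20, σ₃.reg k = σ.reg k := by
    intro k hk
    rw [← hreg₂ k hk]
    simp [hσ₃, Store.setReg_reg, show k ≠ 25 by omega, show k ≠ 26 by omega]
  by_cases d2 : σ.arr 6 v2 = 0
  swap
  · refine ⟨(σ₃.setArr 3 x p3 |>.setReg 23 (p3 + 1)).setArr 4 x (p3 + 1), ?_,
      Or.inl ⟨?_, ?_⟩⟩
    · intro k hk
      rw [← hreg₃ k hk]
      simp [Store.setReg_reg, Store.setArr_reg, show k ≠ 23 by omega]
    · simp only [probe, exec_block_nil, exec_block_cons, exec, eval_eq_iff, eval_lt_iff,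
        Store.setReg_reg, Store.setReg_arr, Store.setArr_reg]
      simp [h0, h1, h5, hx, hr20, hr21, hr22, hr23, hr24, hr25, hr26, hp1, hp2, hp3, he, c1, hσ₃,
        hσ₂, hσ₁, hav1, d1, c2, hav2, d2]
    · refine ⟨?_, ?_, ?_, ?_, ?_⟩
      · intro k h2 h3 h4
        simp [Store.setReg_arr, Store.setArr_arr, h3, h4, hσ₃, hσ₂, hσ₁]
      · intro k i hi
        simp only [Store.setReg_arr, Store.setArr_arr_of_ne _ _ _ _ hi, hσ₃, hσ₂, hσ₁]
      · simp only [Store.setReg_arr, Store.setArr_arr, hσ₃, hσ₂, hσ₁]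
        simp only [Function.update_self, if_true, Nat.reduceEqDiff, if_false,
          hp1]
        refine ⟨by omega, by omega, by omega, by omega, by omega, by omega, by omega, by omega,
          fun j hj hj' hj1 hj2 hj3 => ?_⟩
        by_cases hjp : j = p2
        · rwa [hjp, hav2]
        · exact w9 j hj (he ▸ hj') (by omega) hj2 hjp
      · simp [Store.setReg_arr, Store.setArr_arr, hp3]
      · omega
  by_cases c3 : p3 < e
  swap
  · refine ⟨σ₃, hreg₃, Or.inr ⟨by rw [hσ₃, hσ₂, hσ₁]; rfl, Or.inr (Or.inr (Or.inl
      ⟨?_, v1, v2, hv12, ?_, ?_, hv1, hv2, d1, d2, ?_⟩))⟩⟩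
    · simp only [probe, exec_block_nil, exec_block_cons, exec, eval_eq_iff, eval_lt_iff,
        Store.setReg_reg, Store.setReg_arr]
      simp [h0, h1, h5, hx, hr20, hr21, hr22, hp1, hp2, hp3, he, c1, hσ₁, hσ₂, hσ₃, hav1, d1, c2,
        hav2, d2, c3]
    · simp [hσ₃, hσ₂, Store.setReg_reg]
    · simp [hσ₃, Store.setReg_reg]
    · intro z hz hz'
      obtain ⟨j, hj, hj', hjz⟩ := hmem z hz
      by_cases hjp : j = p1
      · exact Or.inl (Fin.ext (by rw [← hjz, hjp, hav1]))
      · by_cases hjp2 : j = p2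
        · exact Or.inr (Fin.ext (by rw [← hjz, hjp2, hav2]))
        · rw [← hjz] at hz'
          exact (w9 j hj hj' (by omega) hjp hjp2 hz').elim
  obtain ⟨v3, hv3, hav3⟩ := hget p3 (by omega) c3
  obtain ⟨σ₄, hσ₄⟩ : ∃ τ : Store, τ = (σ₃.setReg 27 v3).setReg 26 (σ.arr 6 v3) := ⟨_, rfl⟩
  have hreg₄ : ∀ k < 20, σ₄.reg k = σ.reg k := by
    intro k hk
    rw [← hreg₃ k hk]
    simp [hσ₄, Store.setReg_reg, show k ≠ 27 by omega, show k ≠ 26 by omega]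
  by_cases d3 : σ.arr 6 v3 = 0
  · refine ⟨σ₄, hreg₄, Or.inr ⟨by rw [hσ₄, hσ₃, hσ₂, hσ₁]; rfl, Or.inr (Or.inr (Or.inr
      ⟨?_, v1, v2, v3, hv12, ?_, ?_, hv1, hv2, hv3, d1, d2, d3⟩))⟩⟩
    · simp only [probe, exec_block_nil, exec_block_cons, exec, eval_eq_iff, eval_lt_iff,
        Store.setReg_reg, Store.setReg_arr]
      simp [h0, h1, h5, hx, hr20, hr21, hr22, hp1, hp2, hp3, he, c1, hσ₁, hσ₂, hσ₃, hσ₄, hav1, d1,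
        c2, hav2, d2, c3, hav3, d3]
    · rintro rfl
      have := hinj p1 p3 w1 c1 (by omega) c3 (hav1.trans hav3.symm)
      omega
    · rintro rfl
      have := hinj p2 p3 (by omega) c2 (by omega) c3 (hav2.trans hav3.symm)
      omega
  · refine ⟨(σ₄.setReg 23 (p3 + 1)).setArr 4 x (p3 + 1), ?_, Or.inl ⟨?_, ?_⟩⟩
    · intro k hk
      rw [← hreg₄ k hk]
      simp [Store.setReg_reg, Store.setArr_reg, show k ≠ 23 by omega]
    · simp only [probe, exec_block_nil, exec_block_cons, exec, eval_eq_iff, eval_lt_iff,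
        Store.setReg_reg, Store.setReg_arr, Store.setArr_reg]
      simp [h0, h1, h5, hx, hr20, hr21, hr22, hr23, hr24, hr25, hr26, hr27, hp1, hp2, hp3, he, c1,
        hσ₄, hσ₃, hσ₂, hσ₁, hav1, d1, c2, hav2, d2, c3, hav3, d3]
    · refine ⟨?_, ?_, ?_, ?_, ?_⟩
      · intro k h2 h3 h4
        simp [Store.setReg_arr, Store.setArr_arr, h4, hσ₄, hσ₃, hσ₂, hσ₁]
      · intro k i hi
        simp only [Store.setReg_arr, Store.setArr_arr_of_ne _ _ _ _ hi, hσ₄, hσ₃, hσ₂, hσ₁]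
      · simp only [Store.setReg_arr, Store.setArr_arr, hσ₄, hσ₃, hσ₂, hσ₁]
        simp only [Function.update_self, if_true, Nat.reduceEqDiff, if_false,
          hp1, hp2]
        refine ⟨by omega, by omega, by omega, by omega, by omega, by omega, by omega, by omega,
          fun j hj hj' hj1 hj2 hj3 => ?_⟩
        by_cases hjp : j = p3
        · rwa [hjp, hav3]
        · exact w9 j hj (he ▸ hj') (by omega) hj2 hj3
      · simp [Store.setReg_arr, Store.setArr_arr, hp3]
      · omega

/-- Initialize the window of the vertex in register `7`, and put it on the stack. -/
def initCode : Cmd :=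
  .cond (.eq 7 0) (.const 6 1)
    (block [.load 20 0 7, .save 2 7 20, .inc 20, .save 3 7 20, .inc 20, .save 4 7 20, .save 8 2 7,
      .inc 2, .inc 7])

def popCode : Cmd :=
  .cond (.eq 2 5)
    (block [.const 4 1, .cond (.eq 3 0) (.const 1 1) (.const 1 0)])
    (block [.dec 2, .load 10 8 2, .load 20 6 10, .cond (.eq 20 5) (.const 6 2) .skip])

/-- Examine the number of alive neighbors of the vertex in register `10`. -/
def examineCode : Cmd :=
  probe 10 (.const 6 1) (block [.copy 11 24, .const 6 4])
    (block [.copy 11 24, .copy 12 25, .const 13 0, .const 6 3]) (.const 6 1)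

def failCode : Cmd :=
  .cond (.eq 13 5) (block [.copy 20 11, .copy 11 12, .copy 12 20, .const 13 1]) (.const 6 1)

/-- Test whether the vertices in the registers `10` and `11` are twins with the common neighbor in
register `12`. -/
def compareCode : Cmd :=
  probe 11 failCode failCode
    (.cond (.eq 24 12) (.const 6 4) (.cond (.eq 25 12) (.const 6 4) failCode)) failCode

def removeCode : Cmd :=
  block [.const 20 1, .save 6 10 20, .save 6 11 20, .inc 3, .inc 3, .load 14 0 10, .copy 15 10,
    .inc 15, .load 15 0 15, .const 13 0, .const 6 5]

/-- Put the neighbors of the deleted vertices on the stack. -/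
def pushCode : Cmd :=
  .cond (.lt 14 15) (block [.load 20 1 14, .save 8 2 20, .inc 2, .inc 14])
    (.cond (.eq 13 5) (block [.load 14 0 11, .copy 15 11, .inc 15, .load 15 0 15, .const 13 1])
      (.const 6 1))

def body : Cmd :=
  dispatcher [initCode, popCode, examineCode, compareCode, removeCode, pushCode]

theorem loopFree_body : body.LoopFree := by
  refine loopFree_dispatcher ?_
  have hf : failCode.LoopFree := by simp [failCode, block, LoopFree]
  simp only [List.mem_cons, List.not_mem_nil, or_false, forall_eq_or_imp, forall_eq]
  refine ⟨?_, ?_, ?_, ?_, ?_, ?_⟩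
  · simp [initCode, block, LoopFree]
  · simp [popCode, block, LoopFree]
  · exact loopFree_probe trivial (by simp [block, LoopFree]) (by simp [block, LoopFree]) trivial
  · exact loopFree_probe hf hf ⟨trivial, trivial, hf⟩ hf
  · simp [removeCode, block, LoopFree]
  · simp [pushCode, block, LoopFree]

def OnStack {n : ℕ} (σ : Store) (v : Fin n) : Prop :=
  ∃ j < σ.reg 2, σ.arr 8 j = v

/-- The invariants of the main part of the program. The set `S` consists of the remaining vertices,
and every vertex that can be deleted together with a neighbor is on the stack or in `E`. -/
structure Main {n : ℕ} (G : SimpleGraph (Fin n)) (a₀ a₁ : ℕ → ℕ) (S : Finset (Fin n))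
    (E : Fin n → Prop) (σ : Store) : Prop where
  reg₀ : σ.reg 0 = n
  reg₅ : σ.reg 5 = 0
  reg₄ : σ.reg 4 = 0
  count : σ.reg 3 + S.card = n
  arr₀ : σ.arr 0 = a₀
  arr₁ : σ.arr 1 = a₁
  mem_iff : ∀ v : Fin n, v ∈ S ↔ σ.arr 6 v = 0
  window : ∀ v : Fin n, Window a₀ a₁ (σ.arr 6) v (σ.arr 2 v) (σ.arr 3 v) (σ.arr 4 v)
  stack : ∀ j < σ.reg 2, ∃ v : Fin n, σ.arr 8 j = v
  iff : UniquelyMatchable G Finset.univ ↔ UniquelyMatchable G S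
  leaf : ∀ x y, IsLeafOn G S x y → OnStack σ x ∨ E x
  twins : ∀ x y, AreTwinsOn G S x y → (OnStack σ x ∨ E x) ∨ (OnStack σ y ∨ E y)

/-- The first summand pays for the remaining shifts of the window. The second is released when the
vertex is deleted and pays for pushing its neighbors: each push costs one iteration and the 10 units
deposited on the stack entry. -/
def credit (a₀ : ℕ → ℕ) (σ : Store) (v : ℕ) : ℕ :=
  (a₀ (v + 1) + 2 - σ.arr 4 v) + if σ.arr 6 v = 0 then 20 * (a₀ (v + 1) - a₀ v) + 30 else 0

/-- The 10 units of a stack entry pay for popping and testing it. The additive constants in `Inv`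
decrease along the control flow of one test, so changes of the control point are paid as well. -/
def base (n : ℕ) (a₀ : ℕ → ℕ) (σ : Store) : ℕ :=
  ∑ v : Fin n, credit a₀ σ v + 10 * σ.reg 2

/-- The invariants of the loop, with an upper bound `φ` for the number of remaining iterations. -/
inductive Inv {n : ℕ} (G : SimpleGraph (Fin n)) (a₀ a₁ : ℕ → ℕ) (φ : ℕ) (σ : Store) : Prop
  | init (h6 : σ.reg 6 = 0) (h0 : σ.reg 0 = n) (h5 : σ.reg 5 = 0) (h4 : σ.reg 4 = 0)
      (h3 : σ.reg 3 = 0) (h7 : σ.reg 7 ≤ n) (h2 : σ.reg 2 = σ.reg 7) (ha₀ : σ.arr 0 = a₀)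
      (ha₁ : σ.arr 1 = a₁) (ha₆ : ∀ v, σ.arr 6 v = 0)
      (hv : ∀ v < σ.reg 7, σ.arr 8 v = v ∧ σ.arr 2 v = a₀ v ∧ σ.arr 3 v = a₀ v + 1 ∧
        σ.arr 4 v = a₀ v + 2)
      (hφ : (n - σ.reg 7) + (∑ v : Fin n, (21 * (a₀ (v + 1) - a₀ v) + 30) + 10 * n) + 2 ≤ φ)
  | pop (S : Finset (Fin n)) (h : Main G a₀ a₁ S (fun _ => False) σ) (h6 : σ.reg 6 = 1)
      (hφ : base n a₀ σ + 1 ≤ φ)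
  | examine (S : Finset (Fin n)) (x : Fin n) (h : Main G a₀ a₁ S (· = x) σ) (h6 : σ.reg 6 = 2)
      (hx : σ.reg 10 = x) (hxS : x ∈ S) (hφ : base n a₀ σ + 8 ≤ φ)
  | compare (S : Finset (Fin n)) (x y z : Fin n) (h : Main G a₀ a₁ S (· = x) σ)
      (h6 : σ.reg 6 = 3) (hx : σ.reg 10 = x) (hy : σ.reg 11 = y) (hz : σ.reg 12 = z)
      (hxS : x ∈ S) (hyS : y ∈ S) (hzS : z ∈ S) (hyz : y ≠ z) (hxy : G.Adj x y) (hxz : G.Adj x z)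
      (hadj : ∀ w ∈ S, G.Adj x w → w = y ∨ w = z)
      -- Register `13` tells whether `y` is the first or the second candidate for a twin of `x`; in
      -- the second round the other one has already been refuted.
      (hφ : (σ.reg 13 = 0 ∧ base n a₀ σ + 6 ≤ φ) ∨
        (σ.reg 13 ≠ 0 ∧ ¬ AreTwinsOn G S x z ∧ base n a₀ σ + 4 ≤ φ))
  | remove (S : Finset (Fin n)) (x y : Fin n) (h : Main G a₀ a₁ S (· = x) σ) (h6 : σ.reg 6 = 4)
      (hx : σ.reg 10 = x) (hy : σ.reg 11 = y) (hxS : x ∈ S) (hyS : y ∈ S) (hxy : G.Adj x y)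
      (hiff : UniquelyMatchable G S ↔ UniquelyMatchable G (S \ {x, y}))
      (hφ : base n a₀ σ + 3 ≤ φ)
  | push₁ (S : Finset (Fin n)) (x y : Fin n)
      (h : Main G a₀ a₁ S (fun v => (∃ j, σ.reg 14 ≤ j ∧ j < σ.reg 15 ∧ a₁ j = v) ∨ G.Adj y v) σ)
      (h6 : σ.reg 6 = 5) (hy : σ.reg 11 = y) (h13 : σ.reg 13 = 0) (h14 : a₀ x ≤ σ.reg 14)
      (h15 : σ.reg 15 = a₀ (x + 1))
      (hφ : base n a₀ σ + 20 * (σ.reg 15 - σ.reg 14) + 20 * (a₀ (y + 1) - a₀ y) + 5 ≤ φ)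
  | push₂ (S : Finset (Fin n)) (y : Fin n)
      (h : Main G a₀ a₁ S (fun v => ∃ j, σ.reg 14 ≤ j ∧ j < σ.reg 15 ∧ a₁ j = v) σ)
      (h6 : σ.reg 6 = 5) (h13 : σ.reg 13 ≠ 0) (h14 : a₀ y ≤ σ.reg 14) (h15 : σ.reg 15 = a₀ (y + 1))
      (hφ : base n a₀ σ + 20 * (σ.reg 15 - σ.reg 14) + 3 ≤ φ)
  | done (h4 : σ.reg 4 = 1) (h5 : σ.reg 5 = 0) (h : UniquelyMatchable G Finset.univ → σ.reg 1 = 1)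
      (h' : ¬ UniquelyMatchable G Finset.univ → σ.reg 1 = 0)

/-! ### Every block of the recognition program preserves the invariant and lowers the potential -/

variable {n : ℕ} {G : SimpleGraph (Fin n)} {a₀ a₁ : ℕ → ℕ} {S : Finset (Fin n)}
  {E E' : Fin n → Prop} {σ τ : Store}

theorem base_congr (h2 : τ.reg 2 = σ.reg 2) (h4 : τ.arr 4 = σ.arr 4) (h6 : τ.arr 6 = σ.arr 6) :
    base n a₀ τ = base n a₀ σ := by
  simp [base, credit, h2, h4, h6]

theorem Main.congr (h : Main G a₀ a₁ S E σ) (hreg : ∀ r < 6, τ.reg r = σ.reg r)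
    (harr : τ.arr = σ.arr) : Main G a₀ a₁ S E τ where
  reg₀ := by rw [hreg 0 (by norm_num), h.reg₀]
  reg₅ := by rw [hreg 5 (by norm_num), h.reg₅]
  reg₄ := by rw [hreg 4 (by norm_num), h.reg₄]
  count := by rw [hreg 3 (by norm_num), h.count]
  arr₀ := by rw [harr, h.arr₀]
  arr₁ := by rw [harr, h.arr₁]
  mem_iff := by rw [harr]; exact h.mem_iff
  window := by rw [harr]; exact h.window
  stack := by rw [harr, hreg 2 (by norm_num)]; exact h.stack
  iff := h.iff
  leaf := by simpa only [OnStack, harr, hreg 2 (by norm_num)] using h.leaf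
  twins := by simpa only [OnStack, harr, hreg 2 (by norm_num)] using h.twins

/-- A vertex may be forgotten once it is known to belong to no reducible pair. For twins it suffices
to remember one of the two, because testing it considers both of its neighbors as possible twins. -/
theorem Main.mono (h : Main G a₀ a₁ S E σ)
    (hE : ∀ v, E v → (OnStack σ v ∨ E' v) ∨
      ((∀ y, ¬ IsLeafOn G S v y) ∧ ∀ y, ¬ AreTwinsOn G S v y)) : Main G a₀ a₁ S E' σ :=
  { h with
    leaf := by
      intro x y hxy
      rcases h.leaf x y hxy with h1 | h1
      · exact Or.inl h1
      · rcases hE x h1 with h2 | h2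
        exacts [h2, (h2.1 y hxy).elim]
    twins := by
      intro x y hxy
      rcases h.twins x y hxy with (h1 | h1) | (h1 | h1)
      · exact Or.inl (Or.inl h1)
      · rcases hE x h1 with h2 | h2
        exacts [Or.inl h2, (h2.2 y hxy).elim]
      · exact Or.inr (Or.inl h1)
      · rcases hE y h1 with h2 | h2
        exacts [Or.inr h2, (h2.2 x hxy.symm).elim] }

theorem Main.shift {x : Fin n} (h : Main G a₀ a₁ S E σ) (hreg : ∀ r < 20, τ.reg r = σ.reg r)
    (hs : Shifted a₀ a₁ x σ τ) :
    Main G a₀ a₁ S E τ ∧ base n a₀ τ + 1 = base n a₀ σ := by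
  have h6 : τ.arr 6 = σ.arr 6 := hs.arr_eq 6 (by norm_num) (by norm_num) (by norm_num)
  have h8 : τ.arr 8 = σ.arr 8 := hs.arr_eq 8 (by norm_num) (by norm_num) (by norm_num)
  have hst : ∀ v : Fin n, OnStack τ v ↔ OnStack σ v := by
    simp [OnStack, h8, hreg 2]
  constructor
  · exact {
      reg₀ := by rw [hreg 0 (by norm_num), h.reg₀]
      reg₅ := by rw [hreg 5 (by norm_num), h.reg₅]
      reg₄ := by rw [hreg 4 (by norm_num), h.reg₄]
      count := by rw [hreg 3 (by norm_num), h.count]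
      arr₀ := by rw [hs.arr_eq 0 (by norm_num) (by norm_num) (by norm_num), h.arr₀]
      arr₁ := by rw [hs.arr_eq 1 (by norm_num) (by norm_num) (by norm_num), h.arr₁]
      mem_iff := by rw [h6]; exact h.mem_iff
      window := by
        intro v
        rw [h6]
        by_cases hv : v = x
        · subst hv
          exact hs.window
        · have hv' : (v : ℕ) ≠ x := fun h' => hv (Fin.ext h')
          rw [hs.arr_of_ne 2 v hv', hs.arr_of_ne 3 v hv', hs.arr_of_ne 4 v hv']
          exact h.window v
      stack := by rw [h8, hreg 2 (by norm_num)]; exact h.stack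
      iff := h.iff
      leaf := by simpa only [hst] using h.leaf
      twins := by simpa only [hst] using h.twins }
  · have := sum_add_eq_sum_add (f := fun v : Fin n => credit a₀ τ v)
      (g := fun v : Fin n => credit a₀ σ v) (x := x) (fun v hv => by
        have hv' : (v : ℕ) ≠ x := fun h' => hv (Fin.ext h')
        simp only [credit, h6, hs.arr_of_ne 4 v hv'])
    have h1 := hs.succ
    have h2 := hs.lt
    simp only [credit, h6, h1] at this
    simp only [base, hreg 2 (by norm_num), credit, h6]
    omega

theorem exists_inv_initCode (hL : Layout G a₀ a₁) {φ : ℕ} (h6 : σ.reg 6 = 0)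
    (h0 : σ.reg 0 = n) (h5 : σ.reg 5 = 0) (h4 : σ.reg 4 = 0)
    (h3 : σ.reg 3 = 0) (h7 : σ.reg 7 ≤ n) (h2 : σ.reg 2 = σ.reg 7) (ha₀ : σ.arr 0 = a₀)
    (ha₁ : σ.arr 1 = a₁) (ha₆ : ∀ v, σ.arr 6 v = 0)
    (hv : ∀ v < σ.reg 7, σ.arr 8 v = v ∧ σ.arr 2 v = a₀ v ∧ σ.arr 3 v = a₀ v + 1 ∧
      σ.arr 4 v = a₀ v + 2)
    (hφ : (n - σ.reg 7) + (∑ v : Fin n, (21 * (a₀ (v + 1) - a₀ v) + 30) + 10 * n) + 2 ≤ φ) :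
    ∃ φ' < φ, Inv G a₀ a₁ φ' (initCode.exec σ) := by
  obtain ⟨i, hi⟩ : ∃ i, σ.reg 7 = i := ⟨_, rfl⟩
  obtain ⟨τ, hτ⟩ : ∃ τ, initCode.exec σ = τ := ⟨_, rfl⟩
  rw [hτ]
  rw [hi] at hv h7 hφ h2
  by_cases hin : i = n
  · simp only [initCode, exec, eval_eq_iff, hi, h0, hin, if_true] at hτ
    subst hτ
    refine ⟨_, Nat.sub_lt (by omega) one_pos,
      .pop Finset.univ ⟨?_, ?_, ?_, ?_, ?_, ?_, ?_, ?_, ?_, ?_, ?_, ?_⟩ ?_ ?_⟩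
    · simpa [Store.setReg_reg] using h0
    · simpa [Store.setReg_reg] using h5
    · simpa [Store.setReg_reg] using h4
    · simp [Store.setReg_reg, h3]
    · exact ha₀
    · exact ha₁
    · intro v
      simp [Store.setReg_arr, ha₆]
    · intro v
      obtain ⟨-, h8, h9, h10⟩ := hv v (by omega)
      have := hL.le v
      simp only [Store.setReg_arr, h8, h9, h10]
      exact ⟨by omega, by omega, by omega, by omega, by omega, by omega, by omega, by omega,
        by omega⟩
    · intro j hj
      simp only [Store.setReg_reg] at hj
      exact ⟨⟨j, by simp at hj; omega⟩, (hv j (by simp at hj; omega)).1⟩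
    · exact Iff.rfl
    · intro x y _
      refine Or.inl ⟨x, ?_, (hv x (by omega)).1⟩
      simp [Store.setReg_reg, h2, hin]
    · intro x y _
      refine Or.inl (Or.inl ⟨x, ?_, (hv x (by omega)).1⟩)
      simp [Store.setReg_reg, h2, hin]
    · simp [Store.setReg_reg]
    · have : ∀ v : Fin n, credit a₀ (σ.setReg 6 1) v = 21 * (a₀ (v + 1) - a₀ v) + 30 := by
        intro v
        simp only [credit, Store.setReg_arr, ha₆, (hv v (by omega)).2.2.2, if_true]
        omega
      simp only [base, this, Store.setReg_reg]
      simp only [Nat.reduceEqDiff, if_false, h2]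
      omega
  · simp only [initCode, exec_block_nil, exec_block_cons, exec, eval_eq_iff, Store.setReg_reg,
      Store.setArr_reg] at hτ
    simp [hi, h0, hin, ha₀, h2] at hτ
    subst hτ
    refine ⟨φ - 1, Nat.sub_lt (by omega) one_pos, .init ?_ ?_ ?_ ?_ ?_ ?_ ?_ ?_ ?_ ?_ ?_ ?_⟩ <;>
      simp [Store.setReg_reg, Store.setReg_arr, Store.setArr_reg, Store.setArr_arr]
    all_goals first | assumption | skip
    · omega
    · intro v hvi
      rcases hvi.lt_or_eq with h | h
      · have := hv v h
        simp [Function.update_of_ne h.ne, this]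
      · simp [h]
    · omega

theorem Main.pop {x : Fin n} (h : Main G a₀ a₁ S (fun _ => False) σ)
    (hreg : ∀ r < 6, r ≠ 2 → τ.reg r = σ.reg r) (h2 : τ.reg 2 + 1 = σ.reg 2) (harr : τ.arr = σ.arr)
    (hx : σ.arr 8 (τ.reg 2) = x) :
    Main G a₀ a₁ S (· = x) τ := by
  have hst : ∀ v, OnStack σ v → OnStack τ v ∨ v = x := by
    rintro v ⟨j, hj, hv⟩
    by_cases hj' : j < τ.reg 2
    · exact Or.inl ⟨j, hj', by rwa [harr]⟩
    · rw [show j = τ.reg 2 by omega, hx] at hv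
      exact Or.inr (Fin.ext hv.symm)
  exact {
    reg₀ := by rw [hreg 0 (by norm_num) (by norm_num), h.reg₀]
    reg₅ := by rw [hreg 5 (by norm_num) (by norm_num), h.reg₅]
    reg₄ := by rw [hreg 4 (by norm_num) (by norm_num), h.reg₄]
    count := by rw [hreg 3 (by norm_num) (by norm_num), h.count]
    arr₀ := by rw [harr, h.arr₀]
    arr₁ := by rw [harr, h.arr₁]
    mem_iff := by rw [harr]; exact h.mem_iff
    window := by rw [harr]; exact h.window
    stack := by rw [harr]; exact fun j hj => h.stack j (by omega)
    iff := h.iff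
    leaf := fun x y hxy => hst x (by simpa using h.leaf x y hxy)
    twins := fun x y hxy => Or.imp (hst x) (hst y) (by simpa using h.twins x y hxy) }

/-- With an empty stack no leaf and no twins remain. By
`UniquelyMatchable.exists_isLeafOn_or_areTwinsOn` the remaining graph is uniquely matchable only if
it is empty, which the counter in register `3` detects. -/
theorem exists_inv_popCode (hG : ClawFree G) {φ : ℕ}
    (h : Main G a₀ a₁ S (fun _ => False) σ) (h6 : σ.reg 6 = 1) (hφ : base n a₀ σ + 1 ≤ φ) :
    ∃ φ' < φ, Inv G a₀ a₁ φ' (popCode.exec σ) := by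
  obtain ⟨τ, hτ⟩ : ∃ τ, popCode.exec σ = τ := ⟨_, rfl⟩
  rw [hτ]
  simp only [popCode, exec_block_nil, exec_block_cons, exec, eval_eq_iff, Store.setReg_reg,
    Store.setReg_arr] at hτ
  by_cases h2 : σ.reg 2 = 0
  · refine ⟨φ - 1, Nat.sub_lt (by omega) one_pos, ?_⟩
    have hnst : ∀ v : Fin n, ¬ OnStack σ v := by
      rintro v ⟨j, hj, -⟩
      omega
    have hS : UniquelyMatchable G Finset.univ ↔ S = ∅ := by
      rw [h.iff]
      constructor
      · intro hu
        by_contra hne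
        obtain ⟨x, y, hxy⟩ :=
          hu.exists_isLeafOn_or_areTwinsOn hG (Finset.nonempty_iff_ne_empty.2 hne)
        rcases hxy with hxy | hxy
        · simpa [hnst] using h.leaf x y hxy
        · simpa [hnst] using h.twins x y hxy
      · rintro rfl
        exact uniquelyMatchable_empty G
    have hc : S = ∅ ↔ σ.reg 3 = n := by
      rw [← Finset.card_eq_zero]
      have := h.count
      omega
    by_cases h3 : σ.reg 3 = n
    · simp [h2, h.reg₅, h.reg₀, h3] at hτ
      subst hτ
      exact .done (by simp [Store.setReg_reg]) (by simp [Store.setReg_reg, h.reg₅])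
        (by simp [Store.setReg_reg]) (by
        rw [hS, hc]
        exact fun h' => (h' h3).elim)
    · simp [h2, h.reg₅, h.reg₀, h3] at hτ
      subst hτ
      exact .done (by simp [Store.setReg_reg]) (by simp [Store.setReg_reg, h.reg₅]) (by
        rw [hS, hc]
        exact fun h' => (h3 h').elim) (by simp [Store.setReg_reg])
  · obtain ⟨x, hx⟩ := h.stack (σ.reg 2 - 1) (by omega)
    simp [h2, h.reg₅, hx] at hτ
    have hbase : ∀ τ : Store, τ.reg 2 + 1 = σ.reg 2 → τ.arr = σ.arr →
        base n a₀ τ + 10 = base n a₀ σ := by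
      intro τ h2 harr
      simp only [base, ← h2, credit, harr]
      omega
    by_cases hd : σ.arr 6 x = 0
    · simp [hd] at hτ
      have h2τ : τ.reg 2 + 1 = σ.reg 2 := by
        rw [← hτ]
        simp [Store.setReg_reg]
        omega
      have harr : τ.arr = σ.arr := by rw [← hτ]; rfl
      refine ⟨base n a₀ τ + 8, by have := hbase τ h2τ harr; omega,
        .examine S x (h.pop ?_ h2τ harr ?_) ?_ ?_ ((h.mem_iff x).2 hd) le_rfl⟩
      · intro r hr hr2
        rw [← hτ]
        simp [Store.setReg_reg, hr2, show r ≠ 6 by omega, show r ≠ 20 by omega,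
          show r ≠ 10 by omega]
      · rw [← hx]
        congr 1
        omega
      · rw [← hτ]; simp [Store.setReg_reg]
      · rw [← hτ]; simp [Store.setReg_reg]
    · simp [hd] at hτ
      have h2τ : τ.reg 2 + 1 = σ.reg 2 := by
        rw [← hτ]
        simp [Store.setReg_reg]
        omega
      have harr : τ.arr = σ.arr := by rw [← hτ]; rfl
      refine ⟨base n a₀ τ + 1, by have := hbase τ h2τ harr; omega,
        .pop S ((h.pop (x := x) ?_ h2τ harr ?_).mono ?_) ?_ le_rfl⟩
      · intro r hr hr2
        rw [← hτ]
        simp [Store.setReg_reg, hr2, show r ≠ 20 by omega, show r ≠ 10 by omega]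
      · rw [← hx]
        congr 1
        omega
      · rintro v rfl
        have hvS : v ∉ S := fun h' => hd ((h.mem_iff v).1 h')
        exact Or.inr ⟨fun y hy => hvS hy.1, fun y hy => hvS hy.1⟩
      · rw [← hτ]; simp [Store.setReg_reg, h6]

theorem not_isLeafOn_of_ne {x y z : Fin n} (hy : y ∈ S) (hz : z ∈ S) (hxy : G.Adj x y)
    (hxz : G.Adj x z) (hyz : y ≠ z) (w : Fin n) : ¬ IsLeafOn G S x w := fun h =>
  hyz ((h.2.2.2 y hy hxy).trans (h.2.2.2 z hz hxz).symm)

theorem not_areTwinsOn_of_ne {x y z w : Fin n} (hy : y ∈ S) (hz : z ∈ S) (hw : w ∈ S)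
    (hxy : G.Adj x y) (hxz : G.Adj x z) (hxw : G.Adj x w) (hyz : y ≠ z) (hyw : y ≠ w) (hzw : z ≠ w)
    (u : Fin n) : ¬ AreTwinsOn G S x u := by
  rintro ⟨-, -, -, v, -, -, -, h, -⟩
  rcases h y hy hxy with rfl | rfl <;> rcases h z hz hxz with rfl | rfl <;>
    rcases h w hw hxw with rfl | rfl <;> simp_all

theorem exists_inv_examineCode (hL : Layout G a₀ a₁) {φ : ℕ} {x : Fin n}
    (h : Main G a₀ a₁ S (· = x) σ) (h6 : σ.reg 6 = 2)
    (hx : σ.reg 10 = x) (hxS : x ∈ S) (hφ : base n a₀ σ + 8 ≤ φ) :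
    ∃ φ' < φ, Inv G a₀ a₁ φ' (examineCode.exec σ) := by
  obtain ⟨τ, hreg, h'⟩ := exec_probe hL (r := 10) (by norm_num) h.arr₀ h.arr₁ h.reg₅ hx (h.window x)
    (.const 6 1) (block [.copy 11 24, .const 6 4])
    (block [.copy 11 24, .copy 12 25, .const 13 0, .const 6 3]) (.const 6 1)
  rw [← examineCode] at h'
  -- a vertex without a partner is dropped
  have hdrop : (∀ y, ¬ IsLeafOn G S x y) → (∀ y, ¬ AreTwinsOn G S x y) → τ.arr = σ.arr →
      ∃ φ' < φ, Inv G a₀ a₁ φ' ((Cmd.const 6 1).exec τ) := by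
    intro hl ht harr
    refine ⟨base n a₀ σ + 1, by omega, .pop S ?_ ?_ (le_of_eq ?_)⟩
    · refine (h.congr (τ := (Cmd.const 6 1).exec τ) ?_ ?_).mono ?_
      · intro r hr
        rw [← hreg r (by omega)]
        simp [exec, Store.setReg_reg, show r ≠ 6 by omega]
      · simpa [exec, Store.setReg_arr] using harr
      · rintro v rfl
        exact Or.inr ⟨hl, ht⟩
    · simp [exec, Store.setReg_reg]
    · rw [base_congr] <;> simp [exec, Store.setReg_reg, Store.setReg_arr, harr, hreg 2]
  rcases h' with ⟨hex, hs⟩ | ⟨harr, ⟨hex, h0⟩ | ⟨hex, y, h24, hxy, hy, hu⟩ |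
    ⟨hex, y, z, hyz, h24, h25, hxy, hxz, hy, hz, hu⟩ |
    ⟨hex, y, z, w, hyz, hyw, hzw, hxy, hxz, hxw, hy, hz, hw⟩⟩
  · rw [hex]
    obtain ⟨hm, hb⟩ := h.shift hreg hs
    exact ⟨base n a₀ τ + 8, by omega, .examine S x hm (by rw [hreg 6 (by norm_num), h6])
      (by rw [hreg 10 (by norm_num), hx]) hxS le_rfl⟩
  · rw [hex]
    exact hdrop (fun y hy => h0 y hy.2.2.1 ((h.mem_iff y).1 hy.2.1))
      (fun y hy => h0 y hy.2.2.1 ((h.mem_iff y).1 hy.2.1)) harr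
  · rw [hex]
    have hyS := (h.mem_iff y).2 hy
    refine ⟨base n a₀ σ + 3, by omega, .remove S x y (h.congr ?_ ?_) ?_ ?_ ?_ hxS hyS hxy
      (IsLeafOn.uniquelyMatchable_iff ⟨hxS, hyS, hxy, fun z hz hxz =>
        hu z hxz ((h.mem_iff z).1 hz)⟩) (le_of_eq ?_)⟩
    · intro r hr
      rw [← hreg r (by omega)]
      simp [exec_block_cons, exec_block_nil, exec, Store.setReg_reg, show r ≠ 6 by omega,
        show r ≠ 11 by omega]
    · rw [← harr]; rfl
    · simp [exec_block_cons, exec_block_nil, exec, Store.setReg_reg]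
    · simp [exec_block_cons, exec_block_nil, exec, Store.setReg_reg, hreg 10, hx]
    · simp [exec_block_cons, exec_block_nil, exec, Store.setReg_reg, h24]
    · rw [base_congr] <;>
        simp [exec_block_cons, exec_block_nil, exec, Store.setReg_reg, Store.setReg_arr, harr,
          hreg 2]
  · rw [hex]
    refine ⟨base n a₀ σ + 6, by omega, .compare S x y z (h.congr ?_ ?_) ?_ ?_ ?_ ?_ hxS
      ((h.mem_iff y).2 hy) ((h.mem_iff z).2 hz) hyz hxy hxz
      (fun w hw hxw => hu w hxw ((h.mem_iff w).1 hw)) (Or.inl ⟨?_, le_of_eq ?_⟩)⟩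
    · intro r hr
      rw [← hreg r (by omega)]
      simp [exec_block_cons, exec_block_nil, exec, Store.setReg_reg, show r ≠ 6 by omega,
        show r ≠ 11 by omega, show r ≠ 12 by omega, show r ≠ 13 by omega]
    · rw [← harr]; rfl
    · simp [exec_block_cons, exec_block_nil, exec, Store.setReg_reg]
    · simp [exec_block_cons, exec_block_nil, exec, Store.setReg_reg, hreg 10, hx]
    · simp [exec_block_cons, exec_block_nil, exec, Store.setReg_reg, h24]
    · simp [exec_block_cons, exec_block_nil, exec, Store.setReg_reg, h25]
    · simp [exec_block_cons, exec_block_nil, exec, Store.setReg_reg]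
    · rw [base_congr] <;>
        simp [exec_block_cons, exec_block_nil, exec, Store.setReg_reg, Store.setReg_arr, harr,
          hreg 2]
  · rw [hex]
    rw [← h.mem_iff] at hy hz hw
    exact hdrop (not_isLeafOn_of_ne hy hz hxy hxz hyz)
      (not_areTwinsOn_of_ne hy hz hw hxy hxz hxw hyz hyw hzw) harr

/-- As `x` has exactly the alive neighbors `y` and `z`, the vertices `x` and `y` are twins exactly
if `y` has two alive neighbors and `z` is one of them; `x` is then the other. On the first failure
the roles of `y` and `z` are exchanged, on the second one `x` is dropped. -/
theorem exists_inv_compareCode (hL : Layout G a₀ a₁) {φ : ℕ} {x y z : Fin n}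
    (h : Main G a₀ a₁ S (· = x) σ)
    (h6 : σ.reg 6 = 3) (hx : σ.reg 10 = x) (hy : σ.reg 11 = y) (hz : σ.reg 12 = z)
    (hxS : x ∈ S) (hyS : y ∈ S) (hzS : z ∈ S) (hyz : y ≠ z) (hxy : G.Adj x y) (hxz : G.Adj x z)
    (hadj : ∀ w ∈ S, G.Adj x w → w = y ∨ w = z)
    (hφ : (σ.reg 13 = 0 ∧ base n a₀ σ + 6 ≤ φ) ∨
      (σ.reg 13 ≠ 0 ∧ ¬ AreTwinsOn G S x z ∧ base n a₀ σ + 4 ≤ φ)) :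
    ∃ φ' < φ, Inv G a₀ a₁ φ' (compareCode.exec σ) := by
  obtain ⟨τ, hreg, h'⟩ := exec_probe hL (r := 11) (by norm_num) h.arr₀ h.arr₁ h.reg₅ hy (h.window y)
    failCode failCode
    (.cond (.eq 24 12) (.const 6 4) (.cond (.eq 25 12) (.const 6 4) failCode)) failCode
  rw [← compareCode] at h'
  have hfail : ¬ AreTwinsOn G S x y → τ.arr = σ.arr →
      ∃ φ' < φ, Inv G a₀ a₁ φ' (failCode.exec τ) := by
    intro ht harr
    obtain ⟨υ, hυ⟩ : ∃ υ, failCode.exec τ = υ := ⟨_, rfl⟩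
    rw [hυ]
    simp only [failCode, exec_block_nil, exec_block_cons, exec, eval_eq_iff,
      Store.setReg_reg, hreg 13 (by norm_num), hreg 12 (by norm_num), hreg 11 (by norm_num),
      hreg 5 (by norm_num), hy, hz, h.reg₅] at hυ
    rcases hφ with ⟨h13, hφ⟩ | ⟨h13, htz, hφ⟩
    · simp [h13] at hυ
      subst hυ
      refine ⟨base n a₀ σ + 4, by omega, .compare S x z y (h.congr ?_ ?_) ?_ ?_ ?_ ?_ hxS hzS hyS
        hyz.symm hxz hxy (fun w hw hxw => (hadj w hw hxw).symm)
        (Or.inr ⟨?_, ht, le_of_eq ?_⟩)⟩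
      · intro r hr
        rw [← hreg r (by omega)]
        simp [Store.setReg_reg, show r ≠ 20 by omega, show r ≠ 11 by omega, show r ≠ 12 by omega,
          show r ≠ 13 by omega]
      · rw [← harr]; rfl
      · simp [Store.setReg_reg, hreg 6, h6]
      · simp [Store.setReg_reg, hreg 10, hx]
      · simp [Store.setReg_reg]
      · simp [Store.setReg_reg]
      · simp [Store.setReg_reg]
      · rw [base_congr] <;> simp [Store.setReg_reg, Store.setReg_arr, harr, hreg 2]
    · simp [h13] at hυ
      subst hυ
      refine ⟨base n a₀ σ + 1, by omega,
        .pop S ((h.congr (τ := τ.setReg 6 1) ?_ ?_).mono ?_) ?_ (le_of_eq ?_)⟩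
      · intro r hr
        rw [← hreg r (by omega)]
        simp [Store.setReg_reg, show r ≠ 6 by omega]
      · rw [← harr]; rfl
      · rintro v rfl
        -- Both candidates are refuted, and two alive neighbors exclude a leaf.
        refine Or.inr ⟨not_isLeafOn_of_ne hyS hzS hxy hxz hyz, fun u hu => ?_⟩
        rcases hadj u hu.2.1 hu.2.2.1 with rfl | rfl
        exacts [ht hu, htz hu]
      · simp [Store.setReg_reg]
      · rw [base_congr] <;> simp [Store.setReg_reg, Store.setReg_arr, harr, hreg 2]
  have hxa := (h.mem_iff x).1 hxS
  have htwin : AreTwinsOn G S x y → ∀ u, G.Adj y u → σ.arr 6 u = 0 → u = x ∨ u = z := by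
    rintro ⟨-, -, -, v, hv, hxv, hyv, -, hw⟩ u hyu hu
    rcases hadj v hv hxv with rfl | rfl
    · exact (hyv.ne rfl).elim
    · exact hw u ((h.mem_iff u).2 hu) hyu
  have htwin' : AreTwinsOn G S x y → G.Adj y z := by
    rintro ⟨-, -, -, v, hv, hxv, hyv, -, hw⟩
    rcases hadj v hv hxv with rfl | rfl
    · exact (hyv.ne rfl).elim
    · exact hyv
  rcases h' with ⟨hex, hs⟩ | ⟨harr, ⟨hex, h0⟩ | ⟨hex, u, h24, hyu, hu, hall⟩ |
    ⟨hex, u, v, huv, h24, h25, hyu, hyv, hu, hv, hall⟩ |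
    ⟨hex, u, v, w, huv, huw, hvw, hyu, hyv, hyw, hu, hv, hw⟩⟩
  · rw [hex]
    obtain ⟨hm, hb⟩ := h.shift hreg hs
    refine ⟨φ - 1, by omega, .compare S x y z hm (by rw [hreg 6 (by norm_num), h6])
      (by rw [hreg 10 (by norm_num), hx]) (by rw [hreg 11 (by norm_num), hy])
      (by rw [hreg 12 (by norm_num), hz]) hxS hyS hzS hyz hxy hxz hadj ?_⟩
    rw [hreg 13 (by norm_num)]
    rcases hφ with ⟨h13, hφ⟩ | ⟨h13, htz, hφ⟩
    · exact Or.inl ⟨h13, by omega⟩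
    · exact Or.inr ⟨h13, htz, by omega⟩
  · exact (h0 x hxy.symm hxa).elim
  · rw [hex]
    refine hfail (fun ht => ?_) harr
    have h1 := hall x hxy.symm hxa
    have h2 := hall z (htwin' ht) ((h.mem_iff z).1 hzS)
    exact hxz.ne (h1.trans h2.symm)
  · rw [hex]
    have key : (u = z ∨ v = z) → ∃ φ' < φ, Inv G a₀ a₁ φ' ((Cmd.const 6 4).exec τ) := by
      intro huvz
      have hx' := hall x hxy.symm hxa
      have hyz' : G.Adj y z ∧ ∀ w ∈ S, G.Adj y w → w = x ∨ w = z := by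
        constructor
        · rcases huvz with rfl | rfl <;> assumption
        · intro w hw hyw
          have := hall w hyw ((h.mem_iff w).1 hw)
          have hne := hxz.ne
          rcases huvz with rfl | rfl
          · rcases hx' with rfl | rfl <;> tauto
          · rcases hx' with rfl | rfl <;> tauto
      have ht : AreTwinsOn G S x y := ⟨hxS, hyS, hxy, z, hzS, hxz, hyz'.1, hadj, hyz'.2⟩
      refine ⟨base n a₀ σ + 3, by omega, .remove S x y (h.congr ?_ ?_) ?_ ?_ ?_ hxS hyS hxy
        ht.uniquelyMatchable_iff (le_of_eq ?_)⟩
      · intro r hr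
        rw [← hreg r (by omega)]
        simp [exec, Store.setReg_reg, show r ≠ 6 by omega]
      · rw [← harr]; rfl
      · simp [exec, Store.setReg_reg]
      · simp [exec, Store.setReg_reg, hreg 10, hx]
      · simp [exec, Store.setReg_reg, hreg 11, hy]
      · rw [base_congr] <;> simp [exec, Store.setReg_reg, Store.setReg_arr, harr, hreg 2]
    simp only [exec, eval_eq_iff, h24, h25, hreg 12 (by norm_num), hz, Fin.val_inj]
    split_ifs with h1 h2
    · exact key (Or.inl h1)
    · exact key (Or.inr h2)
    · refine hfail (fun ht => ?_) harr
      rcases hall z (htwin' ht) ((h.mem_iff z).1 hzS) with h3 | h3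
      exacts [h1 h3.symm, h2 h3.symm]
  · rw [hex]
    rw [← h.mem_iff] at hu hv hw
    exact hfail (fun ht => not_areTwinsOn_of_ne hu hv hw hyu hyv hyw huv huw hvw x ht.symm) harr

theorem base_setArr_six {x : Fin n} (h : σ.arr 6 x = 0) :
    base n a₀ (σ.setArr 6 x 1) + (20 * (a₀ (x + 1) - a₀ x) + 30) = base n a₀ σ := by
  have := sum_add_eq_sum_add (f := fun v : Fin n => credit a₀ (σ.setArr 6 x 1) v)
    (g := fun v : Fin n => credit a₀ σ v) (x := x) (fun v hv => by
      have hv' : (v : ℕ) ≠ x := fun h' => hv (Fin.ext h')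
      simp [credit, Store.setArr_arr, hv'])
  have h1 : credit a₀ (σ.setArr 6 x 1) x = a₀ (x + 1) + 2 - σ.arr 4 x := by
    simp [credit, Store.setArr_arr]
  have h2 : credit a₀ σ x =
      (a₀ (x + 1) + 2 - σ.arr 4 x) + (20 * (a₀ (x + 1) - a₀ x) + 30) := by
    simp [credit, h]
  simp only [h1, h2] at this
  simp only [base, Store.setArr_reg]
  omega

/-- A deletion can make a new leaf or new twins only by lowering a degree, so only neighbors of `x`
or `y` have to be tested again. Windows stay valid since vertices are never revived. -/
theorem Main.remove {x y : Fin n} (h : Main G a₀ a₁ S (· = x) σ) (hxS : x ∈ S) (hyS : y ∈ S)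
    (hxy : x ≠ y) (hiff : UniquelyMatchable G S ↔ UniquelyMatchable G (S \ {x, y}))
    (hreg : ∀ r < 6, r ≠ 3 → τ.reg r = σ.reg r) (h3 : τ.reg 3 = σ.reg 3 + 2)
    (harr : τ.arr = ((σ.setArr 6 x 1).setArr 6 y 1).arr) :
    Main G a₀ a₁ (S \ {x, y}) (fun v => G.Adj x v ∨ G.Adj y v) τ := by
  have harr' : ∀ k, k ≠ 6 → τ.arr k = σ.arr k := by
    intro k hk
    rw [harr]
    simp [Store.setArr_arr, hk]
  have h6 : τ.arr 6 = Function.update (Function.update (σ.arr 6) x 1) y 1 := by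
    rw [harr]
    simp [Store.setArr_arr]
  have h8 := harr' 8 (by norm_num)
  have hst : ∀ v : Fin n, OnStack τ v ↔ OnStack σ v := by
    simp [OnStack, h8, hreg 2]
  have hmem : ∀ v, v ∈ S \ {x, y} ↔ v ∈ S ∧ v ≠ x ∧ v ≠ y := by simp
  -- A vertex adjacent to neither `x` nor `y` keeps its neighborhood, so a leaf or twin at this
  -- vertex was already recorded.
  have hup : ∀ v, v ∈ S \ {x, y} → ¬ (G.Adj x v ∨ G.Adj y v) → ∀ w ∈ S, G.Adj v w →
      w ∈ S \ {x, y} := by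
    intro v _ hn w hw hvw
    refine (hmem w).2 ⟨hw, ?_, ?_⟩ <;> rintro rfl
    exacts [hn (Or.inl hvw.symm), hn (Or.inr hvw.symm)]
  exact {
    reg₀ := by rw [hreg 0 (by norm_num) (by norm_num), h.reg₀]
    reg₅ := by rw [hreg 5 (by norm_num) (by norm_num), h.reg₅]
    reg₄ := by rw [hreg 4 (by norm_num) (by norm_num), h.reg₄]
    count := by
      have h1 := Finset.card_sdiff_add_card_eq_card (s := {x, y}) (t := S)
        (by simp [Finset.insert_subset_iff, hxS, hyS])
      rw [Finset.card_pair hxy] at h1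
      have := h.count
      omega
    arr₀ := by rw [harr' 0 (by norm_num), h.arr₀]
    arr₁ := by rw [harr' 1 (by norm_num), h.arr₁]
    mem_iff := by
      intro v
      rw [hmem, h6, h.mem_iff]
      simp only [Function.update_apply, Fin.val_inj]
      split_ifs <;> simp_all
    window := by
      intro v
      rw [harr' 2 (by norm_num), harr' 3 (by norm_num), harr' 4 (by norm_num)]
      have hw := h.window v
      exact { hw with
        dead_of_lt := by
          intro j h1 h2 h3 h4 h5
          have := hw.dead_of_lt j h1 h2 h3 h4 h5
          rw [h6]
          simp only [Function.update_apply]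
          split_ifs <;> simp_all }
    stack := by rw [h8, hreg 2 (by norm_num) (by norm_num)]; exact h.stack
    iff := h.iff.trans hiff
    leaf := by
      rintro u w ⟨hu, hw, huw, hall⟩
      by_cases hn : G.Adj x u ∨ G.Adj y u
      · exact Or.inr hn
      · have := h.leaf u w ⟨((hmem u).1 hu).1, ((hmem w).1 hw).1, huw,
          fun z hz huz => hall z (hup u hu hn z hz huz) huz⟩
        rw [hst]
        exact Or.inl (this.resolve_right ((hmem u).1 hu).2.1)
    twins := by
      rintro u w ⟨hu, hw, huw, z, hz, huz, hwz, hallu, hallw⟩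
      by_cases hnu : G.Adj x u ∨ G.Adj y u
      · exact Or.inl (Or.inr hnu)
      by_cases hnw : G.Adj x w ∨ G.Adj y w
      · exact Or.inr (Or.inr hnw)
      rw [hst, hst]
      have := h.twins u w ⟨((hmem u).1 hu).1, ((hmem w).1 hw).1, huw, z, ((hmem z).1 hz).1, huz,
        hwz, fun v hv huv => hallu v (hup u hu hnu v hv huv) huv,
        fun v hv hwv => hallw v (hup w hw hnw v hv hwv) hwv⟩
      have h1 := ((hmem u).1 hu).2.1
      have h2 := ((hmem w).1 hw).2.1
      tauto }

theorem exists_inv_removeCode (hL : Layout G a₀ a₁) {φ : ℕ} {x y : Fin n}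
    (h : Main G a₀ a₁ S (· = x) σ) (hx : σ.reg 10 = x) (hy : σ.reg 11 = y) (hxS : x ∈ S)
    (hyS : y ∈ S) (hxy : G.Adj x y)
    (hiff : UniquelyMatchable G S ↔ UniquelyMatchable G (S \ {x, y}))
    (hφ : base n a₀ σ + 3 ≤ φ) : ∃ φ' < φ, Inv G a₀ a₁ φ' (removeCode.exec σ) := by
  obtain ⟨τ, hτ⟩ : ∃ τ, removeCode.exec σ = τ := ⟨_, rfl⟩
  rw [hτ]
  simp only [removeCode, exec_block_nil, exec_block_cons, exec, Store.setReg_reg,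
    Store.setReg_arr, Store.setArr_reg, Store.setArr_arr] at hτ
  simp [hx, hy, h.arr₀] at hτ
  have harr : τ.arr = ((σ.setArr 6 x 1).setArr 6 y 1).arr := by rw [← hτ]; rfl
  have h14 : τ.reg 14 = a₀ x := by rw [← hτ]; simp [Store.setReg_reg]
  have h15 : τ.reg 15 = a₀ (x + 1) := by rw [← hτ]; simp [Store.setReg_reg]
  have h2 : τ.reg 2 = σ.reg 2 := by rw [← hτ]; simp [Store.setReg_reg, Store.setArr_reg]
  have hb : base n a₀ τ + (20 * (a₀ (x + 1) - a₀ x) + 30) + (20 * (a₀ (y + 1) - a₀ y) + 30) =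
      base n a₀ σ := by
    have h1 := base_setArr_six (n := n) (a₀ := a₀) ((h.mem_iff x).1 hxS)
    have hy0 : (σ.setArr 6 x 1).arr 6 y = 0 := by
      have : (y : ℕ) ≠ x := fun h' => hxy.ne (Fin.ext h'.symm)
      simpa [Store.setArr_arr, this] using (h.mem_iff y).1 hyS
    have h2' := base_setArr_six (n := n) (a₀ := a₀) hy0
    have h3 : base n a₀ τ = base n a₀ ((σ.setArr 6 x 1).setArr 6 y 1) :=
      base_congr (by rw [h2]; rfl) (by rw [harr]) (by rw [harr])
    omega
  refine ⟨φ - 1, by omega, .push₁ (S \ {x, y}) x y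
    ((h.remove (τ := τ) hxS hyS hxy.ne hiff ?_ ?_ harr).mono ?_) ?_ ?_ ?_ h14.ge h15 ?_⟩
  · intro r hr hr3
    rw [← hτ]
    simp [Store.setReg_reg, Store.setArr_reg, hr3, show r ≠ 6 by omega, show r ≠ 13 by omega,
      show r ≠ 14 by omega, show r ≠ 15 by omega, show r ≠ 20 by omega]
  · rw [← hτ]; simp [Store.setReg_reg]
  · rintro v (hv | hv)
    · rw [h14, h15]
      exact Or.inl (Or.inr (Or.inl ((hL.adj_iff x v).1 hv)))
    · exact Or.inl (Or.inr (Or.inr hv))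
  · rw [← hτ]; simp [Store.setReg_reg]
  · rw [← hτ]; simp [Store.setReg_reg, Store.setArr_reg, hy]
  · rw [← hτ]; simp [Store.setReg_reg]
  · rw [h14, h15]
    omega

theorem Main.push {v : Fin n} (h : Main G a₀ a₁ S E σ)
    (hreg : ∀ r < 6, r ≠ 2 → τ.reg r = σ.reg r) (h2 : τ.reg 2 = σ.reg 2 + 1)
    (harr : τ.arr = (σ.setArr 8 (σ.reg 2) v).arr) (hE : ∀ u, E u → u = v ∨ E' u) :
    Main G a₀ a₁ S E' τ := by
  have harr' : ∀ k, k ≠ 8 → τ.arr k = σ.arr k := by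
    intro k hk
    rw [harr]
    simp [Store.setArr_arr, hk]
  have h8 : τ.arr 8 = Function.update (σ.arr 8) (σ.reg 2) v := by
    rw [harr]
    simp [Store.setArr_arr]
  have hst : ∀ u, OnStack σ u ∨ E u → OnStack τ u ∨ E' u := by
    rintro u (⟨j, hj, hju⟩ | hu)
    · exact Or.inl ⟨j, by omega, by rw [h8, Function.update_of_ne hj.ne, hju]⟩
    · rcases hE u hu with rfl | hu
      · exact Or.inl ⟨σ.reg 2, by omega, by rw [h8, Function.update_self]⟩
      · exact Or.inr hu
  exact {
    reg₀ := by rw [hreg 0 (by norm_num) (by norm_num), h.reg₀]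
    reg₅ := by rw [hreg 5 (by norm_num) (by norm_num), h.reg₅]
    reg₄ := by rw [hreg 4 (by norm_num) (by norm_num), h.reg₄]
    count := by rw [hreg 3 (by norm_num) (by norm_num), h.count]
    arr₀ := by rw [harr' 0 (by norm_num), h.arr₀]
    arr₁ := by rw [harr' 1 (by norm_num), h.arr₁]
    mem_iff := by rw [harr' 6 (by norm_num)]; exact h.mem_iff
    window := by
      rw [harr' 2 (by norm_num), harr' 3 (by norm_num), harr' 4 (by norm_num),
        harr' 6 (by norm_num)]
      exact h.window
    stack := by
      intro j hj
      rw [h8]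
      by_cases hj' : j = σ.reg 2
      · exact ⟨v, by rw [hj', Function.update_self]⟩
      · rw [Function.update_of_ne hj']
        exact h.stack j (by omega)
    iff := h.iff
    leaf := fun x y hxy => hst x (h.leaf x y hxy)
    twins := fun x y hxy => Or.imp (hst x) (hst y) (h.twins x y hxy) }

/-- Put the next neighbor on the stack. -/
theorem exec_pushCode_of_lt (hL : Layout G a₀ a₁) {x : Fin n} (h : Main G a₀ a₁ S E σ)
    (h14 : a₀ x ≤ σ.reg 14) (h15 : σ.reg 15 = a₀ (x + 1)) (hlt : σ.reg 14 < σ.reg 15)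
    (hE : ∀ u, E u → a₁ (σ.reg 14) = u ∨ E' u) :
    Main G a₀ a₁ S E' (pushCode.exec σ) ∧
      base n a₀ (pushCode.exec σ) = base n a₀ σ + 10 ∧
      (pushCode.exec σ).reg 14 = σ.reg 14 + 1 ∧
      ∀ r, r ≠ 2 → r ≠ 14 → r < 20 → (pushCode.exec σ).reg r = σ.reg r := by
  obtain ⟨τ, hτ⟩ : ∃ τ, pushCode.exec σ = τ := ⟨_, rfl⟩
  rw [hτ]
  obtain ⟨v, -, hv⟩ := hL.exists_adj x _ h14 (h15 ▸ hlt)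
  simp only [pushCode, exec_block_nil, exec_block_cons, exec, eval_lt_iff, Store.setReg_reg,
    Store.setArr_reg] at hτ
  simp [hlt, h.arr₁, hv] at hτ
  have h2 : τ.reg 2 = σ.reg 2 + 1 := by rw [← hτ]; simp [Store.setReg_reg]
  have harr : τ.arr = (σ.setArr 8 (σ.reg 2) v).arr := by rw [← hτ]; rfl
  have hr : ∀ r, r ≠ 2 → r ≠ 14 → r < 20 → τ.reg r = σ.reg r := by
    intro r h2 h14 hr
    rw [← hτ]
    simp [Store.setReg_reg, Store.setArr_reg, h2, h14, show r ≠ 20 by omega]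
  refine ⟨h.push (fun r h6 h2 => hr r h2 (by omega) (by omega)) h2 harr fun u hu => ?_, ?_, ?_, hr⟩
  · rcases hE u hu with h' | h'
    · exact Or.inl (Fin.ext (h'.symm.trans hv))
    · exact Or.inr h'
  · simp only [base, credit, h2, harr, Store.setArr_arr]
    simp
    omega
  · rw [← hτ]; simp [Store.setReg_reg]

theorem exists_inv_pushCode₁ (hL : Layout G a₀ a₁) {φ : ℕ} {x y : Fin n}
    (h : Main G a₀ a₁ S (fun v => (∃ j, σ.reg 14 ≤ j ∧ j < σ.reg 15 ∧ a₁ j = v) ∨ G.Adj y v) σ)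
    (h6 : σ.reg 6 = 5) (hy : σ.reg 11 = y) (h13 : σ.reg 13 = 0) (h14 : a₀ x ≤ σ.reg 14)
    (h15 : σ.reg 15 = a₀ (x + 1))
    (hφ : base n a₀ σ + 20 * (σ.reg 15 - σ.reg 14) + 20 * (a₀ (y + 1) - a₀ y) + 5 ≤ φ) :
    ∃ φ' < φ, Inv G a₀ a₁ φ' (pushCode.exec σ) := by
  by_cases hlt : σ.reg 14 < σ.reg 15
  · obtain ⟨hm, hb, h14', hr⟩ := exec_pushCode_of_lt hL h h14 h15 hlt
      (E' := fun v => (∃ j, σ.reg 14 + 1 ≤ j ∧ j < σ.reg 15 ∧ a₁ j = v) ∨ G.Adj y v) (by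
        rintro u (⟨j, hj, hj', hju⟩ | hu)
        · by_cases hj'' : j = σ.reg 14
          · exact Or.inl (hj'' ▸ hju)
          · exact Or.inr (Or.inl ⟨j, by omega, hj', hju⟩)
        · exact Or.inr (Or.inr hu))
    have h15' := hr 15 (by norm_num) (by norm_num) (by norm_num)
    refine ⟨φ - 1, by omega, .push₁ S x y (by rwa [h14', h15'])
      (by rw [hr 6 (by norm_num) (by norm_num) (by norm_num), h6])
      (by rw [hr 11 (by norm_num) (by norm_num) (by norm_num), hy])
      (by rw [hr 13 (by norm_num) (by norm_num) (by norm_num), h13])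
      (by omega) (by omega) (by rw [hb, h14', h15']; omega)⟩
  · obtain ⟨τ, hτ⟩ : ∃ τ, pushCode.exec σ = τ := ⟨_, rfl⟩
    rw [hτ]
    simp only [pushCode, exec_block_nil, exec_block_cons, exec, eval_lt_iff, eval_eq_iff,
      Store.setReg_reg, Store.setReg_arr] at hτ
    simp [hlt, h.arr₀, h13, h.reg₅, hy] at hτ
    have harr : τ.arr = σ.arr := by rw [← hτ]; rfl
    have h14' : τ.reg 14 = a₀ y := by rw [← hτ]; simp [Store.setReg_reg]
    have h15' : τ.reg 15 = a₀ (y + 1) := by rw [← hτ]; simp [Store.setReg_reg]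
    have hr : ∀ r < 10, τ.reg r = σ.reg r := by
      intro r hr
      rw [← hτ]
      simp [Store.setReg_reg, show r ≠ 13 by omega, show r ≠ 14 by omega, show r ≠ 15 by omega]
    refine ⟨φ - 1, by omega, .push₂ S y
      ((h.congr (τ := τ) (fun r h' => hr r (by omega)) harr).mono ?_) ?_ ?_ h14'.ge h15' ?_⟩
    · rintro v (⟨j, hj, hj', -⟩ | hv)
      · omega
      · rw [h14', h15']
        exact Or.inl (Or.inr ((hL.adj_iff y v).1 hv))
    · rw [hr 6 (by norm_num), h6]
    · rw [← hτ]; simp [Store.setReg_reg]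
    · rw [h14', h15', base_congr (σ := σ) (hr 2 (by norm_num)) (by rw [harr]) (by rw [harr])]
      omega

theorem exists_inv_pushCode₂ (hL : Layout G a₀ a₁) {φ : ℕ} {y : Fin n}
    (h : Main G a₀ a₁ S (fun v => ∃ j, σ.reg 14 ≤ j ∧ j < σ.reg 15 ∧ a₁ j = v) σ)
    (h6 : σ.reg 6 = 5) (h13 : σ.reg 13 ≠ 0) (h14 : a₀ y ≤ σ.reg 14)
    (h15 : σ.reg 15 = a₀ (y + 1))
    (hφ : base n a₀ σ + 20 * (σ.reg 15 - σ.reg 14) + 3 ≤ φ) :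
    ∃ φ' < φ, Inv G a₀ a₁ φ' (pushCode.exec σ) := by
  by_cases hlt : σ.reg 14 < σ.reg 15
  · obtain ⟨hm, hb, h14', hr⟩ := exec_pushCode_of_lt hL h h14 h15 hlt
      (E' := fun v => ∃ j, σ.reg 14 + 1 ≤ j ∧ j < σ.reg 15 ∧ a₁ j = v) (by
        rintro u ⟨j, hj, hj', hju⟩
        by_cases hj'' : j = σ.reg 14
        · exact Or.inl (hj'' ▸ hju)
        · exact Or.inr ⟨j, by omega, hj', hju⟩)
    have h15' := hr 15 (by norm_num) (by norm_num) (by norm_num)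
    refine ⟨φ - 1, by omega, .push₂ S y (by rwa [h14', h15'])
      (by rw [hr 6 (by norm_num) (by norm_num) (by norm_num), h6])
      (by rwa [hr 13 (by norm_num) (by norm_num) (by norm_num)])
      (by omega) (by omega) (by rw [hb, h14', h15']; omega)⟩
  · have hex : pushCode.exec σ = σ.setReg 6 1 := by
      simp [pushCode, exec, eval_lt_iff, eval_eq_iff, hlt, h13, h.reg₅]
    rw [hex]
    refine ⟨φ - 1, by omega, .pop S ((h.congr (τ := σ.setReg 6 1) ?_ rfl).mono ?_) ?_ ?_⟩
    · intro r hr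
      simp [Store.setReg_reg, show r ≠ 6 by omega]
    · rintro v ⟨j, hj, hj', -⟩
      omega
    · simp [Store.setReg_reg]
    · rw [base_congr (σ := σ)] <;> simp [Store.setReg_reg, Store.setReg_arr]
      omega

theorem exists_inv_body (hG : ClawFree G) (hL : Layout G a₀ a₁) {φ : ℕ} (h : Inv G a₀ a₁ φ σ)
    (h4 : σ.reg 4 = 0) : ∃ φ' < φ, Inv G a₀ a₁ φ' (body.exec σ) := by
  have hreg : ∀ k, ∀ r < 20, (σ.setReg 30 k).reg r = σ.reg r := by
    intro k r hr
    simp [Store.setReg_reg, show r ≠ 30 by omega]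
  have hb : ∀ k, base n a₀ (σ.setReg 30 k) = base n a₀ σ := fun k =>
    base_congr (hreg k 2 (by norm_num)) rfl rfl
  have hm : ∀ {S E} k, Main G a₀ a₁ S E σ → Main G a₀ a₁ S E (σ.setReg 30 k) := fun k h =>
    h.congr (fun r hr => hreg k r (by omega)) rfl
  cases h with
  | init h6 h0 h5 h4 h3 h7 h2 ha₀ ha₁ ha₆ hv hφ =>
    rw [body, exec_dispatcher (k := 0) rfl h6]
    apply exists_inv_initCode hL <;> simpa only [hreg, Nat.reduceLT, Store.setReg_arr]
  | pop S h h6 hφ =>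
    rw [body, exec_dispatcher (k := 1) rfl h6]
    exact exists_inv_popCode hG (hm 1 h) (by simpa only [hreg, Nat.reduceLT]) (by rwa [hb])
  | examine S x h h6 hx hxS hφ =>
    rw [body, exec_dispatcher (k := 2) rfl h6]
    exact exists_inv_examineCode hL (hm 2 h) (by simpa only [hreg, Nat.reduceLT])
      (by simpa only [hreg, Nat.reduceLT]) hxS (by rwa [hb])
  | compare S x y z h h6 hx hy hz hxS hyS hzS hyz hxy hxz hadj hφ =>
    rw [body, exec_dispatcher (k := 3) rfl h6]
    exact exists_inv_compareCode hL (hm 3 h) (by simpa only [hreg, Nat.reduceLT])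
      (by simpa only [hreg, Nat.reduceLT]) (by simpa only [hreg, Nat.reduceLT])
      (by simpa only [hreg, Nat.reduceLT]) hxS hyS hzS hyz hxy hxz hadj
      (by simpa only [hreg, Nat.reduceLT, hb])
  | remove S x y h h6 hx hy hxS hyS hxy hiff hφ =>
    rw [body, exec_dispatcher (k := 4) rfl h6]
    exact exists_inv_removeCode hL (hm 4 h) (by simpa only [hreg, Nat.reduceLT])
      (by simpa only [hreg, Nat.reduceLT]) hxS hyS hxy hiff (by rwa [hb])
  | push₁ S x y h h6 hy h13 h14 h15 hφ =>
    rw [body, exec_dispatcher (k := 5) rfl h6]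
    refine exists_inv_pushCode₁ (x := x) (y := y) hL
      (by simpa only [hreg, Nat.reduceLT] using hm 5 h) ?_ ?_ ?_ ?_ ?_ ?_ <;>
      simpa only [hreg, Nat.reduceLT, hb]
  | push₂ S y h h6 h13 h14 h15 hφ =>
    rw [body, exec_dispatcher (k := 5) rfl h6]
    refine exists_inv_pushCode₂ (y := y) hL
      (by simpa only [hreg, Nat.reduceLT] using hm 5 h) ?_ ?_ ?_ ?_ ?_ <;>
      simpa only [hreg, Nat.reduceLT, hb]
  | done h4' => omega

theorem Inv.reg_five {φ : ℕ} (h : Inv G a₀ a₁ φ σ) : σ.reg 5 = 0 := by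
  cases h with
  | init h6 h0 h5 => exact h5
  | done h4 h5 => exact h5
  | _ => exact Main.reg₅ (by assumption)

theorem Inv.done_of_ne {φ : ℕ} (h : Inv G a₀ a₁ φ σ) (hne : σ.reg 4 ≠ σ.reg 5) :
    (UniquelyMatchable G Finset.univ → σ.reg 1 = 1) ∧
      (¬ UniquelyMatchable G Finset.univ → σ.reg 1 = 0) := by
  rw [h.reg_five] at hne
  cases h with
  | init h6 h0 h5 h4 => exact (hne h4).elim
  | done h4 h5 h h' => exact ⟨h, h'⟩
  | _ => exact (hne (Main.reg₄ (by assumption))).elim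

theorem decidesWithin {n : ℕ} {G : SimpleGraph (Fin n)} {adj : Fin n → List (Fin n)}
    (hadj : IsNeighborhoodLists G adj) (hG : ClawFree G) :
    DecidesWithin (.while (.eq 4 5) body) adj (HasUniquePerfectMatching G)
      ((42 * (body.cost + 1) + 1) * (n + G.edgeSet.ncard + 1)) := by
  have hL := hadj.layout
  obtain ⟨a₀, ha₀⟩ : ∃ a, (input adj).arr 0 = a := ⟨_, rfl⟩
  obtain ⟨a₁, ha₁⟩ : ∃ a, (input adj).arr 1 = a := ⟨_, rfl⟩
  rw [ha₀, ha₁] at hL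
  obtain ⟨φ, t, σ, ht, hinv, hne, hhalt⟩ := exists_after_eq_nil (a := 4) (b := 5) loopFree_body
    (σ₀ := input adj) (I := fun φ _ σ => Inv G a₀ a₁ φ σ)
    (φ₀ := n + (∑ v : Fin n, (21 * (a₀ (v + 1) - a₀ v) + 30) + 10 * n) + 2)
    (by
      refine .init ?_ ?_ ?_ ?_ ?_ ?_ ?_ ha₀ ha₁ ?_ ?_ ?_ <;> simp [input])
    (fun φ t σ h heq _ _ _ => exists_inv_body hG hL h (by rw [heq, h.reg_five]))
  have hsum : ∑ v : Fin n, (21 * (a₀ (v + 1) - a₀ v) + 30) = 42 * G.edgeSet.ncard + 30 * n := by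
    rw [Finset.sum_add_distrib, ← Finset.mul_sum, hL.sum]
    simp
    ring
  rw [hsum] at ht
  -- The initial potential is 42m + 41n + 2, and leaving the loop takes one more step.
  have hle : t + 1 ≤ (42 * (body.cost + 1) + 1) * (n + G.edgeSet.ncard + 1) := by
    generalize body.cost + 1 = K at *
    generalize G.edgeSet.ncard = m at *
    nlinarith [Nat.zero_le (K * n), Nat.zero_le K]
  obtain ⟨u, hu⟩ := Nat.exists_eq_add_of_le hle
  have hfin := after_add hhalt u
  rw [iterate_step_nil, ← hu] at hfin
  rw [DecidesWithin, hfin, hasUniquePerfectMatching_iff]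
  exact ⟨rfl, hinv.done_of_ne hne⟩

end Recognition
end RAM

/-! # An implementation of `PMinCF` -/

namespace PMinCF

namespace Implementation

open RAM RAM.Cmd

/-- Append the vertex in register `r` to the path, mark it as visited, and initialize its
pointer. -/
def append (r : ℕ) : Cmd :=
  block [.save 2 1 r, .inc 1, .const 21 1, .save 7 r 21, .load 21 0 r, .save 8 r 21]

def outerCode : Cmd :=
  .cond (.eq 3 0) (.const 4 1) (.cond (.eq 1 5) (.const 6 1) (.const 6 2))

/-- Search for a vertex that has not been visited, and let the path consist of this vertex. -/
def findCode : Cmd :=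
  block [.load 20 7 7, .cond (.eq 20 5) (block [.copy 10 7, append 10, .const 6 2]) (.inc 7)]

/-- Search for an end-extension. -/
def extendCode : Cmd :=
  block [.copy 10 1, .dec 10, .load 10 2 10, .load 20 8 10, .copy 22 10, .inc 22, .load 22 0 22,
    .cond (.eq 20 22)
      (block [.load 23 3 10, .cond (.eq 23 5) (block [.load 8 0 10, .copy 9 22, .const 6 3])
        (.const 6 5)])
      (block [.load 24 1 20, .load 25 7 24, .cond (.eq 25 5) (append 24)
        (block [.inc 20, .save 8 10 20])])]

/-- Mark the neighbors of the last vertex of the path. -/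
def markCode : Cmd :=
  .cond (.eq 8 9) (block [.copy 11 1, .dec 11, .const 12 1, .const 6 4])
    (block [.copy 13 10, .inc 13, .load 24 1 8, .save 9 24 13, .inc 8])

def storeCode : Cmd :=
  block [.save 3 10 12, .const 6 5]

/-- Walk back on the path as long as its vertices are marked. -/
def walkCode : Cmd :=
  .cond (.eq 11 5) storeCode
    (block [.copy 20 11, .dec 20, .load 20 2 20, .load 21 9 20, .copy 13 10, .inc 13,
      .cond (.eq 21 13) (block [.dec 11, .inc 12]) storeCode])

/-- Search for a swap-extension. -/
def swapCode : Cmd :=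
  block [.copy 20 1, .dec 20, .load 10 2 20, .dec 20, .load 11 2 20, .load 21 3 10, .const 22 2,
    .cond (.lt 22 21)
      (block [.load 23 8 11, .copy 24 11, .inc 24, .load 24 0 24,
        .cond (.eq 23 24) (.const 6 6)
          (block [.load 25 1 23, .load 26 7 25,
            .cond (.eq 26 5)
              (block [.save 2 20 10, .inc 20, .save 2 20 11, .dec 21, .save 3 10 21, .load 21 3 11,
                .cond (.eq 21 5) .skip (block [.inc 21, .save 3 11 21]), append 25, .const 6 2])
              (block [.inc 23, .save 8 11 23])])])
      (.const 6 6)]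

def cutCode : Cmd :=
  block [.dec 1, .load 10 2 1, .dec 1, .load 11 2 1, .save 4 2 11, .save 5 2 10, .inc 2,
    .const 20 1, .save 6 10 20, .save 6 11 20, .inc 3, .inc 3, .const 6 0]

/-- One `restart` step of the algorithm is split between `findCode`, which fixes the first vertex,
and `extendCode`, which finds the second. Marking and walking handle one vertex per iteration, which
keeps the body loop-free. -/
def body : Cmd :=
  dispatcher [outerCode, findCode, extendCode, markCode, walkCode, swapCode, cutCode]

theorem loopFree_body : body.LoopFree := by
  refine loopFree_dispatcher ?_
  simp [outerCode, findCode, extendCode, markCode, walkCode, storeCode, swapCode, cutCode, append,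
    block, LoopFree]

/-- The list `P`, read backwards, is stored at the beginning of the array. -/
def Holds {n : ℕ} : List (Fin n) → (ℕ → ℕ) → Prop
  | [], _ => True
  | v :: P, f => f P.length = v ∧ Holds P f

theorem Holds.congr {n : ℕ} {P : List (Fin n)} {f g : ℕ → ℕ} (h : Holds P f)
    (hfg : ∀ i < P.length, g i = f i) : Holds P g := by
  induction P with
  | nil => trivial
  | cons v P ih =>
    exact ⟨by rw [hfg _ (by simp), h.1], ih h.2 fun i hi => hfg i (by simp; omega)⟩

theorem Holds.eq_getElem_reverse {n : ℕ} {P : List (Fin n)} {f : ℕ → ℕ} (h : Holds P f) (i : ℕ)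
    (hi : i < P.reverse.length) : f i = (P.reverse[i] : Fin n) := by
  induction P with
  | nil => simp at hi
  | cons v P ih =>
    simp only [List.reverse_cons, List.length_append, List.length_reverse, List.length_singleton]
      at hi
    by_cases hi' : i < P.length
    · simp only [List.reverse_cons]
      rw [List.getElem_append_left (by simpa using hi')]
      exact ih h.2 (by simpa using hi')
    · have hiP : i = P.length := by omega
      subst hiP
      simp [h.1]

theorem Holds.of_append {n : ℕ} {P Q : List (Fin n)} {f : ℕ → ℕ} (h : Holds (P ++ Q) f) :
    Holds Q f := by
  induction P with
  | nil => exact h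
  | cons v P ih => exact ih h.2

/-- The store `σ` holds the variables of the state `s`, except that the path is `P`, and the
auxiliary variables of the program: register `3` counts the deleted vertices, all vertices before
register `7` are visited, array `7` is zero at the vertices that have not been visited, array `8`
holds pointers to the neighbors that have not been considered yet, and the marks in array `9`
certify adjacency. -/
structure Sim {n : ℕ} (G : SimpleGraph (Fin n)) (a₀ a₁ : ℕ → ℕ) (s : State (Fin n))
    (P : List (Fin n)) (σ : Store) : Prop where
  reg₀ : σ.reg 0 = n
  reg₅ : σ.reg 5 = 0
  reg₄ : σ.reg 4 = 0
  count : σ.reg 3 + s.rem.card = n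
  arr₀ : σ.arr 0 = a₀
  arr₁ : σ.arr 1 = a₁
  length : σ.reg 1 = P.length
  path : Holds P (σ.arr 2)
  sub : ∀ v ∈ P, v ∈ s.rem
  lm_eq : ∀ v : Fin n, (σ.arr 3 v : ℤ) = s.lm v + 1
  card_M : σ.reg 2 = s.M.card
  mem_M : ∀ e, e ∈ s.M ↔
    ∃ i < σ.reg 2, ∃ a b : Fin n, σ.arr 4 i = a ∧ σ.arr 5 i = b ∧ e = s(a, b)
  mem_rem : ∀ v : Fin n, v ∈ s.rem ↔ σ.arr 6 v = 0
  visited : ∀ v : Fin n, σ.arr 7 v = 0 ↔ v ∈ s.rem ∧ v ∉ P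
  pointer : ∀ v : Fin n, σ.arr 7 v ≠ 0 → a₀ v ≤ σ.arr 8 v ∧ σ.arr 8 v ≤ a₀ (v + 1) ∧
    ∀ j, a₀ v ≤ j → j < σ.arr 8 v → σ.arr 7 (a₁ j) ≠ 0
  mark : ∀ u v : Fin n, σ.arr 9 u = v + 1 → G.Adj v u
  scan : ∀ v : Fin n, v < σ.reg 7 → σ.arr 7 v ≠ 0
  scan_le : σ.reg 7 ≤ n

/-- An unvisited vertex holds its future pointer moves and 20 units, released when it is appended; a
visited one holds only the pointer moves left. The 10 units of a current vertex pay for matching it.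
As long as lm is undetermined, twice the degree is held for marking the neighbors and walking back.
-/
def credit (a₀ : ℕ → ℕ) (σ : Store) (v : ℕ) : ℕ :=
  (if σ.arr 7 v = 0 then a₀ (v + 1) - a₀ v + 20 else a₀ (v + 1) - σ.arr 8 v) +
    (if σ.arr 6 v = 0 then 10 else 0) +
    if σ.arr 3 v = 0 then 2 * (a₀ (v + 1) - a₀ v) + 10 else 0

/-- The last summand pays for the scan for unvisited vertices, which never moves backwards. -/
def base (n : ℕ) (a₀ : ℕ → ℕ) (σ : Store) : ℕ :=
  ∑ v : Fin n, credit a₀ σ v + (n - σ.reg 7)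

/-- The invariants of the loop, with an upper bound `φ` for the number of remaining iterations. -/
inductive Loop {n : ℕ} (G : SimpleGraph (Fin n)) (a₀ a₁ : ℕ → ℕ) (φ : ℕ) (s : State (Fin n))
    (σ : Store) : Prop
  | outer (hs : s.point = .outer) (h : Sim G a₀ a₁ s s.path σ) (h6 : σ.reg 6 = 0)
      (hφ : base n a₀ σ + 6 ≤ φ)
  | find (hs : s.point = .outer) (hp : s.path = []) (hc : 2 ≤ s.rem.card)
      (h : Sim G a₀ a₁ s [] σ) (h6 : σ.reg 6 = 1) (hφ : base n a₀ σ + 5 ≤ φ)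
  -- The second alternative covers a restart whose first vertex is already stored, while the formal
  -- state, which picks both ends of the edge in one step, still has the empty path.
  | extend (w : Fin n) (p : List (Fin n)) (h : Sim G a₀ a₁ s (w :: p) σ)
      (hs : (s.point = .body ∧ s.path = w :: p) ∨
        (s.point = .outer ∧ s.path = [] ∧ 2 ≤ s.rem.card ∧ p = []))
      (h6 : σ.reg 6 = 2) (hφ : base n a₀ σ + 4 ≤ φ)
  | mark (w : Fin n) (p : List (Fin n)) (hs : s.point = .body) (hp : s.path = w :: p)
      (h : Sim G a₀ a₁ s (w :: p) σ) (hlm : s.lm w = -1) (hn : ¬ HasNewNbr G s w)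
      (h6 : σ.reg 6 = 3) (hw : σ.reg 10 = w) (h9 : σ.reg 9 = a₀ (w + 1)) (h8 : a₀ w ≤ σ.reg 8)
      (h8' : σ.reg 8 ≤ σ.reg 9)
      (hm : ∀ j, a₀ w ≤ j → j < σ.reg 8 → σ.arr 9 (a₁ j) = w + 1)
      -- Marking leaves `base` unchanged; its iterations are charged in advance against the credit
      -- of `w`, which is released only when lm is stored. The walk continues this debt.
      (hφ : base n a₀ σ + 3 ≤ φ + (σ.reg 8 - a₀ w))
  | walk (w : Fin n) (q r : List (Fin n)) (hs : s.point = .body) (hp : s.path = w :: (q ++ r))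
      (h : Sim G a₀ a₁ s (w :: (q ++ r)) σ) (hlm : s.lm w = -1) (hn : ¬ HasNewNbr G s w)
      (h6 : σ.reg 6 = 4) (hw : σ.reg 10 = w) (h11 : σ.reg 11 = r.length)
      (h12 : σ.reg 12 = q.length + 1) (hq : ∀ x ∈ q, G.Adj w x)
      (hm : ∀ u, G.Adj w u → σ.arr 9 u = w + 1)
      (hφ : base n a₀ σ + 2 ≤ φ + (a₀ (w + 1) - a₀ w) + q.length)
  | swap (x y : Fin n) (p : List (Fin n)) (hs : s.point = .swapTest) (hp : s.path = x :: y :: p)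
      (h : Sim G a₀ a₁ s (x :: y :: p) σ) (h6 : σ.reg 6 = 5) (hφ : base n a₀ σ + 2 ≤ φ)
  | cut (x y : Fin n) (p : List (Fin n)) (hs : s.point = .cut) (hp : s.path = x :: y :: p)
      (h : Sim G a₀ a₁ s (x :: y :: p) σ) (h6 : σ.reg 6 = 6) (hφ : base n a₀ σ + 1 ≤ φ)
  | done (hs : s.point = .outer) (hc : s.rem.card < 2) (h4 : σ.reg 4 = 1) (h5 : σ.reg 5 = 0)
      (h : Represents s σ)

/-- One iteration of the loop performs at most one step of `PMinCF`. -/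
def Progress {n : ℕ} (G : SimpleGraph (Fin n)) (a₀ a₁ : ℕ → ℕ) (φ : ℕ) (s : State (Fin n))
    (σ : Store) : Prop :=
  ∃ φ' < φ, ∃ s', (s' = s ∨ Step G s s' ∧ Represents s' σ) ∧ Loop G a₀ a₁ φ' s' σ

/-! ### Elementary changes of the store: simulation and released credit -/

variable {n : ℕ} {G : SimpleGraph (Fin n)} {a₀ a₁ : ℕ → ℕ} {s t : State (Fin n)}
  {P : List (Fin n)} {σ τ : Store}

theorem base_congr (h7 : τ.reg 7 = σ.reg 7) (harr : τ.arr = σ.arr) :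
    base n a₀ τ = base n a₀ σ := by
  simp [base, credit, h7, harr]

theorem Sim.represents (h : Sim G a₀ a₁ s s.path σ) : Represents s σ where
  path_length := h.length
  path_eq := h.path.eq_getElem_reverse
  lm_eq := h.lm_eq
  card_M := h.card_M
  mem_M := h.mem_M
  mem_rem := h.mem_rem

theorem Sim.state_congr (h : Sim G a₀ a₁ s P σ) (hr : t.rem = s.rem) (hl : t.lm = s.lm)
    (hM : t.M = s.M) : Sim G a₀ a₁ t P σ := by
  obtain ⟨h0, h1, h2, h3, h4, h5, h6, h7, h8, h9, h10, h11, h12, h13, h14, h15, h16, h17⟩ := h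
  exact ⟨h0, h1, h2, hr ▸ h3, h4, h5, h6, h7, hr ▸ h8, hl ▸ h9, hM ▸ h10, hM ▸ h11, hr ▸ h12,
    hr ▸ h13, h14, h15, h16, h17⟩

theorem Sim.congr (h : Sim G a₀ a₁ s P σ) (hreg : ∀ r < 8, r ≠ 6 → τ.reg r = σ.reg r)
    (harr : τ.arr = σ.arr) : Sim G a₀ a₁ s P τ := by
  obtain ⟨h0, h1, h2, h3, h4, h5, h6, h7, h8, h9, h10, h11, h12, h13, h14, h15, h16, h17⟩ := h
  rw [← harr] at h4 h5 h7 h9 h11 h12 h13 h14 h15 h16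
  rw [← hreg] at h0 h1 h2 h3 h6 h10 h11 h16 h17 <;> try norm_num
  exact ⟨h0, h1, h2, h3, h4, h5, h6, h7, h8, h9, h10, h11, h12, h13, h14, h15, h16, h17⟩

/-- The pointer of `w` moves past a visited neighbor. -/
theorem Sim.advance {w : Fin n} (h : Sim G a₀ a₁ s P σ) (hw : σ.arr 7 w ≠ 0)
    (hlt : σ.arr 8 w < a₀ (w + 1)) (hv : σ.arr 7 (a₁ (σ.arr 8 w)) ≠ 0)
    (hreg : ∀ r < 8, r ≠ 6 → τ.reg r = σ.reg r)
    (harr : τ.arr = (σ.setArr 8 w (σ.arr 8 w + 1)).arr) :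
    Sim G a₀ a₁ s P τ ∧ base n a₀ τ + 1 = base n a₀ σ := by
  have harr' : ∀ k, k ≠ 8 → τ.arr k = σ.arr k := by
    intro k hk
    rw [harr]
    simp [Store.setArr_arr, hk]
  have h8 : τ.arr 8 = Function.update (σ.arr 8) w (σ.arr 8 w + 1) := by
    rw [harr]
    simp [Store.setArr_arr]
  constructor
  · have hp : ∀ v : Fin n, τ.arr 7 v ≠ 0 → a₀ v ≤ τ.arr 8 v ∧ τ.arr 8 v ≤ a₀ (v + 1) ∧
        ∀ j, a₀ v ≤ j → j < τ.arr 8 v → τ.arr 7 (a₁ j) ≠ 0 := by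
      intro v hv'
      rw [harr' 7 (by norm_num)] at hv' ⊢
      obtain ⟨h1, h2, h3⟩ := h.pointer v hv'
      by_cases hvw : v = w
      · subst hvw
        rw [h8, Function.update_self]
        refine ⟨by omega, by omega, fun j hj hj' => ?_⟩
        by_cases hj'' : j = σ.arr 8 v
        · rwa [hj'']
        · exact h3 j hj (by omega)
      · rw [h8, Function.update_of_ne (fun h' => hvw (Fin.ext h'))]
        exact ⟨h1, h2, h3⟩
    obtain ⟨h0, h1, h2, h3, h4, h5, h6, h7, h8, h9, h10, h11, h12, h13, h14, h15, h16, h17⟩ := h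
    rw [← harr'] at h4 h5 h7 h12 h13 h15 h16 <;> try norm_num
    rw [← hreg] at h0 h1 h2 h3 h6 h10 h16 h17 <;> try norm_num
    simp only [← harr' 3 (by norm_num)] at h9
    rw [← hreg 2 (by norm_num) (by norm_num), ← harr' 4 (by norm_num),
      ← harr' 5 (by norm_num)] at h11
    exact ⟨h0, h1, h2, h3, h4, h5, h6, h7, h8, h9, h10, h11, h12, h13, hp, h15, h16, h17⟩
  · have := sum_add_eq_sum_add (f := fun v : Fin n => credit a₀ τ v)
      (g := fun v : Fin n => credit a₀ σ v) (x := w) (fun v hv => by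
        have hv' : (v : ℕ) ≠ w := fun h' => hv (Fin.ext h')
        simp [credit, harr' 7, harr' 6, harr' 3, h8, hv'])
    simp only [credit, harr' 7 (by norm_num), harr' 6 (by norm_num), harr' 3 (by norm_num), h8,
      Function.update_self, hw, if_false] at this
    simp only [base, hreg 7 (by norm_num) (by norm_num), credit, harr' 7 (by norm_num),
      harr' 6 (by norm_num), harr' 3 (by norm_num), h8]
    omega

/-- A new vertex is appended to the path. -/
theorem Sim.append (hL : Layout G a₀ a₁) {v : Fin n} (h : Sim G a₀ a₁ s P σ) (hv : σ.arr 7 v = 0)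
    (hreg : ∀ r < 8, r ≠ 6 → r ≠ 1 → τ.reg r = σ.reg r) (h1 : τ.reg 1 = P.length + 1)
    (harr : τ.arr = (((σ.setArr 2 P.length v).setArr 7 v 1).setArr 8 v (a₀ v)).arr) :
    Sim G a₀ a₁ s (v :: P) τ ∧ base n a₀ τ + 20 = base n a₀ σ := by
  have harr' : ∀ k, k ≠ 2 → k ≠ 7 → k ≠ 8 → τ.arr k = σ.arr k := by
    intro k hk hk' hk''
    rw [harr]
    simp [Store.setArr_arr, hk, hk', hk'']
  have ha2 : τ.arr 2 = Function.update (σ.arr 2) P.length v := by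
    rw [harr]
    simp [Store.setArr_arr]
  have ha7 : τ.arr 7 = Function.update (σ.arr 7) v 1 := by
    rw [harr]
    simp [Store.setArr_arr]
  have ha8 : τ.arr 8 = Function.update (σ.arr 8) v (a₀ v) := by
    rw [harr]
    simp [Store.setArr_arr]
  have ha7' : ∀ i, σ.arr 7 i ≠ 0 → τ.arr 7 i ≠ 0 := by
    intro i hi
    rw [ha7, Function.update_apply]
    split_ifs <;> simp [hi]
  have hle := hL.le v
  constructor
  · exact {
      reg₀ := by rw [hreg 0 (by norm_num) (by norm_num) (by norm_num), h.reg₀]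
      reg₅ := by rw [hreg 5 (by norm_num) (by norm_num) (by norm_num), h.reg₅]
      reg₄ := by rw [hreg 4 (by norm_num) (by norm_num) (by norm_num), h.reg₄]
      count := by rw [hreg 3 (by norm_num) (by norm_num) (by norm_num), h.count]
      arr₀ := by rw [harr' 0 (by norm_num) (by norm_num) (by norm_num), h.arr₀]
      arr₁ := by rw [harr' 1 (by norm_num) (by norm_num) (by norm_num), h.arr₁]
      length := by simp [h1]
      path := by
        refine ⟨by rw [ha2, Function.update_self], h.path.congr fun i hi => ?_⟩
        rw [ha2, Function.update_of_ne hi.ne]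
      sub := by
        intro u hu
        rcases List.mem_cons.1 hu with rfl | hu
        exacts [((h.visited u).1 hv).1, h.sub u hu]
      lm_eq := by
        rw [harr' 3 (by norm_num) (by norm_num) (by norm_num)]
        exact h.lm_eq
      card_M := by rw [hreg 2 (by norm_num) (by norm_num) (by norm_num), h.card_M]
      mem_M := by
        rw [hreg 2 (by norm_num) (by norm_num) (by norm_num),
          harr' 4 (by norm_num) (by norm_num) (by norm_num),
          harr' 5 (by norm_num) (by norm_num) (by norm_num)]
        exact h.mem_M
      mem_rem := by
        rw [harr' 6 (by norm_num) (by norm_num) (by norm_num)]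
        exact h.mem_rem
      visited := by
        intro u
        have := h.visited u
        rw [ha7]
        simp only [Function.update_apply, Fin.val_inj, List.mem_cons, not_or]
        split_ifs <;> simp_all
      pointer := by
        intro u hu
        by_cases huv : u = v
        · subst huv
          rw [ha8, Function.update_self]
          exact ⟨le_rfl, hle, fun j h1 h2 => by omega⟩
        · have huv' : (u : ℕ) ≠ v := fun h' => huv (Fin.ext h')
          rw [ha7, Function.update_of_ne huv'] at hu
          obtain ⟨h1, h2, h3⟩ := h.pointer u hu
          rw [ha8, Function.update_of_ne huv']
          exact ⟨h1, h2, fun j hj hj' => ha7' _ (h3 j hj hj')⟩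
      mark := by
        rw [harr' 9 (by norm_num) (by norm_num) (by norm_num)]
        exact h.mark
      scan := by
        rw [hreg 7 (by norm_num) (by norm_num) (by norm_num)]
        exact fun u hu => ha7' _ (h.scan u hu)
      scan_le := by
        rw [hreg 7 (by norm_num) (by norm_num) (by norm_num)]
        exact h.scan_le }
  · have := sum_add_eq_sum_add (f := fun u : Fin n => credit a₀ τ u)
      (g := fun u : Fin n => credit a₀ σ u) (x := v) (fun u hu => by
        have hu' : (u : ℕ) ≠ v := fun h' => hu (Fin.ext h')
        simp [credit, harr' 6, harr' 3, ha7, ha8, hu'])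
    simp only [credit, harr' 6 (by norm_num) (by norm_num) (by norm_num),
      harr' 3 (by norm_num) (by norm_num) (by norm_num), ha7, ha8,
      Function.update_self, hv, if_true, one_ne_zero, if_false] at this
    simp only [base, hreg 7 (by norm_num) (by norm_num) (by norm_num), credit,
      harr' 6 (by norm_num) (by norm_num) (by norm_num),
      harr' 3 (by norm_num) (by norm_num) (by norm_num), ha7, ha8]
    omega

theorem represents_congr (h : Represents s σ) (h1 : τ.reg 1 = σ.reg 1) (h2 : τ.reg 2 = σ.reg 2)
    (harr : τ.arr = σ.arr) : Represents s τ := by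
  obtain ⟨h3, h4, h5, h6, h7, h8⟩ := h
  rw [← harr] at h4 h5 h7 h8
  rw [← h1] at h3
  rw [← h2] at h6 h7
  exact ⟨h3, h4, h5, h6, h7, h8⟩

theorem Sim.represents_of_eq (h : Sim G a₀ a₁ s P σ) (hp : t.path = P) (hr : t.rem = s.rem)
    (hl : t.lm = s.lm) (hM : t.M = s.M) : Represents t σ := by
  subst hp
  exact (h.state_congr hr hl hM).represents

theorem Sim.visited_of_mem (h : Sim G a₀ a₁ s P σ) {v : Fin n} (hv : v ∈ P) : σ.arr 7 v ≠ 0 :=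
  fun h' => ((h.visited v).1 h').2 hv

theorem Sim.next (h : Sim G a₀ a₁ s P σ) (hlt : σ.reg 7 < n) (hv : σ.arr 7 (σ.reg 7) ≠ 0)
    (hreg : ∀ r < 8, r ≠ 6 → r ≠ 7 → τ.reg r = σ.reg r) (h7 : τ.reg 7 = σ.reg 7 + 1)
    (harr : τ.arr = σ.arr) :
    Sim G a₀ a₁ s P τ ∧ base n a₀ τ + 1 = base n a₀ σ := by
  constructor
  · have hscan : ∀ v : Fin n, v < τ.reg 7 → τ.arr 7 v ≠ 0 := by
      intro v hv'
      rw [harr]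
      by_cases hv'' : (v : ℕ) = σ.reg 7
      · rwa [hv'']
      · exact h.scan v (by omega)
    obtain ⟨h0, h1, h2, h3, h4, h5, h6, h7', h8, h9, h10, h11, h12, h13, h14, h15, -, -⟩ := h
    rw [← harr] at h4 h5 h7' h9 h11 h12 h13 h14 h15
    rw [← hreg] at h0 h1 h2 h3 h6 h10 h11 <;> try norm_num
    exact ⟨h0, h1, h2, h3, h4, h5, h6, h7', h8, h9, h10, h11, h12, h13, h14, h15, hscan, by omega⟩
  · simp only [base, credit, harr, h7]
    omega

/-- The neighbor `v` of `w` is marked. -/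
theorem Sim.setMark {v w : Fin n} (h : Sim G a₀ a₁ s P σ) (hwv : G.Adj w v)
    (hreg : ∀ r < 8, r ≠ 6 → τ.reg r = σ.reg r) (harr : τ.arr = (σ.setArr 9 v (w + 1)).arr) :
    Sim G a₀ a₁ s P τ ∧ base n a₀ τ = base n a₀ σ := by
  have harr' : ∀ k, k ≠ 9 → τ.arr k = σ.arr k := by
    intro k hk
    rw [harr]
    simp [Store.setArr_arr, hk]
  have h9 : τ.arr 9 = Function.update (σ.arr 9) v (w + 1) := by
    rw [harr]
    simp [Store.setArr_arr]
  constructor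
  · have hm : ∀ u v : Fin n, τ.arr 9 u = v + 1 → G.Adj v u := by
      intro u x hux
      rw [h9, Function.update_apply] at hux
      split_ifs at hux with huv
      · rw [Fin.ext huv, ← Fin.ext (by omega : (w : ℕ) = x)]
        exact hwv
      · exact h.mark u x hux
    obtain ⟨h0, h1, h2, h3, h4, h5, h6, h7, h8, h9, h10, h11, h12, h13, h14, -, h16, h17⟩ := h
    rw [← harr'] at h4 h5 h7 h12 h13 h16 <;> try norm_num
    rw [← hreg] at h0 h1 h2 h3 h6 h10 h16 h17 <;> try norm_num
    simp only [← harr' 3 (by norm_num)] at h9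
    rw [← hreg 2 (by norm_num) (by norm_num), ← harr' 4 (by norm_num),
      ← harr' 5 (by norm_num)] at h11
    rw [← harr' 7 (by norm_num), ← harr' 8 (by norm_num)] at h14
    exact ⟨h0, h1, h2, h3, h4, h5, h6, h7, h8, h9, h10, h11, h12, h13, h14, hm, h16, h17⟩
  · simp [base, credit, hreg 7, harr' 7, harr' 8, harr' 6, harr' 3]

/-- The value of `lm` is determined for the vertex `w`. -/
theorem Sim.setLm {w : Fin n} {l : ℕ} (h : Sim G a₀ a₁ s P σ) (hw : s.lm w = -1)
    (hreg : ∀ r < 8, r ≠ 6 → τ.reg r = σ.reg r) (harr : τ.arr = (σ.setArr 3 w (l + 1)).arr)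
    (hr : t.rem = s.rem) (hl : t.lm = Function.update s.lm w (l : ℤ)) (hM : t.M = s.M) :
    Sim G a₀ a₁ t P τ ∧ base n a₀ τ + (2 * (a₀ (w + 1) - a₀ w) + 10) = base n a₀ σ := by
  have harr' : ∀ k, k ≠ 3 → τ.arr k = σ.arr k := by
    intro k hk
    rw [harr]
    simp [Store.setArr_arr, hk]
  have ha3 : τ.arr 3 = Function.update (σ.arr 3) w (l + 1) := by
    rw [harr]
    simp [Store.setArr_arr]
  have hw0 : σ.arr 3 w = 0 := by
    have := h.lm_eq w
    omega
  constructor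
  · have hm : ∀ v : Fin n, (τ.arr 3 v : ℤ) = t.lm v + 1 := by
      intro v
      rw [ha3, hl, Function.update_apply, Function.update_apply]
      simp only [Fin.val_inj]
      split_ifs
      · simp
      · exact h.lm_eq v
    refine Sim.state_congr (s := ⟨s.point, s.rem, s.path, t.lm, s.M⟩) ?_ hr rfl hM
    obtain ⟨h0, h1, h2, h3, h4, h5, h6, h7, h8, -, h10, h11, h12, h13, h14, h15, h16, h17⟩ := h
    rw [← harr'] at h4 h5 h7 h12 h13 h15 h16 <;> try norm_num
    rw [← hreg] at h0 h1 h2 h3 h6 h10 h16 h17 <;> try norm_num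
    rw [← hreg 2 (by norm_num) (by norm_num), ← harr' 4 (by norm_num),
      ← harr' 5 (by norm_num)] at h11
    rw [← harr' 7 (by norm_num), ← harr' 8 (by norm_num)] at h14
    exact ⟨h0, h1, h2, h3, h4, h5, h6, h7, h8, hm, h10, h11, h12, h13, h14, h15, h16, h17⟩
  · have := sum_add_eq_sum_add (f := fun v : Fin n => credit a₀ τ v)
      (g := fun v : Fin n => credit a₀ σ v) (x := w) (fun v hv => by
        have hv' : (v : ℕ) ≠ w := fun h' => hv (Fin.ext h')
        simp [credit, harr' 7, harr' 8, harr' 6, ha3, hv'])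
    simp only [credit, harr' 7 (by norm_num), harr' 6 (by norm_num), harr' 8 (by norm_num), ha3,
      Function.update_self, hw0, if_true, Nat.succ_ne_zero, if_false] at this
    simp only [base, hreg 7 (by norm_num) (by norm_num), credit, harr' 7 (by norm_num),
      harr' 6 (by norm_num), harr' 8 (by norm_num), ha3]
    omega

/-! ### Every block of the implementation makes progress -/

theorem progress_outerCode (hinv : PMinCF.Inv G s) {φ : ℕ} (hs : s.point = .outer)
    (h : Sim G a₀ a₁ s s.path σ) (hφ : base n a₀ σ + 6 ≤ φ) :
    Progress G a₀ a₁ φ s (outerCode.exec σ) := by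
  obtain ⟨τ, hτ⟩ : ∃ τ, outerCode.exec σ = τ := ⟨_, rfl⟩
  rw [hτ]
  simp only [outerCode, exec, eval_eq_iff, h.reg₀, h.reg₅] at hτ
  have hcount := h.count
  by_cases h3 : σ.reg 3 = n
  · simp only [h3, if_true] at hτ
    subst hτ
    exact ⟨φ - 1, by omega, s, Or.inl rfl, .done hs (by omega) (by simp [Store.setReg_reg])
      (by simp [Store.setReg_reg, h.reg₅]) (represents_congr h.represents rfl rfl rfl)⟩
  -- The program only tests whether all vertices are deleted; by parity this is the same as having
  -- fewer than two left.
  have hc : 2 ≤ s.rem.card := by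
    obtain ⟨k, hk⟩ := hinv.even
    omega
  simp only [h3, if_false, h.length, List.length_eq_zero_iff] at hτ
  have hsim : ∀ k, Sim G a₀ a₁ s s.path (σ.setReg 6 k) := fun k => by
    refine h.congr (fun r _ hr6 => ?_) rfl
    simp [Store.setReg_reg, hr6]
  have hb : ∀ k, base n a₀ (σ.setReg 6 k) = base n a₀ σ := fun k => base_congr rfl rfl
  by_cases hp : s.path = []
  · simp only [hp, if_true] at hτ
    subst hτ
    exact ⟨base n a₀ σ + 5, by omega, s, Or.inl rfl,
      .find hs hp hc (hp ▸ hsim 1) (by simp [Store.setReg_reg]) (by rw [hb])⟩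
  · simp only [hp, if_false] at hτ
    subst hτ
    obtain ⟨w, p, hwp⟩ := List.exists_cons_of_ne_nil hp
    refine ⟨base n a₀ σ + 4, by omega, _, Or.inr ⟨.keep s hs hc hp, ?_⟩,
      .extend w p ?_ (Or.inl ⟨rfl, hwp⟩) (by simp [Store.setReg_reg]) (by rw [hb])⟩
    · exact (hsim 2).represents_of_eq rfl rfl rfl rfl
    · exact (hwp ▸ hsim 2).state_congr rfl rfl rfl

theorem exec_append (r : ℕ) (hr : r < 30 ∧ r ≠ 1 ∧ r ≠ 21) (hL : Layout G a₀ a₁) {v : Fin n}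
    (h : Sim G a₀ a₁ s P σ) (hv : σ.arr 7 v = 0) (hσ : σ.reg r = v) :
    (∀ k, k ≠ 1 → k ≠ 21 → ((append r).exec σ).reg k = σ.reg k) ∧
      Sim G a₀ a₁ s (v :: P) ((append r).exec σ) ∧
      base n a₀ ((append r).exec σ) + 20 = base n a₀ σ := by
  obtain ⟨τ, hτ⟩ : ∃ τ, (append r).exec σ = τ := ⟨_, rfl⟩
  rw [hτ]
  simp only [Implementation.append, exec_block_nil, exec_block_cons, exec, Store.setReg_reg,
    Store.setArr_reg, Store.setReg_arr, Store.setArr_arr] at hτ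
  simp [hr, hσ, h.arr₀, h.length] at hτ
  have hreg : ∀ k, k ≠ 1 → k ≠ 21 → τ.reg k = σ.reg k := by
    intro k h1 h21
    rw [← hτ]
    simp [Store.setReg_reg, Store.setArr_reg, h1, h21]
  refine ⟨hreg, h.append hL hv (fun k hk _ h1 => hreg k h1 (by omega)) ?_ ?_⟩
  · rw [← hτ]; simp [Store.setReg_reg, Store.setArr_reg]
  · rw [← hτ]; rfl

theorem progress_findCode (hL : Layout G a₀ a₁) {φ : ℕ} (hs : s.point = .outer)
    (hp : s.path = []) (hc : 2 ≤ s.rem.card) (h : Sim G a₀ a₁ s [] σ) (h6 : σ.reg 6 = 1)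
    (hφ : base n a₀ σ + 5 ≤ φ) : Progress G a₀ a₁ φ s (findCode.exec σ) := by
  obtain ⟨τ, hτ⟩ : ∃ τ, findCode.exec σ = τ := ⟨_, rfl⟩
  rw [hτ]
  -- With an empty path the unvisited vertices are exactly the remaining ones, so the scan cannot
  -- run off the end.
  have hlt : σ.reg 7 < n := by
    obtain ⟨v, hv⟩ : s.rem.Nonempty := Finset.card_pos.1 (by omega)
    by_contra hge
    exact h.scan v (by omega) ((h.visited v).2 ⟨hv, by simp⟩)
  simp only [findCode, exec_block_nil, exec_block_cons, exec, eval_eq_iff, Store.setReg_reg] at hτ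
  by_cases hv : σ.arr 7 (σ.reg 7) = 0
  · obtain ⟨v, hv'⟩ : ∃ v : Fin n, σ.reg 7 = v := ⟨⟨_, hlt⟩, rfl⟩
    rw [hv'] at hv
    simp [hv', hv, h.reg₅] at hτ
    obtain ⟨υ, hυ⟩ : ∃ υ, (σ.setReg 20 0).setReg 10 v = υ := ⟨_, rfl⟩
    rw [hυ] at hτ
    have harr : υ.arr = σ.arr := by rw [← hυ]; rfl
    have hυreg : ∀ r, r ≠ 10 → r ≠ 20 → υ.reg r = σ.reg r := by
      intro r h1 h2
      rw [← hυ]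
      simp [Store.setReg_reg, h1, h2]
    have hυs : Sim G a₀ a₁ s [] υ :=
      h.congr (fun r hr _ => hυreg r (by omega) (by omega)) harr
    obtain ⟨hreg, hsim, hb⟩ := exec_append 10 (by norm_num) hL hυs (v := v) (by rw [harr, hv])
      (by rw [← hυ]; simp [Store.setReg_reg])
    have hb' : base n a₀ υ = base n a₀ σ := base_congr (hυreg 7 (by norm_num) (by norm_num)) harr
    have hb'' : base n a₀ τ = base n a₀ ((Implementation.append 10).exec υ) := by
      rw [← hτ]
      exact base_congr rfl rfl
    refine ⟨φ - 1, by omega, s, Or.inl rfl, .extend v [] (hsim.congr ?_ ?_)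
      (Or.inr ⟨hs, hp, hc, rfl⟩) ?_ (by omega)⟩
    · intro r _ hr6
      rw [← hτ]
      simp [Store.setReg_reg, hr6]
    · rw [← hτ]; rfl
    · rw [← hτ]; simp [Store.setReg_reg]
  · simp [hv, h.reg₅] at hτ
    obtain ⟨hsim, hb⟩ := h.next (τ := τ) hlt hv (by
      intro r hr h6 h7
      rw [← hτ]
      simp [Store.setReg_reg, h7, show r ≠ 20 by omega]) (by
      rw [← hτ]
      simp [Store.setReg_reg]) (by rw [← hτ]; rfl)
    refine ⟨φ - 1, by omega, s, Or.inl rfl, .find hs hp hc hsim ?_ (by omega)⟩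
    rw [← hτ]
    simp [Store.setReg_reg, h6]

/-- All neighbors behind the pointer are visited, and visited vertices of the current graph lie on
the path. So a pointer at the end of the list certifies that there is no end-extension. -/
theorem progress_extendCode (hL : Layout G a₀ a₁) (hinv : PMinCF.Inv G s) {φ : ℕ} {w : Fin n}
    {p : List (Fin n)} (h : Sim G a₀ a₁ s (w :: p) σ)
    (hs : (s.point = .body ∧ s.path = w :: p) ∨
      (s.point = .outer ∧ s.path = [] ∧ 2 ≤ s.rem.card ∧ p = []))
    (h6 : σ.reg 6 = 2) (hφ : base n a₀ σ + 4 ≤ φ) :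
    Progress G a₀ a₁ φ s (extendCode.exec σ) := by
  obtain ⟨τ, hτ⟩ : ∃ τ, extendCode.exec σ = τ := ⟨_, rfl⟩
  rw [hτ]
  have hwvis := h.visited_of_mem (v := w) (by simp)
  obtain ⟨hp1, hp2, hp3⟩ := h.pointer w hwvis
  simp only [extendCode, exec_block_nil, exec_block_cons, exec, eval_eq_iff, Store.setReg_reg,
    Store.setReg_arr] at hτ
  simp [h.length, h.path.1, h.arr₀, h.reg₅] at hτ
  by_cases hend : σ.arr 8 w = a₀ (w + 1)
  · have hall : ∀ v ∈ s.rem, G.Adj w v → v ∈ w :: p := by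
      intro v hv hwv
      by_contra hvp
      obtain ⟨j, hj, hj', hjv⟩ := (hL.adj_iff w v).1 hwv
      exact hp3 j hj (by omega) (by rw [hjv]; exact (h.visited v).2 ⟨hv, hvp⟩)
    -- In the middle of a restart the pointer cannot reach the end: by connectivity the first vertex
    -- has a neighbor in the current graph.
    obtain ⟨hsb, hp⟩ : s.point = .body ∧ s.path = w :: p := by
      rcases hs with hs | ⟨-, -, hc, rfl⟩
      · exact hs
      · obtain ⟨v, hv, hwv⟩ := hinv.conn.exists_adj hc (h.sub w (by simp))
        have := hall v hv hwv
        simp only [List.mem_singleton] at this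
        exact (hwv.ne this.symm).elim
    have hn : ¬ HasNewNbr G s w := by
      rintro ⟨v, ⟨hv, hwv⟩, hvp⟩
      rw [hp] at hvp
      exact hvp (hall v hv hwv)
    have hlm := h.lm_eq w
    by_cases h3 : σ.arr 3 w = 0
    · simp [hend, h3] at hτ
      refine ⟨φ - 1, by omega, s, Or.inl rfl, .mark w p hsb hp (h.congr ?_ ?_) (by omega) hn
        ?_ ?_ ?_ ?_ ?_ ?_ ?_⟩
      · intro r hr hr6
        rw [← hτ]
        simp [Store.setReg_reg, hr6, show r ≠ 8 by omega, show r ≠ 9 by omega,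
          show r ≠ 10 by omega, show r ≠ 20 by omega, show r ≠ 22 by omega, show r ≠ 23 by omega]
      · rw [← hτ]; rfl
      · rw [← hτ]; simp [Store.setReg_reg]
      · rw [← hτ]; simp [Store.setReg_reg]
      · rw [← hτ]; simp [Store.setReg_reg]
      · rw [← hτ]; simp [Store.setReg_reg]
      · rw [← hτ]; simp [Store.setReg_reg, hL.le w]
      · intro j hj hj'
        rw [← hτ] at hj'
        simp [Store.setReg_reg] at hj'
        omega
      · have : base n a₀ τ = base n a₀ σ := by
          rw [← hτ]
          exact base_congr rfl rfl
        omega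
    · simp [hend, h3] at hτ
      have hlm' : s.lm w ≠ -1 := by omega
      obtain ⟨y, q, rfl⟩ := hinv.exists_cons_cons hp hlm'
      have hb : base n a₀ τ = base n a₀ σ := by
        rw [← hτ]
        exact base_congr rfl rfl
      have hsim : Sim G a₀ a₁ s (w :: y :: q) τ := by
        refine h.congr ?_ ?_
        · intro r hr hr6
          rw [← hτ]
          simp [Store.setReg_reg, hr6, show r ≠ 10 by omega, show r ≠ 20 by omega,
            show r ≠ 22 by omega, show r ≠ 23 by omega]
        · rw [← hτ]; rfl
      refine ⟨base n a₀ τ + 2, by omega, _, Or.inr ⟨.lm_known s w _ hsb hp hn hlm', ?_⟩,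
        .swap w y q rfl hp (hsim.state_congr rfl rfl rfl) ?_ le_rfl⟩
      · exact hsim.represents_of_eq hp rfl rfl rfl
      · rw [← hτ]; simp [Store.setReg_reg]
  · obtain ⟨v, hwv, hv⟩ := hL.exists_adj w (σ.arr 8 w) hp1 (by omega)
    simp [hend, h.arr₁, hv] at hτ
    by_cases hvis : σ.arr 7 v = 0
    · simp [hvis] at hτ
      obtain ⟨υ, hυ⟩ : ∃ υ, (((((((((σ.setReg 10 (p.length + 1)).setReg 10 p.length).setReg 10
        w).setReg 20 (σ.arr 8 w)).setReg 22 w).setReg 22 (w + 1)).setReg 22 (a₀ (w + 1))).setReg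
          24 v).setReg 25 0) = υ := ⟨_, rfl⟩
      rw [hυ] at hτ
      have harr : υ.arr = σ.arr := by rw [← hυ]; rfl
      have hυreg : ∀ r < 10, υ.reg r = σ.reg r := by
        intro r hr
        rw [← hυ]
        simp [Store.setReg_reg, show r ≠ 10 by omega, show r ≠ 20 by omega,
          show r ≠ 22 by omega, show r ≠ 24 by omega, show r ≠ 25 by omega]
      have hυs : Sim G a₀ a₁ s (w :: p) υ := h.congr (fun r hr _ => hυreg r (by omega)) harr
      obtain ⟨hreg, hsim, hb⟩ := exec_append 24 (by norm_num) hL hυs (v := v)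
        (by rw [harr, hvis]) (by rw [← hυ]; simp [Store.setReg_reg])
      rw [hτ] at hreg hsim hb
      have hb' : base n a₀ υ = base n a₀ σ := base_congr (hυreg 7 (by norm_num)) harr
      have h6' : τ.reg 6 = 2 := by
        rw [hreg 6 (by norm_num) (by norm_num), hυreg 6 (by norm_num), h6]
      obtain ⟨hvrem, hvp⟩ := (h.visited v).1 hvis
      rcases hs with ⟨hs, hp⟩ | ⟨hs, hp, hc, rfl⟩
      · exact ⟨base n a₀ τ + 4, by omega, _,
          Or.inr ⟨.end_extension s w v p hs hp ⟨hvrem, hwv⟩ (by rwa [hp]),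
            hsim.represents_of_eq rfl rfl rfl rfl⟩,
          .extend v (w :: p) (hsim.state_congr rfl rfl rfl) (Or.inl ⟨hs, rfl⟩) h6' le_rfl⟩
      · exact ⟨base n a₀ τ + 4, by omega, _,
          Or.inr ⟨.restart s w v hs hc hp (h.sub w (by simp)) ⟨hvrem, hwv⟩,
            hsim.represents_of_eq rfl rfl rfl rfl⟩,
          .extend v [w] (hsim.state_congr rfl rfl rfl) (Or.inl ⟨rfl, rfl⟩) h6' le_rfl⟩
    · simp [hvis] at hτ
      obtain ⟨hsim, hb⟩ := h.advance (τ := τ) hwvis (by omega) (by rwa [hv]) (by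
        intro r hr hr6
        rw [← hτ]
        simp [Store.setReg_reg, Store.setArr_reg, show r ≠ 10 by omega, show r ≠ 20 by omega,
          show r ≠ 22 by omega, show r ≠ 24 by omega, show r ≠ 25 by omega]) (by
        rw [← hτ]; rfl)
      refine ⟨φ - 1, by omega, s, Or.inl rfl, .extend w p hsim hs ?_ (by omega)⟩
      rw [← hτ]
      simp [Store.setReg_reg, Store.setArr_reg, h6]

theorem progress_markCode (hL : Layout G a₀ a₁) {φ : ℕ} {w : Fin n} {p : List (Fin n)}
    (hs : s.point = .body) (hp : s.path = w :: p)
    (h : Sim G a₀ a₁ s (w :: p) σ) (hlm : s.lm w = -1) (hn : ¬ HasNewNbr G s w)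
    (h6 : σ.reg 6 = 3) (hw : σ.reg 10 = w) (h9 : σ.reg 9 = a₀ (w + 1)) (h8 : a₀ w ≤ σ.reg 8)
    (h8' : σ.reg 8 ≤ σ.reg 9)
    (hm : ∀ j, a₀ w ≤ j → j < σ.reg 8 → σ.arr 9 (a₁ j) = w + 1)
    (hφ : base n a₀ σ + 3 ≤ φ + (σ.reg 8 - a₀ w)) :
    Progress G a₀ a₁ φ s (markCode.exec σ) := by
  obtain ⟨τ, hτ⟩ : ∃ τ, markCode.exec σ = τ := ⟨_, rfl⟩
  rw [hτ]
  -- A fictitious assignment of lm shows that the credit of `w` is still contained in `base`; it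
  -- keeps the bound positive despite the debt.
  have hpos : 2 * (a₀ (w + 1) - a₀ w) + 10 ≤ base n a₀ σ := by
    have := (h.setLm (w := w) (l := 0) (τ := σ.setArr 3 w 1) hlm (fun _ _ _ => rfl) rfl
      (t := ⟨s.point, s.rem, s.path, Function.update s.lm w 0, s.M⟩) rfl rfl rfl).2
    omega
  simp only [markCode, exec_block_nil, exec_block_cons, exec, eval_eq_iff, Store.setReg_reg,
    Store.setReg_arr, Store.setArr_reg] at hτ
  by_cases hend : σ.reg 8 = σ.reg 9
  · simp [hend, h.length] at hτ
    have hb : base n a₀ τ = base n a₀ σ := by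
      rw [← hτ]
      exact base_congr rfl rfl
    refine ⟨φ - 1, by omega, s, Or.inl rfl, .walk w [] p hs (by simpa using hp) (h.congr ?_ ?_) hlm
      hn ?_ ?_ ?_ ?_ (by simp) ?_ ?_⟩
    · intro r hr hr6
      rw [← hτ]
      simp [Store.setReg_reg, hr6, show r ≠ 11 by omega, show r ≠ 12 by omega]
    · rw [← hτ]; rfl
    · rw [← hτ]; simp [Store.setReg_reg]
    · rw [← hτ]; simp [Store.setReg_reg, hw]
    · rw [← hτ]; simp [Store.setReg_reg]
    · rw [← hτ]; simp [Store.setReg_reg]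
    · intro u hu
      obtain ⟨j, hj, hj', hju⟩ := (hL.adj_iff w u).1 hu
      rw [← hju, ← hτ]
      exact hm j hj (by omega)
    · simp only [List.length_nil]
      omega
  · obtain ⟨v, hwv, hv⟩ := hL.exists_adj w (σ.reg 8) h8 (by omega)
    simp [hend, hw, h.arr₁, hv] at hτ
    have harr : τ.arr = (σ.setArr 9 v (w + 1)).arr := by rw [← hτ]; rfl
    obtain ⟨hsim, hb⟩ := h.setMark (τ := τ) hwv (by
      intro r hr hr6
      rw [← hτ]
      simp [Store.setReg_reg, Store.setArr_reg, show r ≠ 13 by omega, show r ≠ 24 by omega,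
        show r ≠ 8 by omega]) harr
    have h8τ : τ.reg 8 = σ.reg 8 + 1 := by rw [← hτ]; simp [Store.setReg_reg]
    have h9τ : τ.reg 9 = σ.reg 9 := by rw [← hτ]; simp [Store.setReg_reg, Store.setArr_reg]
    refine ⟨φ - 1, by omega, s, Or.inl rfl, .mark w p hs hp hsim hlm hn ?_ ?_ (by omega) (by omega)
      (by omega) ?_ (by omega)⟩
    · rw [← hτ]; simp [Store.setReg_reg, Store.setArr_reg, h6]
    · rw [← hτ]; simp [Store.setReg_reg, Store.setArr_reg, hw]
    · intro j hj hj'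
      rw [harr, Store.setArr_arr, if_pos rfl, Function.update_apply]
      split_ifs with hjv
      · rfl
      · refine hm j hj ?_
        by_contra hj''
        exact hjv (by rw [← hv]; congr 1; omega)

theorem progress_storeCode (hL : Layout G a₀ a₁) (hinv : PMinCF.Inv G s) {φ : ℕ} {w : Fin n}
    {q r : List (Fin n)} (hs : s.point = .body) (hp : s.path = w :: (q ++ r))
    (h : Sim G a₀ a₁ s (w :: (q ++ r)) σ) (hlm : s.lm w = -1) (hn : ¬ HasNewNbr G s w)
    (hw : σ.reg 10 = w) (h12 : σ.reg 12 = q.length + 1) (hq : ∀ x ∈ q, G.Adj w x)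
    (hr : adjRun G w r = 0)
    (hφ : base n a₀ σ + 2 ≤ φ + (a₀ (w + 1) - a₀ w) + q.length) :
    Progress G a₀ a₁ φ s (storeCode.exec σ) := by
  obtain ⟨τ, hτ⟩ : ∃ τ, storeCode.exec σ = τ := ⟨_, rfl⟩
  rw [hτ]
  simp only [storeCode, exec_block_nil, exec_block_cons, exec, hw, h12] at hτ
  have hrun : adjRun G w (q ++ r) = q.length := by
    rw [adjRun_append hq, hr, Nat.add_zero]
  have hone := hinv.one_le_adjRun hs hp hn
  rw [hrun] at hone
  have hnodup := hinv.nodup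
  rw [hp, List.nodup_cons, List.nodup_append] at hnodup
  -- The walk passed only distinct neighbors of `w`, so together with the marking its debt is at
  -- most twice the degree, the amount released by `Sim.setLm`.
  have hdeg := hL.length_le hnodup.2.1 hq
  obtain ⟨y, q', rfl⟩ := List.exists_cons_of_length_pos hone
  have hgr : IsGreatest (lmSet G s w (y :: q' ++ r)) (y :: q').length :=
    (isGreatest_lmSet_iff fun x hx => h.sub x (List.mem_cons_of_mem _ hx)).2 ⟨hrun.symm, hone⟩
  obtain ⟨hsim, hb⟩ := h.setLm (τ := τ) (l := (y :: q').length)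
    (t := { s with point := .swapTest, lm := Function.update s.lm w ((y :: q').length : ℤ) }) hlm
    (by
      intro k _ hk
      rw [← hτ]
      simp [Store.setReg_reg, Store.setArr_reg, hk]) (by rw [← hτ]; rfl) rfl rfl rfl
  refine ⟨base n a₀ τ + 2, by omega, _, Or.inr ⟨.lm_compute s w _ _ hs hp hn hlm hgr, ?_⟩,
    .swap w y (q' ++ r) rfl hp hsim ?_ le_rfl⟩
  · exact hsim.represents_of_eq hp rfl rfl rfl
  · rw [← hτ]
    simp [Store.setReg_reg]

/-- No credit changes, because the zeros of array `3`, the undetermined values, stay the same: the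
shifted value at `x` is at least 3 before the decrement, and an undetermined value at `y` is left
alone. -/
theorem Sim.swap {x y : Fin n} {p : List (Fin n)} (h : Sim G a₀ a₁ s (x :: y :: p) σ)
    (hxy : x ≠ y) (hx : 2 ≤ s.lm x) (hr : t.rem = s.rem) (hl : t.lm = swapLm s.lm x y)
    (hM : t.M = s.M) (hreg : ∀ r < 8, r ≠ 6 → τ.reg r = σ.reg r)
    (harr : ∀ k, k ≠ 2 → k ≠ 3 → τ.arr k = σ.arr k)
    (ha2 : τ.arr 2 = Function.update (Function.update (σ.arr 2) p.length x) (p.length + 1) y)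
    (hax : τ.arr 3 x = σ.arr 3 x - 1)
    (hay : τ.arr 3 y = if σ.arr 3 y = 0 then 0 else σ.arr 3 y + 1)
    (ha3 : ∀ v : Fin n, v ≠ x → v ≠ y → τ.arr 3 v = σ.arr 3 v) :
    Sim G a₀ a₁ t (y :: x :: p) τ ∧ base n a₀ τ = base n a₀ σ := by
  have hlx := h.lm_eq x
  have hly := h.lm_eq y
  have hmem : ∀ v, v ∈ y :: x :: p ↔ v ∈ x :: y :: p := by
    intro v
    simp only [List.mem_cons]
    tauto
  constructor
  · have hlm : ∀ v : Fin n, (τ.arr 3 v : ℤ) = t.lm v + 1 := by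
      intro v
      rw [hl]
      by_cases hvx : v = x
      · rw [hvx, swapLm_left hxy, hax]
        omega
      by_cases hvy : v = y
      · rw [hvy, swapLm_right hxy, hay]
        split_ifs <;> push_cast <;> omega
      · rw [swapLm_of_ne hvx hvy, ha3 v hvx hvy, h.lm_eq]
    have hpath : Holds (y :: x :: p) (τ.arr 2) := by
      refine ⟨by simp [ha2], by simp [ha2], h.path.2.2.congr fun i hi => ?_⟩
      rw [ha2, Function.update_of_ne (by omega), Function.update_of_ne (by omega)]
    refine Sim.state_congr (s := ⟨s.point, s.rem, s.path, t.lm, s.M⟩) ?_ hr rfl hM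
    obtain ⟨h0, h1, h2, h3, h4, h5, h6, h7, h8, -, h10, h11, h12, h13, h14, h15, h16, h17⟩ := h
    rw [← harr] at h4 h5 h12 h13 h15 h16 <;> try norm_num
    rw [← hreg] at h0 h1 h2 h3 h6 h10 h16 h17 <;> try norm_num
    rw [← hreg 2 (by norm_num) (by norm_num), ← harr 4 (by norm_num) (by norm_num),
      ← harr 5 (by norm_num) (by norm_num)] at h11
    rw [← harr 7 (by norm_num) (by norm_num), ← harr 8 (by norm_num) (by norm_num)] at h14
    simp only [← hmem] at h8 h13
    exact ⟨h0, h1, h2, h3, h4, h5, h6, hpath, h8, hlm, h10, h11, h12, h13, h14, h15, h16, h17⟩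
  · have : ∀ v : Fin n, τ.arr 3 v = 0 ↔ σ.arr 3 v = 0 := by
      intro v
      by_cases hvx : v = x
      · rw [hvx, hax]
        omega
      by_cases hvy : v = y
      · rw [hvy, hay]
        split_ifs <;> simp_all
      · rw [ha3 v hvx hvy]
    simp [base, credit, hreg 7, harr 7, harr 8, harr 6, this]

/-- The matched vertices leave the path and the current graph together, so array `7` stays correct
and no pointer has to be reset. -/
theorem Sim.cut {x y : Fin n} {p : List (Fin n)} (h : Sim G a₀ a₁ s (x :: y :: p) σ)
    (hnodup : (x :: y :: p).Nodup) (hM' : s(y, x) ∉ s.M) (hr : t.rem = s.rem \ {x, y})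
    (hl : t.lm = s.lm) (hM : t.M = insert s(y, x) s.M)
    (hreg : ∀ r < 8, r ≠ 1 → r ≠ 2 → r ≠ 3 → r ≠ 6 → τ.reg r = σ.reg r) (h1 : τ.reg 1 = p.length)
    (h2 : τ.reg 2 = σ.reg 2 + 1) (h3 : τ.reg 3 = σ.reg 3 + 2)
    (harr : ∀ k, k ≠ 4 → k ≠ 5 → k ≠ 6 → τ.arr k = σ.arr k)
    (ha4 : τ.arr 4 = Function.update (σ.arr 4) (σ.reg 2) y)
    (ha5 : τ.arr 5 = Function.update (σ.arr 5) (σ.reg 2) x)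
    (ha6 : τ.arr 6 = Function.update (Function.update (σ.arr 6) x 1) y 1) :
    Sim G a₀ a₁ t p τ ∧ base n a₀ τ + 20 = base n a₀ σ := by
  have hxr : x ∈ s.rem := h.sub x (by simp)
  have hyr : y ∈ s.rem := h.sub y (by simp)
  simp only [List.nodup_cons, List.mem_cons, not_or] at hnodup
  obtain ⟨⟨hxy, hxp⟩, hyp, -⟩ := hnodup
  have ha6' : ∀ v : Fin n, τ.arr 6 v = if v = y then 1 else if v = x then 1 else σ.arr 6 v := by
    intro v
    rw [ha6, Function.update_apply, Function.update_apply]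
    simp only [Fin.val_inj]
  constructor
  · exact {
      reg₀ := by rw [hreg 0, h.reg₀] <;> norm_num
      reg₅ := by rw [hreg 5, h.reg₅] <;> norm_num
      reg₄ := by rw [hreg 4, h.reg₄] <;> norm_num
      count := by
        have hsub : ({x, y} : Finset (Fin n)) ⊆ s.rem := by
          intro v hv
          rcases Finset.mem_insert.1 hv with rfl | hv
          · exact hxr
          · rwa [Finset.mem_singleton.1 hv]
        have := Finset.card_sdiff_add_card_eq_card hsub
        rw [Finset.card_pair hxy] at this
        have := h.count
        rw [h3, hr]
        omega
      arr₀ := by rw [harr 0, h.arr₀] <;> norm_num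
      arr₁ := by rw [harr 1, h.arr₁] <;> norm_num
      length := h1
      path := by
        rw [harr 2 (by norm_num) (by norm_num) (by norm_num)]
        exact h.path.2.2
      sub := by
        intro v hv
        have := h.sub v (by simp [hv])
        rw [hr]
        simp only [Finset.mem_sdiff, Finset.mem_insert, Finset.mem_singleton, this, true_and]
        rintro (rfl | rfl) <;> contradiction
      lm_eq := by
        rw [harr 3 (by norm_num) (by norm_num) (by norm_num), hl]
        exact h.lm_eq
      card_M := by
        rw [h2, hM, Finset.card_insert_of_notMem hM', h.card_M]
      mem_M := by
        intro e
        rw [hM, Finset.mem_insert, h.mem_M, h2, ha4, ha5]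
        constructor
        · rintro (rfl | ⟨i, hi, a, b, ha, hb, rfl⟩)
          · exact ⟨σ.reg 2, by omega, y, x, by simp, by simp, rfl⟩
          · exact ⟨i, by omega, a, b, by rwa [Function.update_of_ne hi.ne],
              by rwa [Function.update_of_ne hi.ne], rfl⟩
        · rintro ⟨i, hi, a, b, ha, hb, rfl⟩
          by_cases hi' : i = σ.reg 2
          · subst hi'
            rw [Function.update_self] at ha hb
            left
            rw [Fin.ext ha, Fin.ext hb]
          · rw [Function.update_of_ne hi'] at ha hb
            exact Or.inr ⟨i, by omega, a, b, ha, hb, rfl⟩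
      mem_rem := by
        intro v
        rw [hr, ha6']
        simp only [Finset.mem_sdiff, Finset.mem_insert, Finset.mem_singleton, h.mem_rem]
        split_ifs <;> simp_all
      visited := by
        intro v
        rw [harr 7 (by norm_num) (by norm_num) (by norm_num), h.visited, hr]
        simp only [Finset.mem_sdiff, Finset.mem_insert, Finset.mem_singleton, List.mem_cons]
        tauto
      pointer := by
        rw [harr 7 (by norm_num) (by norm_num) (by norm_num),
          harr 8 (by norm_num) (by norm_num) (by norm_num)]
        exact h.pointer
      mark := by
        rw [harr 9 (by norm_num) (by norm_num) (by norm_num)]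
        exact h.mark
      scan := by
        rw [hreg 7, harr 7] <;> try norm_num
        exact h.scan
      scan_le := by
        rw [hreg 7] <;> try norm_num
        exact h.scan_le }
  · have hc : ∀ v : Fin n, credit a₀ σ v =
        credit a₀ τ v + ((if v = x then 10 else 0) + if v = y then 10 else 0) := by
      intro v
      have hx6 := (h.mem_rem x).1 hxr
      have hy6 := (h.mem_rem y).1 hyr
      simp only [credit, harr 7 (by norm_num) (by norm_num) (by norm_num),
        harr 8 (by norm_num) (by norm_num) (by norm_num),
        harr 3 (by norm_num) (by norm_num) (by norm_num), ha6']
      by_cases hvx : v = x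
      · subst hvx
        simp only [hxy, if_true, if_false, one_ne_zero, hx6]
        omega
      by_cases hvy : v = y
      · subst hvy
        simp only [hvx, if_true, if_false, one_ne_zero, hy6]
        omega
      · simp [hvx, hvy]
    simp only [base, hc, Finset.sum_add_distrib, Finset.sum_ite_eq', Finset.mem_univ, if_true,
      hreg 7 (by norm_num) (by norm_num) (by norm_num) (by norm_num) (by norm_num)]
    omega

theorem progress_cutCode (hinv : PMinCF.Inv G s) {φ : ℕ} {x y : Fin n}
    {p : List (Fin n)} (hs : s.point = .cut) (hp : s.path = x :: y :: p)
    (h : Sim G a₀ a₁ s (x :: y :: p) σ) (hφ : base n a₀ σ + 1 ≤ φ) :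
    Progress G a₀ a₁ φ s (cutCode.exec σ) := by
  obtain ⟨τ, hτ⟩ : ∃ τ, cutCode.exec σ = τ := ⟨_, rfl⟩
  rw [hτ]
  have hnodup := hinv.nodup
  rw [hp] at hnodup
  have h1 : σ.arr 2 (p.length + 1) = x := h.path.1
  have h2 : σ.arr 2 p.length = y := h.path.2.1
  simp only [cutCode, exec_block_nil, exec_block_cons, exec, Store.setReg_reg, Store.setReg_arr,
    Store.setArr_reg] at hτ
  simp [h.length, h1, h2] at hτ
  obtain ⟨hsim, hb⟩ := h.cut (τ := τ)
    (t := { s with point := .outer, rem := s.rem \ {x, y}, path := p, M := insert s(y, x) s.M })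
    hnodup (fun hM => (hinv.adj_of_mem _ _ hM).2.1 (h.sub y (by simp))) rfl rfl rfl
    (by
      intro r hr h1 h2 h3 h6
      rw [← hτ]
      simp [Store.setReg_reg, Store.setArr_reg, h1, h2, h3, h6, show r ≠ 10 by omega,
        show r ≠ 11 by omega, show r ≠ 20 by omega])
    (by rw [← hτ]; simp [Store.setReg_reg, Store.setArr_reg])
    (by rw [← hτ]; simp [Store.setReg_reg, Store.setArr_reg])
    (by rw [← hτ]; simp [Store.setReg_reg])
    (by
      intro k h4 h5 h6
      rw [← hτ]
      simp [Store.setReg_arr, Store.setArr_arr, h4, h5, h6])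
    (by rw [← hτ]; simp [Store.setReg_arr, Store.setArr_arr])
    (by rw [← hτ]; simp [Store.setReg_arr, Store.setArr_arr])
    (by rw [← hτ]; simp [Store.setReg_arr, Store.setArr_arr])
  refine ⟨base n a₀ τ + 6, by omega, _, Or.inr ⟨.match_last s x y p hs hp, hsim.represents⟩,
    .outer rfl hsim ?_ le_rfl⟩
  rw [← hτ]
  simp [Store.setReg_reg]

/-- A mark equal to `w + 1` decides adjacency to `w`: marks left by other vertices carry other
numbers, and all neighbors of `w` have been marked in the preceding phase. -/
theorem progress_walkCode (hL : Layout G a₀ a₁) (hinv : PMinCF.Inv G s) {φ : ℕ} {w : Fin n}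
    {q r : List (Fin n)} (hs : s.point = .body) (hp : s.path = w :: (q ++ r))
    (h : Sim G a₀ a₁ s (w :: (q ++ r)) σ) (hlm : s.lm w = -1) (hn : ¬ HasNewNbr G s w)
    (h6 : σ.reg 6 = 4) (hw : σ.reg 10 = w) (h11 : σ.reg 11 = r.length)
    (h12 : σ.reg 12 = q.length + 1) (hq : ∀ x ∈ q, G.Adj w x)
    (hm : ∀ u, G.Adj w u → σ.arr 9 u = w + 1)
    (hφ : base n a₀ σ + 2 ≤ φ + (a₀ (w + 1) - a₀ w) + q.length) :
    Progress G a₀ a₁ φ s (walkCode.exec σ) := by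
  rcases r with _ | ⟨y, r⟩
  · have : walkCode.exec σ = storeCode.exec σ := by
      simp [walkCode, exec, eval_eq_iff, h11, h.reg₅]
    rw [this]
    exact progress_storeCode hL hinv hs hp h hlm hn hw h12 hq rfl hφ
  have hy : σ.arr 2 r.length = y := (Holds.of_append h.path.2).1
  obtain ⟨υ, hυ⟩ : ∃ υ, block [.copy 20 11, .dec 20, .load 20 2 20, .load 21 9 20, .copy 13 10,
    .inc 13, .cond (.eq 21 13) (block [.dec 11, .inc 12]) storeCode] = υ := ⟨_, rfl⟩
  have hex : walkCode.exec σ = υ.exec σ := by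
    simp [walkCode, exec, eval_eq_iff, h11, h.reg₅, hυ]
  rw [hex]
  simp only [← hυ, exec_block_cons, exec_block_nil, exec, eval_eq_iff, Store.setReg_reg,
    Store.setReg_arr]
  simp only [Nat.reduceEqDiff, if_true, if_false, h11, List.length_cons, Nat.add_sub_cancel, hy, hw]
  obtain ⟨ω, hω⟩ : ∃ ω, (((((σ.setReg 20 (r.length + 1)).setReg 20 r.length).setReg 20 y).setReg 21
    (σ.arr 9 y)).setReg 13 w).setReg 13 (w + 1) = ω := ⟨_, rfl⟩
  have harr : ω.arr = σ.arr := by rw [← hω]; rfl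
  have hreg : ∀ k < 13, ω.reg k = σ.reg k := by
    intro k hk
    rw [← hω]
    simp [Store.setReg_reg, show k ≠ 13 by omega, show k ≠ 20 by omega, show k ≠ 21 by omega]
  have hsim : Sim G a₀ a₁ s (w :: (q ++ y :: r)) ω :=
    h.congr (fun k hk _ => hreg k (by omega)) harr
  have hb : base n a₀ ω = base n a₀ σ := base_congr (hreg 7 (by norm_num)) harr
  rw [hω]
  by_cases hwy : σ.arr 9 y = w + 1
  · have hadj := h.mark y w hwy
    simp only [hwy, if_true]
    have hq' : ∀ x ∈ q ++ [y], G.Adj w x := by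
      intro x hx
      rcases List.mem_append.1 hx with hx | hx
      · exact hq x hx
      · rw [List.mem_singleton.1 hx]
        exact hadj
    have heq : q ++ y :: r = (q ++ [y]) ++ r := by simp
    have hpos := (h.setLm (w := w) (l := 0) (τ := σ.setArr 3 w 1) hlm (fun _ _ _ => rfl) rfl
      (t := ⟨s.point, s.rem, s.path, Function.update s.lm w 0, s.M⟩) rfl rfl rfl).2
    have hnodup := hinv.nodup
    rw [hp, List.nodup_cons, List.nodup_append] at hnodup
    have hdeg := hL.length_le hnodup.2.1 hq
    rw [heq] at hp hsim
    obtain ⟨τ, hτ⟩ : ∃ τ, (ω.setReg 11 r.length).setReg 12 (σ.reg 12 + 1) = τ := ⟨_, rfl⟩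
    have hbτ : base n a₀ τ = base n a₀ ω := by
      rw [← hτ]
      exact base_congr rfl rfl
    have hregτ : ∀ k < 11, τ.reg k = ω.reg k := by
      intro k hk
      rw [← hτ]
      simp [Store.setReg_reg, show k ≠ 11 by omega, show k ≠ 12 by omega]
    rw [hτ]
    refine ⟨φ - 1, by omega, s, Or.inl rfl, .walk w (q ++ [y]) r hs hp (hsim.congr
      (fun k hk _ => hregτ k (by omega)) (by rw [← hτ]; rfl)) hlm hn ?_ ?_ ?_ ?_ hq' ?_ ?_⟩
    · rw [hregτ 6 (by norm_num), hreg 6 (by norm_num), h6]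
    · rw [hregτ 10 (by norm_num), hreg 10 (by norm_num), hw]
    · rw [← hτ]; simp [Store.setReg_reg]
    · rw [← hτ]; simp [Store.setReg_reg, h12]
    · rw [← hτ]
      simpa only [Store.setReg_arr, harr] using hm
    · rw [List.length_append, List.length_singleton]
      omega
  · have hnadj : ¬ G.Adj w y := fun hadj => hwy (hm y hadj)
    simp only [hwy, if_false]
    exact progress_storeCode hL hinv hs hp hsim hlm hn (by rw [hreg 10 (by norm_num), hw])
      (by rw [hreg 12 (by norm_num), h12]) hq (adjRun_cons_of_not_adj hnadj r) (by rwa [hb])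

theorem progress_no_extension {φ : ℕ} {x y : Fin n} {p : List (Fin n)}
    (hs : s.point = .swapTest) (hp : s.path = x :: y :: p) (h : Sim G a₀ a₁ s (x :: y :: p) σ)
    (hφ : base n a₀ σ + 2 ≤ φ) (hne : ¬ (2 ≤ s.lm x ∧ HasNewNbr G s y)) (h6 : τ.reg 6 = 6)
    (hreg : ∀ r < 8, r ≠ 6 → τ.reg r = σ.reg r) (harr : τ.arr = σ.arr) :
    Progress G a₀ a₁ φ s τ := by
  have hsim := h.congr hreg harr
  have hb : base n a₀ τ = base n a₀ σ := base_congr (hreg 7 (by norm_num) (by norm_num)) harr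
  exact ⟨base n a₀ τ + 1, by omega, _, Or.inr ⟨.no_extension s x y p hs hp hne,
    hsim.represents_of_eq hp rfl rfl rfl⟩,
    .cut x y p rfl hp (hsim.state_congr rfl rfl rfl) h6 le_rfl⟩

theorem progress_swap_extension (hL : Layout G a₀ a₁) {φ : ℕ} {x y v : Fin n}
    {p : List (Fin n)} {υ : Store} (hs : s.point = .swapTest) (hp : s.path = x :: y :: p)
    (h : Sim G a₀ a₁ s (x :: y :: p) σ) (hφ : base n a₀ σ + 2 ≤ φ) (hxy : x ≠ y)
    (hlm : 2 ≤ s.lm x) (hyv : G.Adj y v) (hv : v ∈ s.rem) (hvp : v ∉ x :: y :: p)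
    (hτ : ((Implementation.append 25).exec υ).setReg 6 2 = τ)
    (hreg : ∀ r < 8, υ.reg r = σ.reg r) (h25 : υ.reg 25 = v)
    (harr : ∀ k, k ≠ 2 → k ≠ 3 → υ.arr k = σ.arr k)
    (ha2 : υ.arr 2 = Function.update (Function.update (σ.arr 2) p.length x) (p.length + 1) y)
    (hax : υ.arr 3 x = σ.arr 3 x - 1)
    (hay : υ.arr 3 y = if σ.arr 3 y = 0 then 0 else σ.arr 3 y + 1)
    (ha3 : ∀ u : Fin n, u ≠ x → u ≠ y → υ.arr 3 u = σ.arr 3 u) :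
    Progress G a₀ a₁ φ s τ := by
  obtain ⟨hsim, hb⟩ := h.swap (τ := υ) (t := { s with
    point := .body, path := v :: y :: x :: p, lm := swapLm s.lm x y }) hxy hlm rfl rfl rfl
    (fun r hr _ => hreg r hr) harr ha2 hax hay ha3
  have hvis : υ.arr 7 v = 0 := by
    rw [harr 7 (by norm_num) (by norm_num)]
    exact (h.visited v).2 ⟨hv, hvp⟩
  obtain ⟨-, hsim', hb'⟩ := exec_append 25 (by norm_num) hL hsim hvis h25
  have hb'' : base n a₀ τ = base n a₀ ((Implementation.append 25).exec υ) := by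
    rw [← hτ]
    exact base_congr rfl rfl
  have hsimτ := hsim'.congr (τ := τ) (fun r _ hr6 => by
    rw [← hτ]
    simp [Store.setReg_reg, hr6]) (by rw [← hτ]; rfl)
  refine ⟨φ - 1, by omega, _, Or.inr ⟨.swap_extension s x y v p hs hp hlm ⟨hv, hyv⟩ (by rwa [hp]),
    hsimτ.represents⟩, .extend v (y :: x :: p) hsimτ (Or.inl ⟨rfl, rfl⟩) ?_ (by omega)⟩
  rw [← hτ]
  simp [Store.setReg_reg]

theorem progress_swapCode (hL : Layout G a₀ a₁) (hinv : PMinCF.Inv G s) {φ : ℕ} {x y : Fin n}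
    {p : List (Fin n)} (hs : s.point = .swapTest) (hp : s.path = x :: y :: p)
    (h : Sim G a₀ a₁ s (x :: y :: p) σ) (h6 : σ.reg 6 = 5) (hφ : base n a₀ σ + 2 ≤ φ) :
    Progress G a₀ a₁ φ s (swapCode.exec σ) := by
  obtain ⟨τ, hτ⟩ : ∃ τ, swapCode.exec σ = τ := ⟨_, rfl⟩
  rw [hτ]
  have hnodup := hinv.nodup
  rw [hp] at hnodup
  have hxy : x ≠ y := fun h => by simp [h] at hnodup
  have hx : σ.arr 2 (p.length + 1) = x := h.path.1
  have hy : σ.arr 2 p.length = y := h.path.2.1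
  have hlx := h.lm_eq x
  have hyvis := h.visited_of_mem (v := y) (by simp)
  obtain ⟨hp1, hp2, hp3⟩ := h.pointer y hyvis
  simp only [swapCode, exec_block_nil, exec_block_cons, exec, eval_eq_iff, eval_lt_iff,
    Store.setReg_reg, Store.setReg_arr, Store.setArr_reg] at hτ
  simp [h.length, hx, hy, h.arr₀, h.reg₅] at hτ
  -- Array `3` holds lm + 1, so this is the test lm(x) ≥ 2.
  by_cases hlm : 2 < σ.arr 3 x
  swap
  · simp [hlm] at hτ
    refine progress_no_extension hs hp h hφ (fun h => by omega) ?_ ?_ ?_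
    · rw [← hτ]; simp [Store.setReg_reg]
    · intro r hr hr6
      rw [← hτ]
      simp [Store.setReg_reg, hr6, show r ≠ 10 by omega, show r ≠ 11 by omega,
        show r ≠ 20 by omega, show r ≠ 21 by omega, show r ≠ 22 by omega]
    · rw [← hτ]; rfl
  by_cases hend : σ.arr 8 y = a₀ (y + 1)
  · simp [hlm, hend] at hτ
    refine progress_no_extension hs hp h hφ ?_ ?_ ?_ ?_
    · rintro ⟨-, v, ⟨hv, hyv⟩, hvp⟩
      rw [hp] at hvp
      obtain ⟨j, hj, hj', hjv⟩ := (hL.adj_iff y v).1 hyv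
      exact hp3 j hj (by omega) (by rw [hjv]; exact (h.visited v).2 ⟨hv, hvp⟩)
    · rw [← hτ]; simp [Store.setReg_reg]
    · intro r hr hr6
      rw [← hτ]
      simp [Store.setReg_reg, hr6, show r ≠ 10 by omega, show r ≠ 11 by omega,
        show r ≠ 20 by omega, show r ≠ 21 by omega, show r ≠ 22 by omega, show r ≠ 23 by omega,
        show r ≠ 24 by omega]
    · rw [← hτ]; rfl
  obtain ⟨v, hyv, hv⟩ := hL.exists_adj y (σ.arr 8 y) hp1 (by omega)
  simp [hlm, hend, h.arr₁, hv] at hτ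
  by_cases hvis : σ.arr 7 v = 0
  · simp [hvis] at hτ
    obtain ⟨hvrem, hvp⟩ := (h.visited v).1 hvis
    have hyx : (y : ℕ) ≠ x := fun h => hxy (Fin.ext h.symm)
    simp [Store.setArr_arr, Store.setReg_arr, hyx] at hτ
    by_cases hy3 : σ.arr 3 y = 0
    · simp only [hy3, if_true] at hτ
      refine progress_swap_extension hL hs hp h hφ hxy (by omega) hyv hvrem hvp hτ ?_
        ?_ ?_ ?_ ?_ ?_ ?_
      · intro r hr
        simp [Store.setReg_reg, Store.setArr_reg, show r ≠ 10 by omega, show r ≠ 11 by omega,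
          show r ≠ 20 by omega, show r ≠ 21 by omega, show r ≠ 22 by omega, show r ≠ 23 by omega,
          show r ≠ 24 by omega, show r ≠ 25 by omega, show r ≠ 26 by omega]
      · simp [Store.setReg_reg, Store.setArr_reg]
      · intro k h2 h3
        simp [Store.setReg_arr, Store.setArr_arr, h2, h3]
      · simp [Store.setReg_arr, Store.setArr_arr]
      · simp [Store.setReg_arr, Store.setArr_arr]
      · simp [Store.setReg_arr, Store.setArr_arr, hyx, hy3]
      · intro u hux _
        have hux' : (u : ℕ) ≠ x := fun h => hux (Fin.ext h)
        simp [Store.setReg_arr, Store.setArr_arr, hux']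
    · simp only [hy3, if_false] at hτ
      refine progress_swap_extension hL hs hp h hφ hxy (by omega) hyv hvrem hvp hτ ?_
        ?_ ?_ ?_ ?_ ?_ ?_
      · intro r hr
        simp [Store.setReg_reg, Store.setArr_reg, show r ≠ 10 by omega, show r ≠ 11 by omega,
          show r ≠ 20 by omega, show r ≠ 21 by omega, show r ≠ 22 by omega, show r ≠ 23 by omega,
          show r ≠ 24 by omega, show r ≠ 25 by omega, show r ≠ 26 by omega]
      · simp [Store.setReg_reg, Store.setArr_reg]
      · intro k h2 h3
        simp [Store.setReg_arr, Store.setArr_arr, h2, h3]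
      · simp [Store.setReg_arr, Store.setArr_arr]
      · simp [Store.setReg_arr, Store.setArr_arr, hyx.symm]
      · simp [Store.setReg_arr, Store.setArr_arr, hy3]
      · intro u hux huy
        have hux' : (u : ℕ) ≠ x := fun h => hux (Fin.ext h)
        have huy' : (u : ℕ) ≠ y := fun h => huy (Fin.ext h)
        simp [Store.setReg_arr, Store.setArr_arr, hux', huy']
  · simp [hvis] at hτ
    obtain ⟨hsim, hb⟩ := h.advance (τ := τ) hyvis (by omega) (by rwa [hv]) (by
      intro r hr hr6
      rw [← hτ]
      simp [Store.setReg_reg, Store.setArr_reg, show r ≠ 10 by omega, show r ≠ 11 by omega,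
        show r ≠ 20 by omega, show r ≠ 21 by omega, show r ≠ 22 by omega, show r ≠ 23 by omega,
        show r ≠ 24 by omega, show r ≠ 25 by omega, show r ≠ 26 by omega]) (by
      rw [← hτ]; rfl)
    refine ⟨φ - 1, by omega, s, Or.inl rfl, .swap x y p hs hp hsim ?_ (by omega)⟩
    rw [← hτ]
    simp [Store.setReg_reg, Store.setArr_reg, h6]

theorem Loop.reg_five {φ : ℕ} (h : Loop G a₀ a₁ φ s σ) : σ.reg 5 = 0 := by
  cases h with
  | done hs hc h4 h5 => exact h5
  | _ => exact Sim.reg₅ (by assumption)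

theorem Loop.done_of_ne {φ : ℕ} (h : Loop G a₀ a₁ φ s σ) (hne : σ.reg 4 ≠ σ.reg 5) :
    s.point = .outer ∧ s.rem.card < 2 ∧ Represents s σ := by
  rw [h.reg_five] at hne
  cases h with
  | done hs hc h4 h5 h => exact ⟨hs, hc, h⟩
  | _ => exact (hne (Sim.reg₄ (by assumption))).elim

theorem progress_body (hL : Layout G a₀ a₁) (hinv : PMinCF.Inv G s) {φ : ℕ}
    (h : Loop G a₀ a₁ φ s σ) (h4 : σ.reg 4 = 0) : Progress G a₀ a₁ φ s (body.exec σ) := by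
  have hreg : ∀ k, ∀ r < 20, (σ.setReg 30 k).reg r = σ.reg r := by
    intro k r hr
    simp [Store.setReg_reg, show r ≠ 30 by omega]
  have hb : ∀ k, base n a₀ (σ.setReg 30 k) = base n a₀ σ := fun k =>
    base_congr (hreg k 7 (by norm_num)) rfl
  have hm : ∀ {P} k, Sim G a₀ a₁ s P σ → Sim G a₀ a₁ s P (σ.setReg 30 k) := fun k h =>
    h.congr (fun r hr _ => hreg k r (by omega)) rfl
  cases h with
  | outer hs h h6 hφ =>
    rw [body, exec_dispatcher (k := 0) rfl h6]
    exact progress_outerCode hinv hs (hm 0 h) (by rwa [hb])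
  | find hs hp hc h h6 hφ =>
    rw [body, exec_dispatcher (k := 1) rfl h6]
    exact progress_findCode hL hs hp hc (hm 1 h) (by simpa only [hreg, Nat.reduceLT])
      (by rwa [hb])
  | extend w p h hs h6 hφ =>
    rw [body, exec_dispatcher (k := 2) rfl h6]
    exact progress_extendCode hL hinv (hm 2 h) hs (by simpa only [hreg, Nat.reduceLT])
      (by rwa [hb])
  | mark w p hs hp h hlm hn h6 hw h9 h8 h8' hm' hφ =>
    rw [body, exec_dispatcher (k := 3) rfl h6]
    refine progress_markCode hL hs hp (hm 3 h) hlm hn ?_ ?_ ?_ ?_ ?_ ?_ ?_ <;>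
      simpa only [hreg, Nat.reduceLT, hb]
  | walk w q r hs hp h hlm hn h6 hw h11 h12 hq hm' hφ =>
    rw [body, exec_dispatcher (k := 4) rfl h6]
    refine progress_walkCode hL hinv hs hp (hm 4 h) hlm hn ?_ ?_ ?_ ?_ hq ?_ ?_ <;>
      simpa only [hreg, Nat.reduceLT, hb]
  | swap x y p hs hp h h6 hφ =>
    rw [body, exec_dispatcher (k := 5) rfl h6]
    exact progress_swapCode hL hinv hs hp (hm 5 h) (by simpa only [hreg, Nat.reduceLT])
      (by rwa [hb])
  | cut x y p hs hp h h6 hφ =>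
    rw [body, exec_dispatcher (k := 6) rfl h6]
    exact progress_cutCode hinv hs hp (hm 6 h) (by rwa [hb])
  | done hs hc h4' => omega

/-- A step of `PMinCF` between two times, the second state being represented at the second time. -/
def TimedStep (G : SimpleGraph (Fin n)) (p : Cmd) (σ₀ : Store) (a b : State (Fin n) × ℕ) : Prop :=
  Step G a.1 b.1 ∧ a.2 ≤ b.2 ∧ Represents b.1 (after p σ₀ b.2).store

/-- The loop invariant carries the execution as a relation, while `ImplementedWithin` asks for an
indexed sequence. -/
theorem _root_.Relation.ReflTransGen.exists_seq {α : Type*} {r : α → α → Prop} {a b : α}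
    (h : Relation.ReflTransGen r a b) :
    ∃ (N : ℕ) (f : ℕ → α), f 0 = a ∧ f N = b ∧ ∀ i < N, r (f i) (f (i + 1)) := by
  induction h with
  | refl => exact ⟨0, fun _ => a, rfl, rfl, by simp⟩
  | @tail b c _ hbc ih =>
    obtain ⟨N, f, h0, hN, hf⟩ := ih
    refine ⟨N + 1, fun i => if i ≤ N then f i else c, by simp [h0], by simp, fun i hi => ?_⟩
    by_cases hi' : i = N
    · subst hi'
      simpa [hN] using hbc
    · simpa [show i ≤ N by omega, show i + 1 ≤ N by omega] using hf i (by omega)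

/-! ### Initial store and total running time of the implementation -/

theorem sim_start (adj : Fin n → List (Fin n)) :
    Sim G ((input adj).arr 0) ((input adj).arr 1) (start (Fin n)) [] (input adj) where
  reg₀ := by simp [input]
  reg₅ := by simp [input]
  reg₄ := by simp [input]
  count := by simp [input, start]
  arr₀ := rfl
  arr₁ := rfl
  length := by simp [input]
  path := trivial
  sub := by simp
  lm_eq := by simp [input, start]
  card_M := by simp [input, start]
  mem_M := by simp [input, start]
  mem_rem := by simp [input, start]
  visited := by simp [input, start]
  pointer := by simp [input]
  mark := by simp [input]
  scan := by simp [input]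
  scan_le := by simp [input]

theorem base_input (hL : Layout G a₀ a₁) (adj : Fin n → List (Fin n)) :
    base n a₀ (input adj) = 6 * G.edgeSet.ncard + 41 * n := by
  have : ∀ v : Fin n, credit a₀ (input adj) v = 3 * (a₀ (v + 1) - a₀ v) + 40 := by
    intro v
    simp only [credit, input]
    norm_num
    omega
  simp only [base, this, Finset.sum_add_distrib, ← Finset.mul_sum, hL.sum]
  simp [input]
  omega

theorem implementedWithin {adj : Fin n → List (Fin n)} (hadj : IsNeighborhoodLists G adj)
    (hG : G.Connected) (hc : ClawFree G) (he : Even n) :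
    ImplementedWithin (.while (.eq 4 5) body) G adj
      ((94 * (body.cost + 1) + 1) * G.edgeSet.ncard) := by
  have hL := hadj.layout
  have hsim := sim_start (G := G) adj
  obtain ⟨p, hp⟩ : ∃ p, Cmd.while (.eq 4 5) body = p := ⟨_, rfl⟩
  have hinv : ∀ {s t}, Relation.ReflTransGen (TimedStep G p (input adj)) (start (Fin n), 0) (s, t) →
      PMinCF.Inv G s := fun h =>
    (inv_start hG (by simpa using he)).of_reflTransGen hc (h.lift Prod.fst fun _ _ h => h.1)
  obtain ⟨φ, t, σ, ht, ⟨s, t₀, ht₀, htr, hloop⟩, hne, hhalt⟩ := exists_after_eq_nil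
    (a := 4) (b := 5) loopFree_body (σ₀ := input adj)
    -- The invariant records the timed execution so far; `t₀` is the time of the last step, which
    -- may lie some iterations back.
    (I := fun φ t σ => ∃ s, ∃ t₀ ≤ t,
      Relation.ReflTransGen (TimedStep G p (input adj)) (start (Fin n), 0) (s, t₀) ∧
        Loop G ((input adj).arr 0) ((input adj).arr 1) φ s σ)
    (φ₀ := base n ((input adj).arr 0) (input adj) + 6)
    ⟨_, 0, le_rfl, .refl, .outer rfl hsim (by simp [input]) le_rfl⟩
    (by
      rintro φ t σ ⟨s, t₀, ht₀, htr, hloop⟩ heq t' ht' hafter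
      obtain ⟨φ', hφ', s', hs', hloop'⟩ := progress_body hL (hinv htr) hloop
        (by rw [heq, hloop.reg_five])
      refine ⟨φ', hφ', s', ?_⟩
      rcases hs' with rfl | ⟨hst, hrep⟩
      · exact ⟨t₀, ht₀.trans ht', htr, hloop'⟩
      · refine ⟨t', le_rfl, htr.tail ⟨hst, ht₀.trans ht', ?_⟩, hloop'⟩
        rw [hp] at hafter
        rwa [hafter])
  obtain ⟨hs, hcard, hrep⟩ := hloop.done_of_ne hne
  rw [hp] at hhalt ⊢
  have hhalted : Represents { s with point := .halted } (after p (input adj) (t + 1)).store := by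
    rw [hhalt]
    obtain ⟨h1, h2, h3, h4, h5, h6⟩ := hrep
    exact ⟨h1, h2, h3, h4, h5, h6⟩
  -- The step that ends the outer loop is placed at the moment when the program halts.
  obtain ⟨N, f, h0, hN, hf⟩ := (htr.tail (c := (_, t + 1))
    ⟨.stop_while s hs hcard, by simp only; omega, hhalted⟩).exists_seq
  refine ⟨N, fun i => (f i).1, fun i => (f i).2, by simp [h0],
    fun i hi => ⟨(hf i hi).1, (hf i hi).2.1⟩,
    by simp [hN], fun i hi => ?_, by simp [hN, hhalt], ?_⟩
  · rcases i with _ | i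
    · simp only [h0]
      exact hsim.represents
    · exact (hf i hi).2.2
  · simp only [hN]
    have hn : n ≤ G.edgeSet.ncard + 1 := by
      have := hG.card_vert_le_card_edgeSet_add_one
      rwa [Nat.card_eq_fintype_card, Fintype.card_fin, Nat.card_coe_set_eq] at this
    have hpos : 0 < n := Fin.pos_iff_nonempty.2 hG.nonempty
    obtain ⟨k, hk⟩ := he
    rw [base_input hL] at ht
    -- From n ≤ m + 1 the left side is at most 47m + 47; a positive even n is at least 2, so m ≥ 1
    -- and this is at most 94m.
    have hle : 6 * G.edgeSet.ncard + 41 * n + 6 ≤ 94 * G.edgeSet.ncard := by omega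
    have := ht.trans (Nat.mul_le_mul_left _ hle)
    calc t + 1 ≤ (body.cost + 1) * (94 * G.edgeSet.ncard) + G.edgeSet.ncard := by omega
      _ = _ := by ring

end Implementation

end PMinCF

theorem theorem1 :
    -- correctness, for all choices that the algorithm can make
    (∀ (V : Type*) [Fintype V] [DecidableEq V] (G : SimpleGraph V),
      G.Connected → ClawFree G → Even (Fintype.card V) → PMinCF.WorksCorrectly G) ∧
    -- an implementation with running time `O(m(G))`
    (∃ (p : RAM.Cmd) (C : ℕ), ∀ (n : ℕ) (G : SimpleGraph (Fin n)) (adj : Fin n → List (Fin n)),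
      RAM.IsNeighborhoodLists G adj → G.Connected → ClawFree G → Even n →
        PMinCF.ImplementedWithin p G adj (C * G.edgeSet.ncard)) ∧
    -- linear-time recognition of the claw-free graphs with a unique perfect matching
    (∃ (p : RAM.Cmd) (C : ℕ), ∀ (n : ℕ) (G : SimpleGraph (Fin n)) (adj : Fin n → List (Fin n)),
      RAM.IsNeighborhoodLists G adj → ClawFree G →
        RAM.DecidesWithin p adj (HasUniquePerfectMatching G) (C * (n + G.edgeSet.ncard + 1))) := by
  refine ⟨fun V _ _ G hG hc he => PMinCF.worksCorrectly hG hc he,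
    ⟨_, _, fun n G adj hadj hG hc he => PMinCF.Implementation.implementedWithin hadj hG hc he⟩,
    ⟨_, _, fun n G adj hadj hG => RAM.Recognition.decidesWithin hadj hG⟩⟩
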